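/- **Setting.** Let $d\ge 3$, $U=\{z\in\mathbb{Z}^d:|z_1|+\cdots+|z_d|=1\}$, and let $\Omega$ be the set of all $\omega=(\omega_{n,x})_{n\in\mathbb{Z},x\in\mathbb{Z}^d}$, where each $\omega_{n,x}=(\pi_{n,n+1}(x,x+z))_{z\in U}$ is a probability vector on $U$. Let $\mathbb{P}$ be a probability measure on $\Omega$ (with the product $\sigma$-algebra) under which the $\omega_{n,x}$ are i.i.d., and assume that for some $c_1>0$, $\mathbb{P}(\pi_{0,1}(0,z)\ge c_1)=1$ for every $z\in U$. For $n\in\mathbb{Z}$ let $\mathcal{B}_n^+$ (resp. $\mathcal{B}_n^-$) be generated by the $\omega_{m,x}$ with $m\ge n$ (resp. $m\le n$), and put $(T_{m,y}\omega)_{n,x}=\omega_{n+m,x+y}$. Under $P^\omega_{o,o}$ the walk $(X_n)_{n\ge0}$ starts at $X_0=0$ at time $0$ and jumps at time $n$ from $x$ to $x+z$ with probability $\pi_{n,n+1}(x,x+z)$; $Z_i=X_i-X_{i-1}$; $E_{o,o}$ is the expectation under $\mathbb{P}\times P^\omega_{o,o}$. Let $q(z)=\mathbb{E}[\pi_{0,1}(0,z)]$,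 $\xi_o=\sum_{z\in U}q(z)z$, $\Lambda_c(\theta)=\log\sum_{z\in U}q(z)e^{\langle\theta,z\rangle}$ and $I_c(\xi)=\sup_\theta\{\langle\theta,\xi\rangle-\Lambda_c(\theta)\}$. **Theorem.** There is $\eta>0$ such that, for $\mathbb{P}$-a.e. $\omega$, the laws of $X_n/n$ under $P^\omega_{o,o}$ satisfy the large deviation principle in the $\eta$-neighborhood of $\xi_o$ with rate function $I_c$ (that is, on this ball $I_c$ is nonnegative and lower semicontinuous, and for every Borel subset $G$ of it $$-\inf_{G^o}I_c\le\liminf_{n\to\infty}\tfrac1n\log P^\omega_{o,o}(X_n/n\in G)\le\limsup_{n\to\infty}\tfrac1n\log P^\omega_{o,o}(X_n/n\in G)\le-\inf_{\overline G}I_c\,),$$ and such that for every $\xi\in\mathbb{R}^d$ with $|\xi-\xi_o|<\eta$ the following holds. 1. There is a unique $\theta\in\mathbb{R}^d$ with $\nabla\Lambda_c(\theta)=\xi$, and there is a unique probability measure $\bar\mu_\xi^\infty$ on $\Omega\times U^{\mathbb{N}}$ such that for all integers $N,M,K\ge0$, with $L=N+M+K+1$, and every bounded $f(\omega,(z_i)_{i\ge1})$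 which does not depend on $(z_i)_{i>K}$ and is $\mathcal{B}_{-N}^+\cap\mathcal{B}_M^-$-measurable in $\omega$, $$\int f\,d\bar\mu_\xi^\infty=E_{o,o}\left[e^{\langle\theta,X_L\rangle-L\Lambda_c(\theta)}f(T_{N,X_N}\omega,(Z_{N+i})_{i\ge1})\right].$$ Let $\mu_\xi^\infty$ be the law of $(T_{k,z_1+\cdots+z_k}\omega)_{k\ge0}$ under $\bar\mu_\xi^\infty$. 2. There is a $\mathcal{B}_0^+$-measurable function $u^\theta:\Omega\to(0,\infty)$ with $\int u^\theta\,d\mathbb{P}=1$ and, $\mathbb{P}$-a.s., $$u^\theta(\omega)=\sum_{z\in U}\pi_{0,1}(0,z)\,e^{\langle\theta,z\rangle-\Lambda_c(\theta)}\,u^\theta(T_{1,z}\omega),$$ so that the kernel $\overline\pi^\theta$ on $\Omega$ which moves $\omega$ to $T_{1,z}\omega$ with weight $$\pi_{0,1}(0,z)\,\frac{u^\theta(T_{1,z}\omega)}{u^\theta(\omega)}\,e^{\langle\theta,z\rangle-\Lambda_c(\theta)},\qquad z\in U,$$ is a probability kernel for $\mathbb{P}$-a.e. $\omega$, and the following is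 true: $\mu_\xi^\infty$ is the law of a stationary Markov process $(w_k)_{k\ge0}$ with transition kernel $\overline\pi^\theta$ whose one-dimensional marginal is absolutely continuous with respect to $\mathbb{P}$ on $\mathcal{B}_n^+$ for every $n\in\mathbb{Z}$, and it is the only law on $\Omega^{\mathbb{N}}$ with these properties. -/

import Mathlib

open MeasureTheory Filter Topology
open scoped RealInnerProductSpace

noncomputable section

namespace SpaceTimeRWRE

/-- The set `U` of nearest-neighbour steps: the points of `ℤ^d` with `ℓ¹` norm one. -/
abbrev Step (d : ℕ) : Type := {z : Fin d → ℤ // ∑ i, |z i| = 1}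

theorem finite_step (d : ℕ) : Finite (Step d) := by
  refine Set.Finite.to_subtype ((Set.finite_Icc (-1 : Fin d → ℤ) 1).subset ?_)
  intro z hz
  have hz' : ∑ i, |z i| = 1 := hz
  have h : ∀ i, |z i| ≤ 1 := fun i => by
    rw [← hz']
    exact Finset.single_le_sum (f := fun i => |z i|) (fun j _ => abs_nonneg _)
      (Finset.mem_univ i)
  exact ⟨fun i => (abs_le.mp (h i)).1, fun i => (abs_le.mp (h i)).2⟩

instance instFintypeStep (d : ℕ) : Fintype (Step d) :=
  haveI := finite_step d
  Fintype.ofFinite _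

/-- The environment at one space-time point: a probability vector on the steps. -/
abbrev SiteEnv (d : ℕ) : Type := stdSimplex ℝ (Step d)

/-- The space `Ω` of environments `ω = (ω_{n,x})`, `n ∈ ℤ`, `x ∈ ℤ^d`, with the product
`σ`-algebra `𝓑`. -/
abbrev Env (d : ℕ) : Type := ℤ × (Fin d → ℤ) → SiteEnv d

variable {d : ℕ}

/-- `π_{n,n+1}(x, x + z)`. -/
def transProb (ω : Env d) (n : ℤ) (x : Fin d → ℤ) (z : Step d) : ℝ := (ω (n, x)).1 z

/-- The space-time shift: `(T_{m,y} ω)_{n,x} = ω_{n+m,x+y}`. -/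
def shift (m : ℤ) (y : Fin d → ℤ) (ω : Env d) : Env d := fun p => ω (p.1 + m, p.2 + y)

/-- `𝓑_n^+`, generated by the `ω_{m,x}` with `m ≥ n`. -/
def futureSigma (d : ℕ) (n : ℤ) : MeasurableSpace (Env d) :=
  ⨆ (m : ℤ) (_ : n ≤ m) (x : Fin d → ℤ),
    MeasurableSpace.comap (fun ω : Env d => ω (m, x)) inferInstance

/-- `𝓑_n^-`, generated by the `ω_{m,x}` with `m ≤ n`. -/
def pastSigma (d : ℕ) (n : ℤ) : MeasurableSpace (Env d) :=
  ⨆ (m : ℤ) (_ : m ≤ n) (x : Fin d → ℤ),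
    MeasurableSpace.comap (fun ω : Env d => ω (m, x)) inferInstance

/-- The law `ℙ` of the environment: the `ω_{n,x}` are i.i.d. with common law `ρ`. -/
def envLaw (ρ : Measure (SiteEnv d)) [IsProbabilityMeasure ρ] : Measure (Env d) :=
  Measure.infinitePi (fun _ : ℤ × (Fin d → ℤ) => ρ)

/-- A lattice point seen as a vector of Euclidean space. -/
def toVec (x : Fin d → ℤ) : EuclideanSpace ℝ (Fin d) := WithLp.toLp 2 (fun i => (x i : ℝ))

/-- `q(z) = 𝔼[π_{0,1}(0, z)]`. -/
def meanProb (ρ : Measure (SiteEnv d)) [IsProbabilityMeasure ρ] (z : Step d) : ℝ :=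
  ∫ ω, transProb ω 0 0 z ∂(envLaw ρ)

/-- The limiting velocity `ξ_o = ∑ z, q(z) z`. -/
def meanVelocity (ρ : Measure (SiteEnv d)) [IsProbabilityMeasure ρ] :
    EuclideanSpace ℝ (Fin d) :=
  ∑ z : Step d, meanProb ρ z • toVec z.1

/-- The logarithmic moment generating function `Λ_c`. -/
def logMGF (ρ : Measure (SiteEnv d)) [IsProbabilityMeasure ρ]
    (θ : EuclideanSpace ℝ (Fin d)) : ℝ :=
  Real.log (∑ z : Step d, meanProb ρ z * Real.exp ⟪θ, toVec z.1⟫)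

/-- The rate function `I_c` of the averaged large deviation principle: the convex conjugate
of `Λ_c`. -/
def averagedRate (ρ : Measure (SiteEnv d)) [IsProbabilityMeasure ρ]
    (ξ : EuclideanSpace ℝ (Fin d)) : EReal :=
  ⨆ θ : EuclideanSpace ℝ (Fin d), ((⟪θ, ξ⟫ - logMGF ρ θ : ℝ) : EReal)

/-- The position `X_k = Z_1 + ⋯ + Z_k` of the walk started at the origin, for a finite
sequence of steps (`z i` is the step `Z_{i+1}`). -/
def pathPos {n : ℕ} (z : Fin n → Step d) (k : ℕ) : Fin d → ℤ :=
  ∑ i : Fin n with i.val < k, (z i).1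

/-- The quenched probability `P_{o,o}^ω (Z_1 = z 0, …, Z_n = z (n-1))`. -/
def quenchedProb (ω : Env d) {n : ℕ} (z : Fin n → Step d) : ℝ :=
  ∏ i : Fin n, transProb ω (i.val : ℤ) (pathPos z i.val) (z i)

/-- The averaged expectation `E_{o,o}[F(ω, (Z_1, …, Z_n))]`, i.e. the `ℙ`-mean of the
expectation under the quenched law of the first `n` steps. -/
def averagedExp (ρ : Measure (SiteEnv d)) [IsProbabilityMeasure ρ] (n : ℕ)
    (F : Env d → (Fin n → Step d) → ℝ) : ℝ :=
  ∫ ω, ∑ z : Fin n → Step d, quenchedProb ω z * F ω z ∂(envLaw ρ)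

/-- The quenched law of the mean velocity `X_n / n`. -/
def quenchedVelocityLaw (ω : Env d) (n : ℕ) : Measure (EuclideanSpace ℝ (Fin d)) :=
  ∑ z : Fin n → Step d,
    ENNReal.ofReal (quenchedProb ω z) • Measure.dirac ((n : ℝ)⁻¹ • toVec (pathPos z n))

/-- The sequence `Q` satisfies the large deviation principle in the open set `V`, with rate
function `I`. -/
def LDPOn (V : Set (EuclideanSpace ℝ (Fin d)))
    (Q : ℕ → Measure (EuclideanSpace ℝ (Fin d)))
    (I : EuclideanSpace ℝ (Fin d) → EReal) : Prop :=
  (∀ x ∈ V, 0 ≤ I x) ∧ LowerSemicontinuousOn I V ∧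
  ∀ G : Set (EuclideanSpace ℝ (Fin d)), G ⊆ V → MeasurableSet G →
    -(⨅ x ∈ interior G, I x) ≤
        liminf (fun n : ℕ => (((n : ℝ)⁻¹ : ℝ) : EReal) * ENNReal.log (Q n G)) atTop ∧
    limsup (fun n : ℕ => (((n : ℝ)⁻¹ : ℝ) : EReal) * ENNReal.log (Q n G)) atTop ≤
        -(⨅ x ∈ closure G, I x)

/-- `m` is the measure `μ̄_ξ^∞` on `Ω × U^ℕ`, where `ξ = ∇Λ_c(θ)`: for all `N M K` and every
bounded `f(ω, z_1, …, z_K)` that is `𝓑_{-N}^+ ∩ 𝓑_M^-`-measurable in `ω`, with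
`L = N + M + K + 1`,
`∫ f dm = E_{o,o}[exp (⟨θ, X_L⟩ - L Λ_c(θ)) f(T_{N,X_N} ω, Z_{N+1}, …, Z_{N+K})]`.
In `U^ℕ` the coordinate with index `i` is `z_{i+1}`. -/
def IsTiltedMeasure (ρ : Measure (SiteEnv d)) [IsProbabilityMeasure ρ]
    (θ : EuclideanSpace ℝ (Fin d)) (m : Measure (Env d × (ℕ → Step d))) : Prop :=
  IsProbabilityMeasure m ∧
  ∀ (N M K : ℕ) (f : Env d → (Fin K → Step d) → ℝ),
    (∃ C : ℝ, ∀ ω z, |f ω z| ≤ C) →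
    (∀ z, Measurable[futureSigma d (-(N : ℤ)) ⊓ pastSigma d (M : ℤ)] (fun ω => f ω z)) →
    ∫ p, f p.1 (fun i : Fin K => p.2 i.val) ∂m =
      averagedExp ρ (N + M + K + 1) (fun ω z =>
        Real.exp (⟪θ, toVec (pathPos z (N + M + K + 1))⟫
          - ((N + M + K + 1 : ℕ) : ℝ) * logMGF ρ θ) *
        f (shift (N : ℤ) (pathPos z N) ω)
          (fun i : Fin K => z ⟨N + i.val, by have := i.isLt; omega⟩))

/-- The map `(ω, (z_i)) ↦ (T_{k, z_1 + ⋯ + z_k} ω)_{k ≥ 0}`. -/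
def envTrajectory (p : Env d × (ℕ → Step d)) : ℕ → Env d :=
  fun k => shift (k : ℤ) (∑ i ∈ Finset.range k, (p.2 i).1) p.1

/-- The transform of the kernel of the environment Markov chain by `θ` and `u`: from `ω` it
goes to `T_{1,z} ω` with weight
`π_{0,1}(0, z) (u(T_{1,z} ω) / u(ω)) exp (⟨θ, z⟩ - Λ_c(θ))`. -/
def doobKernel (ρ : Measure (SiteEnv d)) [IsProbabilityMeasure ρ]
    (θ : EuclideanSpace ℝ (Fin d)) (u : Env d → ℝ) (ω : Env d) : Measure (Env d) :=
  ∑ z : Step d,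
    ENNReal.ofReal (transProb ω 0 0 z * (u (shift 1 z.1 ω) / u ω) *
        Real.exp (⟪θ, toVec z.1⟫ - logMGF ρ θ)) •
      Measure.dirac (shift 1 z.1 ω)

/-- `P` is the law of a stationary Markov process `(w_k)_{k ≥ 0}` with transition kernel `κ`:
it is a shift-invariant probability measure, and the conditional law of `w_{n+1}` given
`w_0, …, w_n` is `κ(w_n, ·)`. -/
def IsStationaryMarkov {S : Type*} [MeasurableSpace S] (κ : S → Measure S)
    (P : Measure (ℕ → S)) : Prop :=
  IsProbabilityMeasure P ∧
  P.map (fun w k => w (k + 1)) = P ∧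
  ∀ (n : ℕ) (B : Set (Fin (n + 1) → S)) (A : Set S), MeasurableSet B → MeasurableSet A →
    P {w | (fun i : Fin (n + 1) => w i.val) ∈ B ∧ w (n + 1) ∈ A} =
      ∫⁻ w in {w | (fun i : Fin (n + 1) => w i.val) ∈ B}, κ (w n) A ∂P

/-- The one-dimensional marginal of the process `P` is absolutely continuous with respect to
`ℙ` on every `𝓑_n^+`. -/
def MarginalAC (ρ : Measure (SiteEnv d)) [IsProbabilityMeasure ρ]
    (P : Measure (ℕ → Env d)) : Prop :=
  ∀ (n : ℤ) (A : Set (Env d)), MeasurableSet[futureSigma d n] A →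
    envLaw ρ A = 0 → P.map (fun w => w 0) A = 0

end SpaceTimeRWRE

end

open MeasureTheory Filter Topology
open scoped RealInnerProductSpace ENNReal Matrix

noncomputable section

namespace SpaceTimeRWRE

/-! Everything rests on the normalized partition function `polymer`, W_n = E^ω[exp(⟨θ, X_n⟩ - n
Λ_c(θ))], a nonnegative martingale of mean one along the layers of the environment. Its second
moment follows two walks in a common environment. Their difference has independent tilted steps
except at the origin, where the two walks use the same site. In dimension at least three this
difference is transient enough to have a bounded superharmonic function that survives small tilts
(`exists_superharmonic`). Hence W_n is bounded in L² for small θ (`exists_lintegral_polymer_sq_le`)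
and converges almost surely and in L¹ to a limit u of mean one. A zero-one law makes u positive
(`exists_density`), and the one-step recursion of W_n passes to the limit as the fixed point
equation.

Large deviations: W_n tends to a positive limit, so the quenched exponential moments grow at the
averaged rate Λ_c for all small θ. A local Gärtner–Ellis argument (`HasExpRate.exists_decay`,
`HasExpRate.le_measure_ball`) then applies at the velocities ∇Λ_c(θ), and strict convexity of Λ_c
shows that these fill a neighborhood of ξ_o (`exists_tilt`).

The tilted measure: the walk meets a fresh layer at every time, so under the tilted averaged measure
the pairs (step, current layer seen from the walk) are i.i.d. with law `stepLaw`. Extending this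
sequence to all integer times gives `walkLaw`, and `walkEnv` decodes it into an environment around
the walk (`lintegral_walkLaw`). The measure of the theorem is an image of `walkLaw`, and
stationarity is invariance under the time shift. On the future the law of `walkEnv` has density u,
and conditioning the first step on the environment and the past of the walk produces exactly the
kernel transformed by u (`IsFutureDensity.lintegral_firstStep_past`).

Uniqueness: a function of finitely many future layers and a function of the environment seen much
later use disjoint blocks of the i.i.d. sequence, so they are exactly independent
(`IsFutureDensity.lintegral_mul_iterate`). Any competing marginal has an integrable density with
respect to the law of `walkEnv` on the future. Approximating this density in L¹ by functions of
finitely many layers and iterating the kernel identifies the two marginals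
(`IsFutureDensity.marginal_unique`). -/

/-! ### Product measures: mixing, reindexing and cylinder `σ`-algebras -/

section Product

variable {ι α β : Type*}

open Classical in
/-- The point of `ι → α` with coordinates from `p.1` on `S` and from `p.2` off `S`. -/
def mixOn (S : Set ι) (p : (ι → α) × (ι → α)) : ι → α :=
  fun i => if i ∈ S then p.1 i else p.2 i

theorem mixOn_of_mem {S : Set ι} {i : ι} (h : i ∈ S) (p : (ι → α) × (ι → α)) :
    mixOn S p i = p.1 i := if_pos h

theorem mixOn_of_notMem {S : Set ι} {i : ι} (h : i ∉ S) (p : (ι → α) × (ι → α)) :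
    mixOn S p i = p.2 i := if_neg h

variable [MeasurableSpace α]

@[fun_prop]
theorem measurable_mixOn (S : Set ι) : Measurable (mixOn S : (ι → α) × (ι → α) → ι → α) := by
  refine measurable_pi_lambda _ fun i => ?_
  by_cases h : i ∈ S
  · simp only [mixOn_of_mem h]; fun_prop
  · simp only [mixOn_of_notMem h]; fun_prop

/-- Resampling the coordinates off `S` from an independent copy does not change a product law. All
uses of independence below go through this map. -/
theorem measurePreserving_mixOn (P : Measure α) [IsProbabilityMeasure P] (S : Set ι) :
    MeasurePreserving (mixOn S)
      ((Measure.infinitePi fun _ : ι => P).prod (Measure.infinitePi fun _ : ι => P))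
      (Measure.infinitePi fun _ : ι => P) := by
  classical
  refine ⟨measurable_mixOn S, Measure.eq_infinitePi _ fun s t ht => ?_⟩
  have hpre : mixOn S ⁻¹' (Set.pi s t) =
      (Set.pi (s.filter (· ∈ S) : Finset ι) t) ×ˢ (Set.pi (s.filter (· ∉ S) : Finset ι) t) := by
    ext p
    simp only [Set.mem_preimage, Set.mem_pi, SetLike.mem_coe, Set.mem_prod, Finset.mem_filter]
    constructor
    · intro h
      exact ⟨fun i hi => by simpa [mixOn_of_mem hi.2] using h i hi.1,
        fun i hi => by simpa [mixOn_of_notMem hi.2] using h i hi.1⟩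
    · rintro ⟨h₁, h₂⟩ i hi
      by_cases hS : i ∈ S
      · rw [mixOn_of_mem hS]; exact h₁ i ⟨hi, hS⟩
      · rw [mixOn_of_notMem hS]; exact h₂ i ⟨hi, hS⟩
  have hms : MeasurableSet (Set.pi (s : Set ι) t) :=
    MeasurableSet.pi s.countable_toSet fun i _ => ht i
  rw [Measure.map_apply (measurable_mixOn S) hms, hpre, Measure.prod_prod,
    Measure.infinitePi_pi _ fun i _ => ht i, Measure.infinitePi_pi _ fun i _ => ht i,
    Finset.prod_filter_mul_prod_filter_not]

theorem measurePreserving_comp_injective {κ : Type*} (P : Measure α) [IsProbabilityMeasure P]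
    {g : κ → ι} (hg : Function.Injective g) :
    MeasurePreserving (fun (ω : ι → α) k => ω (g k))
      (Measure.infinitePi fun _ : ι => P) (Measure.infinitePi fun _ : κ => P) :=
  ⟨by fun_prop, Measure.map_infinitePi_infinitePi_of_inj (P := fun _ : ι => P) hg⟩

/-- The `σ`-algebra generated by the coordinates in `S`. -/
abbrev cylSigma (α : Type*) [MeasurableSpace α] (S : Set ι) : MeasurableSpace (ι → α) :=
  ⨆ i ∈ S, MeasurableSpace.comap (fun ω => ω i) inferInstance

theorem cylSigma_le (S : Set ι) : cylSigma α S ≤ MeasurableSpace.pi :=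
  iSup₂_le fun i _ => (measurable_pi_apply i).comap_le

theorem cylSigma_mono {S T : Set ι} (h : S ⊆ T) : cylSigma α S ≤ cylSigma α T :=
  iSup₂_le fun i hi => le_iSup₂_of_le i (h hi) le_rfl

theorem cylSigma_le_comap (S : Set ι) :
    cylSigma α S ≤ MeasurableSpace.comap S.domRestrict MeasurableSpace.pi := by
  refine iSup₂_le fun i hi => ?_
  have : (fun ω : ι → α => ω i) = (fun v : S → α => v ⟨i, hi⟩) ∘ S.domRestrict := rfl
  rw [this, ← MeasurableSpace.comap_comp]
  exact MeasurableSpace.comap_mono (measurable_pi_apply _).comap_le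

/-- With its converse below, this allows σ-algebras of layers to be replaced by pointwise dependence
on coordinates, which composes easily with shifts. -/
theorem dependsOn_of_measurable_cylSigma [MeasurableSpace β] [MeasurableSingletonClass β]
    {S : Set ι} {f : (ι → α) → β} (hf : Measurable[cylSigma α S] f) : DependsOn f S := by
  intro x y hxy
  obtain ⟨t, -, ht⟩ := cylSigma_le_comap S _ (hf (measurableSet_singleton (f x)))
  have hx : x ∈ S.domRestrict ⁻¹' t := by rw [ht]; rfl
  have hy : y ∈ S.domRestrict ⁻¹' t := by
    have : (S.domRestrict y : S → α) = S.domRestrict x := by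
      ext i; exact (hxy i i.2).symm
    rw [Set.mem_preimage, this]; exact hx
  rw [ht] at hy
  exact hy.symm

theorem measurable_cylSigma_of_dependsOn [MeasurableSpace β] [Nonempty α]
    {S : Set ι} {f : (ι → α) → β} (hf : Measurable f) (hS : DependsOn f S) :
    Measurable[cylSigma α S] f := by
  obtain ⟨a⟩ := ‹Nonempty α›
  -- Freezing the coordinates off `S` at an arbitrary value leaves `f` unchanged and makes it
  -- visibly a function of the coordinates in `S`.
  have hfact : f = f ∘ fun ω => mixOn S (ω, fun _ => a) := by
    funext ω
    exact hS fun i hi => (mixOn_of_mem hi (ω, fun _ => a)).symm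
  have hproj : Measurable[cylSigma α S] fun ω : ι → α => mixOn S (ω, fun _ => a) := by
    refine (@measurable_pi_iff _ _ _ (cylSigma α S) _ _).2 fun i => ?_
    by_cases h : i ∈ S
    · simp only [mixOn_of_mem h]
      exact Measurable.of_comap_le (le_iSup₂_of_le i h le_rfl)
    · simp only [mixOn_of_notMem h]
      exact measurable_const
  rw [hfact]
  exact hf.comp hproj

theorem lintegral_mul_of_dependsOn (P : Measure α) [IsProbabilityMeasure P] {S : Set ι}
    {f g : (ι → α) → ℝ≥0∞} (hf : Measurable f) (hg : Measurable g) (hfS : DependsOn f S)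
    (hgS : DependsOn g Sᶜ) :
    ∫⁻ ω, f ω * g ω ∂(Measure.infinitePi fun _ : ι => P) =
      (∫⁻ ω, f ω ∂(Measure.infinitePi fun _ : ι => P)) *
        ∫⁻ ω, g ω ∂(Measure.infinitePi fun _ : ι => P) := by
  rw [← (measurePreserving_mixOn P S).lintegral_comp (f := fun ω => f ω * g ω) (hf.mul hg),
    ← lintegral_prod_mul hf.aemeasurable hg.aemeasurable]
  refine lintegral_congr fun p => ?_
  rw [hfS (y := p.1) fun i hi => mixOn_of_mem hi p, hgS (y := p.2) fun i hi => mixOn_of_notMem hi p]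

end Product

/-- Finite measures which agree on an increasing sequence of `σ`-algebras agree on their
supremum. -/
theorem measure_eq_of_iSup {X : Type*} {mX : MeasurableSpace X} {μ ν : Measure X}
    [IsFiniteMeasure μ] {m : ℕ → MeasurableSpace X} (hmono : Monotone m) (hle : ∀ n, m n ≤ mX)
    (h : ∀ n s, MeasurableSet[m n] s → μ s = ν s) {s : Set X} (hs : MeasurableSet[⨆ n, m n] s) :
    μ s = ν s := by
  have hsup : ⨆ n, m n ≤ mX := iSup_le hle
  have hpi : IsPiSystem (⋃ n, {s | MeasurableSet[m n] s}) :=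
    isPiSystem_iUnion_of_monotone _ (fun n => @MeasurableSpace.isPiSystem_measurableSet X (m n))
      fun i j hij s hs => hmono hij s hs
  have htrim : μ.trim hsup = ν.trim hsup := by
    refine ext_of_generate_finite (m0 := ⨆ n, m n) _
      (MeasurableSpace.generateFrom_iUnion_measurableSet m).symm hpi ?_ ?_
    · intro s hs
      obtain ⟨n, hn⟩ := Set.mem_iUnion.1 hs
      have hn' : MeasurableSet[⨆ n, m n] s := le_iSup m n s hn
      rw [trim_measurableSet_eq hsup hn', trim_measurableSet_eq hsup hn']
      exact h n s hn
    · rw [trim_measurableSet_eq hsup MeasurableSet.univ, trim_measurableSet_eq hsup MeasurableSet.univ]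
      exact h 0 _ MeasurableSet.univ
  rw [← trim_measurableSet_eq hsup hs, ← trim_measurableSet_eq hsup hs, htrim]

/-- Measures which agree on a sub-`σ`-algebra give the same integral to its functions. -/
theorem lintegral_eq_of_agree {X : Type*} {m mX : MeasurableSpace X} {μ ν : Measure X}
    (hm : m ≤ mX) (h : ∀ s, MeasurableSet[m] s → μ s = ν s) {f : X → ℝ≥0∞}
    (hf : Measurable[m] f) : ∫⁻ x, f x ∂μ = ∫⁻ x, f x ∂ν := by
  have htrim : μ.trim hm = ν.trim hm := by
    refine @Measure.ext _ m _ _ fun s hs => ?_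
    rw [trim_measurableSet_eq hm hs, trim_measurableSet_eq hm hs, h s hs]
  rw [← lintegral_trim hm hf, ← lintegral_trim hm hf, htrim]

/-! ### Environments, shifts and paths -/

variable {d : ℕ}

theorem futureSigma_eq (n : ℤ) :
    futureSigma d n = cylSigma (SiteEnv d) {p : ℤ × (Fin d → ℤ) | n ≤ p.1} := by
  refine le_antisymm (iSup₂_le fun m hm => iSup_le fun x => ?_) (iSup₂_le fun p hp => ?_)
  · exact le_iSup₂_of_le (f := fun (i : ℤ × (Fin d → ℤ)) _ =>
      MeasurableSpace.comap (fun ω : Env d => ω i) inferInstance) (m, x) hm le_rfl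
  · exact le_iSup₂_of_le p.1 hp (le_iSup_of_le p.2 le_rfl)

theorem pastSigma_eq (n : ℤ) :
    pastSigma d n = cylSigma (SiteEnv d) {p : ℤ × (Fin d → ℤ) | p.1 ≤ n} := by
  refine le_antisymm (iSup₂_le fun m hm => iSup_le fun x => ?_) (iSup₂_le fun p hp => ?_)
  · exact le_iSup₂_of_le (f := fun (i : ℤ × (Fin d → ℤ)) _ =>
      MeasurableSpace.comap (fun ω : Env d => ω i) inferInstance) (m, x) hm le_rfl
  · exact le_iSup₂_of_le p.1 hp (le_iSup_of_le p.2 le_rfl)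

instance (ρ : Measure (SiteEnv d)) [IsProbabilityMeasure ρ] : IsProbabilityMeasure (envLaw ρ) := by
  unfold envLaw; infer_instance

theorem shift_apply (m : ℤ) (y : Fin d → ℤ) (ω : Env d) (p : ℤ × (Fin d → ℤ)) :
    shift m y ω p = ω (p.1 + m, p.2 + y) := rfl

@[fun_prop]
theorem measurable_shift (m : ℤ) (y : Fin d → ℤ) : Measurable (shift m y) := by
  unfold shift; fun_prop

theorem shift_shift (m n : ℤ) (x y : Fin d → ℤ) (ω : Env d) :
    shift m x (shift n y ω) = shift (m + n) (x + y) ω := by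
  funext p; simp only [shift]; congr 2 <;> abel

@[simp]
theorem shift_zero (ω : Env d) : shift 0 0 ω = ω := by funext p; simp [shift]

theorem measurePreserving_shift (ρ : Measure (SiteEnv d)) [IsProbabilityMeasure ρ] (m : ℤ)
    (y : Fin d → ℤ) : MeasurePreserving (shift m y) (envLaw ρ) (envLaw ρ) :=
  measurePreserving_comp_injective ρ (g := fun p : ℤ × (Fin d → ℤ) => (p.1 + m, p.2 + y))
    fun p q h => by
      simp only [Prod.mk.injEq, add_left_inj] at h
      exact Prod.ext h.1 h.2

@[fun_prop]
theorem measurable_transProb (n : ℤ) (x : Fin d → ℤ) (z : Step d) :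
    Measurable fun ω : Env d => transProb ω n x z := by
  have h1 : Measurable fun v : SiteEnv d => v.1 z := (measurable_pi_apply z).comp measurable_subtype_coe
  exact h1.comp (measurable_pi_apply (n, x))

theorem transProb_nonneg (ω : Env d) (n : ℤ) (x : Fin d → ℤ) (z : Step d) :
    0 ≤ transProb ω n x z := (ω (n, x)).2.1 z

theorem sum_transProb (ω : Env d) (n : ℤ) (x : Fin d → ℤ) :
    ∑ z, transProb ω n x z = 1 := (ω (n, x)).2.2

theorem transProb_le_one (ω : Env d) (n : ℤ) (x : Fin d → ℤ) (z : Step d) :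
    transProb ω n x z ≤ 1 := by
  rw [← sum_transProb ω n x]
  exact Finset.single_le_sum (fun i _ => transProb_nonneg ω n x i) (Finset.mem_univ z)

theorem transProb_shift (m n : ℤ) (x y : Fin d → ℤ) (ω : Env d) (z : Step d) :
    transProb (shift m y ω) n x z = transProb ω (n + m) (x + y) z := rfl

@[simp]
theorem pathPos_zero {n : ℕ} (z : Fin n → Step d) : pathPos z 0 = 0 := by simp [pathPos]

theorem pathPos_cons_succ {n : ℕ} (z₀ : Step d) (z : Fin n → Step d) (k : ℕ) :
    pathPos (Fin.cons z₀ z : Fin (n + 1) → Step d) (k + 1) = z₀.1 + pathPos z k := by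
  simp [pathPos, Finset.sum_filter, Fin.sum_univ_succ]

theorem quenchedProb_cons (ω : Env d) {n : ℕ} (z₀ : Step d) (z : Fin n → Step d) :
    quenchedProb ω (Fin.cons z₀ z : Fin (n + 1) → Step d) =
      transProb ω 0 0 z₀ * quenchedProb (shift 1 z₀.1 ω) z := by
  rw [quenchedProb, Fin.prod_univ_succ]
  congr 1
  · simp
  · refine Finset.prod_congr rfl fun i _ => ?_
    rw [transProb_shift, Fin.cons_succ, Fin.val_succ, pathPos_cons_succ]
    push_cast
    rw [add_comm z₀.1]

theorem quenchedProb_nonneg (ω : Env d) {n : ℕ} (z : Fin n → Step d) : 0 ≤ quenchedProb ω z :=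
  Finset.prod_nonneg fun _ _ => transProb_nonneg _ _ _ _

theorem quenchedProb_le_one (ω : Env d) {n : ℕ} (z : Fin n → Step d) : quenchedProb ω z ≤ 1 :=
  Finset.prod_le_one (fun _ _ => transProb_nonneg _ _ _ _) fun _ _ => transProb_le_one _ _ _ _

@[fun_prop]
theorem measurable_quenchedProb {n : ℕ} (z : Fin n → Step d) :
    Measurable fun ω : Env d => quenchedProb ω z := by
  unfold quenchedProb; fun_prop

theorem quenchedProb_congr {n : ℕ} (z : Fin n → Step d) {ω ω' : Env d}
    (h : ∀ p : ℤ × (Fin d → ℤ), 0 ≤ p.1 → p.1 < n → ω p = ω' p) :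
    quenchedProb ω z = quenchedProb ω' z := by
  refine Finset.prod_congr rfl fun i _ => ?_
  rw [transProb, transProb, h _ (by simp) (by simp)]

/-- Splitting a sum over paths according to the first step. -/
theorem sum_path_succ {M : Type*} [AddCommMonoid M] {n : ℕ} (f : (Fin (n + 1) → Step d) → M) :
    ∑ z, f z = ∑ z₀ : Step d, ∑ z : Fin n → Step d, f (Fin.cons z₀ z) := by
  rw [← (Fin.consEquiv fun _ : Fin (n + 1) => Step d).sum_comp, Fintype.sum_prod_type]
  rfl

theorem toVec_add (x y : Fin d → ℤ) : toVec (x + y) = toVec x + toVec y := by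
  ext i; simp [toVec]

theorem toVec_zero : toVec (0 : Fin d → ℤ) = 0 := by
  ext i; simp [toVec]

/-! ### The tilted step weights -/

section Weights

variable (ρ : Measure (SiteEnv d)) [IsProbabilityMeasure ρ]

theorem meanProb_nonneg (z : Step d) : 0 ≤ meanProb ρ z :=
  integral_nonneg fun ω => transProb_nonneg ω 0 0 z

theorem integrable_transProb (n : ℤ) (x : Fin d → ℤ) (z : Step d) :
    Integrable (fun ω => transProb ω n x z) (envLaw ρ) :=
  Integrable.of_bound (C := 1) (measurable_transProb n x z).aestronglyMeasurable
    (ae_of_all _ fun ω => by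
      rw [Real.norm_of_nonneg (transProb_nonneg _ _ _ _)]; exact transProb_le_one _ _ _ _)

theorem sum_meanProb : ∑ z, meanProb ρ z = 1 := by
  simp only [meanProb]
  rw [← integral_finsetSum _ fun z _ => integrable_transProb ρ 0 0 z]
  simp [sum_transProb]

theorem lintegral_transProb (n : ℤ) (x : Fin d → ℤ) (z : Step d) :
    ∫⁻ ω, ENNReal.ofReal (transProb ω n x z) ∂(envLaw ρ) = ENNReal.ofReal (meanProb ρ z) := by
  rw [meanProb, ofReal_integral_eq_lintegral_ofReal (integrable_transProb ρ 0 0 z)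
    (ae_of_all _ fun ω => transProb_nonneg _ _ _ _),
    ← (measurePreserving_shift ρ n x).lintegral_comp
      (f := fun ω => ENNReal.ofReal (transProb ω 0 0 z)) (by fun_prop)]
  simp [transProb_shift]

theorem exists_meanProb_pos : ∃ z, 0 < meanProb ρ z := by
  by_contra! h
  have := Finset.sum_nonpos fun z (_ : z ∈ Finset.univ) => h z
  rw [sum_meanProb] at this
  linarith

theorem mgf_pos (θ : EuclideanSpace ℝ (Fin d)) :
    0 < ∑ z : Step d, meanProb ρ z * Real.exp ⟪θ, toVec z.1⟫ := by
  obtain ⟨z, hz⟩ := exists_meanProb_pos ρ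
  refine Finset.sum_pos' (fun z _ => mul_nonneg (meanProb_nonneg ρ z) (Real.exp_pos _).le)
    ⟨z, Finset.mem_univ z, mul_pos hz (Real.exp_pos _)⟩

/-- The factor `exp (⟨θ, z⟩ - Λ_c(θ))`. -/
def tiltWeight (θ : EuclideanSpace ℝ (Fin d)) (z : Step d) : ℝ :=
  Real.exp (⟪θ, toVec z.1⟫ - logMGF ρ θ)

theorem tiltWeight_pos (θ : EuclideanSpace ℝ (Fin d)) (z : Step d) : 0 < tiltWeight ρ θ z :=
  Real.exp_pos _

theorem sum_meanProb_mul_tiltWeight (θ : EuclideanSpace ℝ (Fin d)) :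
    ∑ z, meanProb ρ z * tiltWeight ρ θ z = 1 := by
  simp only [tiltWeight, Real.exp_sub, logMGF, Real.exp_log (mgf_pos ρ θ)]
  simp only [← mul_div_assoc]
  rw [← Finset.sum_div, div_self (mgf_pos ρ θ).ne']

/-- The weight `P_{o,o}^ω(Z = z) exp (⟨θ, X_n⟩ - n Λ_c(θ))` of a path. -/
def pathWeight (θ : EuclideanSpace ℝ (Fin d)) (ω : Env d) {n : ℕ} (z : Fin n → Step d) : ℝ :=
  quenchedProb ω z * Real.exp (⟪θ, toVec (pathPos z n)⟫ - (n : ℝ) * logMGF ρ θ)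

theorem pathWeight_nonneg (θ : EuclideanSpace ℝ (Fin d)) (ω : Env d) {n : ℕ}
    (z : Fin n → Step d) : 0 ≤ pathWeight ρ θ ω z :=
  mul_nonneg (quenchedProb_nonneg _ _) (Real.exp_pos _).le

theorem pathWeight_cons (θ : EuclideanSpace ℝ (Fin d)) (ω : Env d) {n : ℕ} (z₀ : Step d)
    (z : Fin n → Step d) :
    pathWeight ρ θ ω (Fin.cons z₀ z : Fin (n + 1) → Step d) =
      transProb ω 0 0 z₀ * tiltWeight ρ θ z₀ * pathWeight ρ θ (shift 1 z₀.1 ω) z := by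
  have : ⟪θ, toVec (z₀.1 + pathPos z n)⟫ - ((n + 1 : ℕ) : ℝ) * logMGF ρ θ =
      (⟪θ, toVec z₀.1⟫ - logMGF ρ θ) + (⟪θ, toVec (pathPos z n)⟫ - (n : ℝ) * logMGF ρ θ) := by
    rw [toVec_add, inner_add_right]; push_cast; ring
  rw [pathWeight, pathWeight, tiltWeight, quenchedProb_cons, pathPos_cons_succ, this, Real.exp_add]
  ring

@[fun_prop]
theorem measurable_pathWeight (θ : EuclideanSpace ℝ (Fin d)) {n : ℕ} (z : Fin n → Step d) :
    Measurable fun ω : Env d => pathWeight ρ θ ω z := by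
  unfold pathWeight; fun_prop

theorem pathWeight_congr (θ : EuclideanSpace ℝ (Fin d)) {n : ℕ} (z : Fin n → Step d)
    {ω ω' : Env d} (h : ∀ p : ℤ × (Fin d → ℤ), 0 ≤ p.1 → p.1 < n → ω p = ω' p) :
    pathWeight ρ θ ω z = pathWeight ρ θ ω' z := by
  rw [pathWeight, pathWeight, quenchedProb_congr z h]

end Weights

/-! ### The tilted walk as a function of an i.i.d. sequence -/

/-- The sequences of pairs (step, environment seen from the walk), indexed by time. Of the
environment attached to time `n`, only the layer of time `0` is used. -/
abbrev Traj (d : ℕ) : Type := ℤ → Step d × Env d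

/-- The law of the first step and of the environment, under the tilted averaged measure. -/
def stepLaw (ρ : Measure (SiteEnv d)) [IsProbabilityMeasure ρ]
    (θ : EuclideanSpace ℝ (Fin d)) : Measure (Step d × Env d) :=
  ∑ z : Step d, ((envLaw ρ).withDensity
    (fun ω => ENNReal.ofReal (transProb ω 0 0 z * tiltWeight ρ θ z))).map (Prod.mk z)

section StepLaw

variable (ρ : Measure (SiteEnv d)) [IsProbabilityMeasure ρ] (θ : EuclideanSpace ℝ (Fin d))

theorem lintegral_stepLaw {f : Step d × Env d → ℝ≥0∞} (hf : Measurable f) :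
    ∫⁻ p, f p ∂(stepLaw ρ θ) =
      ∑ z, ∫⁻ ω, ENNReal.ofReal (transProb ω 0 0 z * tiltWeight ρ θ z) * f (z, ω) ∂(envLaw ρ) := by
  rw [stepLaw, lintegral_finsetSum_measure]
  refine Finset.sum_congr rfl fun z _ => ?_
  rw [lintegral_map hf (by fun_prop), lintegral_withDensity_eq_lintegral_mul _ (by fun_prop)
    (by fun_prop)]
  rfl

instance : IsProbabilityMeasure (stepLaw ρ θ) := by
  constructor
  rw [← lintegral_one, lintegral_stepLaw ρ θ measurable_const]
  have h : ∀ z, ∫⁻ ω, ENNReal.ofReal (transProb ω 0 0 z * tiltWeight ρ θ z) * 1 ∂(envLaw ρ) =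
      ENNReal.ofReal (meanProb ρ z * tiltWeight ρ θ z) := fun z => by
    simp only [mul_one, ENNReal.ofReal_mul' (tiltWeight_pos ρ θ z).le]
    rw [lintegral_mul_const _ (by fun_prop), lintegral_transProb]
  simp only [h]
  rw [← ENNReal.ofReal_sum_of_nonneg fun z _ =>
    mul_nonneg (meanProb_nonneg ρ z) (tiltWeight_pos ρ θ z).le, sum_meanProb_mul_tiltWeight,
    ENNReal.ofReal_one]

/-- The law of the i.i.d. sequence. -/
def walkLaw : Measure (Traj d) := Measure.infinitePi fun _ : ℤ => stepLaw ρ θ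

instance : IsProbabilityMeasure (walkLaw ρ θ) := by unfold walkLaw; infer_instance

end StepLaw

/-- The shift of time. -/
def timeShift (k : ℤ) (ϑ : Traj d) : Traj d := fun n => ϑ (n + k)

@[fun_prop]
theorem measurable_timeShift (k : ℤ) : Measurable (timeShift k : Traj d → Traj d) := by
  unfold timeShift; fun_prop

theorem measurePreserving_timeShift (ρ : Measure (SiteEnv d)) [IsProbabilityMeasure ρ]
    (θ : EuclideanSpace ℝ (Fin d)) (k : ℤ) :
    MeasurePreserving (timeShift k) (walkLaw ρ θ) (walkLaw ρ θ) :=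
  measurePreserving_comp_injective (stepLaw ρ θ) (add_left_injective k)

theorem timeShift_timeShift (j k : ℤ) (ϑ : Traj d) :
    timeShift j (timeShift k ϑ) = timeShift (j + k) ϑ := by
  funext n; simp only [timeShift, add_assoc]

@[simp]
theorem timeShift_zero (ϑ : Traj d) : timeShift 0 ϑ = ϑ := by funext n; simp [timeShift]

/-- The position of the two-sided walk, at the origin at time `0`. -/
def walkPos (ϑ : Traj d) (n : ℤ) : Fin d → ℤ :=
  ∑ i ∈ Finset.Ico 0 n, (ϑ i).1.1 - ∑ i ∈ Finset.Ico n 0, (ϑ i).1.1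

@[simp]
theorem walkPos_zero (ϑ : Traj d) : walkPos ϑ 0 = 0 := by simp [walkPos]

theorem walkPos_add_one (ϑ : Traj d) (n : ℤ) :
    walkPos ϑ (n + 1) = walkPos ϑ n + (ϑ n).1.1 := by
  rcases le_or_gt 0 n with h | h
  · have h1 : Finset.Ico 0 (n + 1) = insert n (Finset.Ico 0 n) := by
      ext i; simp only [Finset.mem_Ico, Finset.mem_insert]; omega
    rw [walkPos, walkPos, h1, Finset.sum_insert (by simp), Finset.Ico_eq_empty (a := n) (by omega),
      Finset.Ico_eq_empty (a := n + 1) (by omega)]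
    simp [add_comm]
  · have h1 : Finset.Ico n 0 = insert n (Finset.Ico (n + 1) 0) := by
      ext i; simp only [Finset.mem_Ico, Finset.mem_insert]; omega
    rw [walkPos, walkPos, h1, Finset.sum_insert (by simp), Finset.Ico_eq_empty (b := n) (by omega),
      Finset.Ico_eq_empty (b := n + 1) (by omega)]
    simp

theorem walkPos_timeShift (ϑ : Traj d) (k n : ℤ) :
    walkPos (timeShift k ϑ) n = walkPos ϑ (n + k) - walkPos ϑ k := by
  induction n using Int.induction_on with
  | zero => simp
  | succ i ih =>
    rw [walkPos_add_one, ih, add_right_comm (i : ℤ) 1 k, walkPos_add_one ϑ (i + k)]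
    simp only [timeShift]; abel
  | pred i ih =>
    have h := walkPos_add_one (timeShift k ϑ) (-(i : ℤ) - 1)
    have h' := walkPos_add_one ϑ (-(i : ℤ) - 1 + k)
    rw [sub_add_cancel, ih] at h
    rw [show -(i : ℤ) - 1 + k + 1 = -(i : ℤ) + k by ring] at h'
    rw [h'] at h
    simp only [timeShift] at h
    rw [eq_sub_of_add_eq h.symm]; abel

@[fun_prop]
theorem measurable_walkPos (n : ℤ) : Measurable fun ϑ : Traj d => walkPos ϑ n := by
  have h : ∀ i : ℤ, Measurable fun ϑ : Traj d => (ϑ i).1.1 := fun i =>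
    measurable_subtype_coe.comp (measurable_fst.comp (measurable_pi_apply i))
  unfold walkPos
  exact (Finset.measurable_sum _ fun i _ => h i).sub (Finset.measurable_sum _ fun i _ => h i)

theorem walkPos_congr {ϑ ϑ' : Traj d} {n : ℤ} (h₁ : ∀ i, 0 ≤ i → i < n → ϑ i = ϑ' i)
    (h₂ : ∀ i, n ≤ i → i < 0 → ϑ i = ϑ' i) : walkPos ϑ n = walkPos ϑ' n := by
  rw [walkPos, walkPos]
  congr 1
  · refine Finset.sum_congr rfl fun i hi => ?_
    rw [Finset.mem_Ico] at hi
    rw [h₁ i hi.1 hi.2]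
  · refine Finset.sum_congr rfl fun i hi => ?_
    rw [Finset.mem_Ico] at hi
    rw [h₂ i hi.1 hi.2]

/-- The environment in which the walk moves. -/
def walkEnv (ϑ : Traj d) : Env d := fun p => (ϑ p.1).2 (0, p.2 - walkPos ϑ p.1)

@[fun_prop]
theorem measurable_walkEnv : Measurable (walkEnv : Traj d → Env d) := by
  refine measurable_pi_lambda _ fun p => ?_
  have h1 : Measurable fun q : (Fin d → ℤ) × Env d => q.2 (0, p.2 - q.1) :=
    measurable_from_prod_countable_right fun x => by simpa using measurable_pi_apply _
  have h2 : Measurable fun ϑ : Traj d => (walkPos ϑ p.1, (ϑ p.1).2) := by fun_prop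
  exact h1.comp h2

/-- Re-centering time in the i.i.d. sequence is the same as viewing the environment from the walker
at time `k`. Invariance of `walkLaw` thereby becomes stationarity of the environment seen from the
walk. -/
theorem walkEnv_timeShift (k : ℤ) (ϑ : Traj d) :
    walkEnv (timeShift k ϑ) = shift k (walkPos ϑ k) (walkEnv ϑ) := by
  funext p
  simp only [walkEnv, shift, walkPos_timeShift, timeShift]
  abel_nf

/-- Layers at times `≥ 0` use only the entries from time `0` up to that layer, while negative layers
use only negative entries. So the past and the future of the decoded environment are independent. -/
theorem walkEnv_congr_future {ϑ ϑ' : Traj d} {p : ℤ × (Fin d → ℤ)} (hp : 0 ≤ p.1)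
    (h : ∀ i, 0 ≤ i → i ≤ p.1 → ϑ i = ϑ' i) : walkEnv ϑ p = walkEnv ϑ' p := by
  rw [walkEnv, walkEnv, h _ hp le_rfl, walkPos_congr (ϑ' := ϑ') (fun i h₀ h₁ => h i h₀ h₁.le)
    fun i h₀ h₁ => by omega]

theorem walkEnv_congr_past {ϑ ϑ' : Traj d} {p : ℤ × (Fin d → ℤ)} (hp : p.1 < 0)
    (h : ∀ i, i < 0 → ϑ i = ϑ' i) : walkEnv ϑ p = walkEnv ϑ' p := by
  rw [walkEnv, walkEnv, h _ hp, walkPos_congr (ϑ' := ϑ') (fun i h₀ h₁ => by omega)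
    fun i h₀ h₁ => h i h₁]

/-- The first `L` steps. -/
def firstSteps (L : ℕ) (ϑ : Traj d) : Fin L → Step d := fun i => (ϑ i.val).1

@[fun_prop]
theorem measurable_firstSteps (L : ℕ) : Measurable (firstSteps L : Traj d → Fin L → Step d) := by
  unfold firstSteps; fun_prop

theorem pathPos_firstSteps {L k : ℕ} (hk : k ≤ L) (ϑ : Traj d) :
    pathPos (firstSteps L ϑ) k = walkPos ϑ k := by
  induction k with
  | zero => simp
  | succ k ih =>
    push_cast
    rw [walkPos_add_one, ← ih (by omega), pathPos, pathPos]
    have : (Finset.univ.filter fun i : Fin L => i.val < k + 1) =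
        insert ⟨k, by omega⟩ (Finset.univ.filter fun i : Fin L => i.val < k) := by
      ext i; simp only [Finset.mem_filter, Finset.mem_univ, true_and, Finset.mem_insert, Fin.ext_iff]
      omega
    rw [this, Finset.sum_insert (by simp), add_comm]
    rfl

/-! ### Peeling off the first layer -/

/-- The environment with the layer of time `0` of `ℓ`, and with `η`, seen from `(-1, -z)`, on the
other layers. -/
def glue (z : Step d) (ℓ η : Env d) : Env d :=
  mixOn {p | p.1 = 0} (ℓ, shift (-1) (-z.1) η)

theorem glue_zero (z : Step d) (ℓ η : Env d) (x : Fin d → ℤ) : glue z ℓ η (0, x) = ℓ (0, x) :=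
  mixOn_of_mem (by simp) _

theorem glue_of_ne (z : Step d) (ℓ η : Env d) {p : ℤ × (Fin d → ℤ)} (hp : p.1 ≠ 0) :
    glue z ℓ η p = η (p.1 - 1, p.2 - z.1) := by
  rw [glue, mixOn_of_notMem (by simpa using hp)]
  simp [shift, sub_eq_add_neg]

theorem shift_glue (z : Step d) (ℓ η : Env d) {p : ℤ × (Fin d → ℤ)} (hp : 0 ≤ p.1) :
    shift 1 z.1 (glue z ℓ η) p = η p := by
  rw [shift_apply, glue_of_ne _ _ _ (by simp only; omega)]
  simp

@[fun_prop]
theorem measurable_glue (z : Step d) : Measurable fun p : Env d × Env d => glue z p.1 p.2 := by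
  unfold glue; fun_prop

theorem measurePreserving_glue (ρ : Measure (SiteEnv d)) [IsProbabilityMeasure ρ] (z : Step d) :
    MeasurePreserving (fun p : Env d × Env d => glue z p.1 p.2)
      ((envLaw ρ).prod (envLaw ρ)) (envLaw ρ) :=
  (measurePreserving_mixOn ρ {p : ℤ × (Fin d → ℤ) | p.1 = 0}).comp
    ((MeasurePreserving.id (envLaw ρ)).prod (measurePreserving_shift ρ (-1) (-z.1)))

theorem lintegral_glue (ρ : Measure (SiteEnv d)) [IsProbabilityMeasure ρ] (z : Step d)
    {f : Env d → ℝ≥0∞} (hf : Measurable f) :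
    ∫⁻ ω, f ω ∂(envLaw ρ) = ∫⁻ ℓ, ∫⁻ η, f (glue z ℓ η) ∂(envLaw ρ) ∂(envLaw ρ) := by
  rw [← (measurePreserving_glue ρ z).lintegral_comp hf, lintegral_prod _ (by fun_prop)]

/-- The sequence with value `a` at time `0`, followed by `ϑ`. -/
def consTraj (a : Step d × Env d) (ϑ : Traj d) : Traj d :=
  mixOn {0} (fun _ => a, timeShift (-1) ϑ)

@[simp]
theorem consTraj_zero (a : Step d × Env d) (ϑ : Traj d) : consTraj a ϑ 0 = a :=
  mixOn_of_mem (by simp) _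

theorem consTraj_add_one (a : Step d × Env d) (ϑ : Traj d) {n : ℤ} (hn : 0 ≤ n) :
    consTraj a ϑ (n + 1) = ϑ n := by
  rw [consTraj, mixOn_of_notMem (by simp only [Set.mem_singleton_iff]; omega)]
  simp [timeShift]

@[fun_prop]
theorem measurable_consTraj :
    Measurable fun p : (Step d × Env d) × Traj d => consTraj p.1 p.2 := by
  unfold consTraj; fun_prop

/-- The entry at time `0` is independent of the others. The entry of `ϑ` at time `-1` is overwritten
by `a`, which is harmless because all entries are i.i.d. -/
theorem lintegral_consTraj (ρ : Measure (SiteEnv d)) [IsProbabilityMeasure ρ]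
    (θ : EuclideanSpace ℝ (Fin d)) {f : Traj d → ℝ≥0∞} (hf : Measurable f) :
    ∫⁻ ϑ, f ϑ ∂(walkLaw ρ θ) =
      ∫⁻ a, ∫⁻ ϑ, f (consTraj a ϑ) ∂(walkLaw ρ θ) ∂(stepLaw ρ θ) := by
  have h1 : MeasurePreserving (fun ϑ : Traj d => ϑ 0) (walkLaw ρ θ) (stepLaw ρ θ) :=
    measurePreserving_eval_infinitePi (fun _ : ℤ => stepLaw ρ θ) 0
  have h2 : Measurable fun a => ∫⁻ ϑ, f (consTraj a ϑ) ∂(walkLaw ρ θ) :=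
    (hf.comp measurable_consTraj).lintegral_prod_right'
  have hQ : walkLaw ρ θ = Measure.infinitePi fun _ : ℤ => stepLaw ρ θ := rfl
  have h3 := (measurePreserving_mixOn (stepLaw ρ θ) ({0} : Set ℤ)).lintegral_comp hf
  rw [← hQ] at h3
  rw [← h3, lintegral_prod _ (by fun_prop), ← h1.lintegral_comp h2]
  refine lintegral_congr fun ϑ => ?_
  rw [← (measurePreserving_timeShift ρ θ (-1)).lintegral_comp (by fun_prop)]
  refine lintegral_congr fun ϑ' => congrArg f (funext fun n => ?_)
  by_cases hn : n = 0
  · subst hn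
    rw [mixOn_of_mem (by simp), consTraj_zero]
  · rw [mixOn_of_notMem (by simpa using hn), consTraj, mixOn_of_notMem (by simpa using hn)]

/-- The restriction to nonnegative layers is needed: the entry lost in `consTraj` displaces the
negative layers. -/
theorem walkEnv_consTraj (z : Step d) (ℓ : Env d) (ϑ : Traj d) {p : ℤ × (Fin d → ℤ)}
    (hp : 0 ≤ p.1) : walkEnv (consTraj (z, ℓ) ϑ) p = glue z ℓ (walkEnv ϑ) p := by
  obtain ⟨n, x⟩ := p
  simp only at hp
  rcases hp.eq_or_lt with rfl | hn
  · rw [glue_zero]; simp [walkEnv]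
  · obtain ⟨m, rfl⟩ : ∃ m, n = m + 1 := ⟨n - 1, by ring⟩
    have h1 : walkPos (consTraj (z, ℓ) ϑ) 1 = z.1 := by
      have := walkPos_add_one (consTraj (z, ℓ) ϑ) 0
      simpa using this
    have h2 := walkPos_timeShift (consTraj (z, ℓ) ϑ) 1 m
    rw [h1, walkPos_congr (ϑ := timeShift 1 (consTraj (z, ℓ) ϑ)) (ϑ' := ϑ) (n := m)
      (fun i h₀ _ => consTraj_add_one _ _ h₀) (fun i h₀ h₁ => by omega)] at h2
    rw [glue_of_ne _ _ _ (by simp only; omega)]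
    simp only [walkEnv, consTraj_add_one _ _ (show 0 ≤ m by omega), add_sub_cancel_right, h2]
    abel_nf

theorem firstSteps_consTraj (L : ℕ) (a : Step d × Env d) (ϑ : Traj d) :
    firstSteps (L + 1) (consTraj a ϑ) = Fin.cons a.1 (firstSteps L ϑ) := by
  funext i
  refine Fin.cases ?_ (fun i => ?_) i
  · simp [firstSteps]
  · rw [Fin.cons_succ, firstSteps, firstSteps, Fin.val_succ]
    push_cast
    rw [consTraj_add_one _ _ (by simp)]

/-- The tilted averaged measure of the walk up to time `L`, on events which depend on the layers
`0, …, L - 1` only, is the law of the walk built from the i.i.d. sequence. -/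
theorem lintegral_walkLaw (ρ : Measure (SiteEnv d)) [IsProbabilityMeasure ρ]
    (θ : EuclideanSpace ℝ (Fin d)) (L : ℕ) (F : Env d → (Fin L → Step d) → ℝ≥0∞)
    (hF : ∀ z, Measurable fun ω => F ω z)
    (hdep : ∀ z, DependsOn (fun ω => F ω z) {p : ℤ × (Fin d → ℤ) | 0 ≤ p.1 ∧ p.1 < L}) :
    ∫⁻ ϑ, F (walkEnv ϑ) (firstSteps L ϑ) ∂(walkLaw ρ θ) =
      ∫⁻ ω, ∑ z, ENNReal.ofReal (pathWeight ρ θ ω z) * F ω z ∂(envLaw ρ) := by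
  have hjoint : ∀ {L : ℕ} {F : Env d → (Fin L → Step d) → ℝ≥0∞},
      (∀ z, Measurable fun ω => F ω z) → Measurable fun q : Env d × (Fin L → Step d) => F q.1 q.2 :=
    fun hF => measurable_from_prod_countable_left hF
  induction L with
  | zero =>
    obtain ⟨ω₀⟩ : Nonempty (Env d) := nonempty_of_isProbabilityMeasure (envLaw ρ)
    have hc : ∀ ω z, F ω z = F ω₀ Fin.elim0 := fun ω z => by
      rw [Subsingleton.elim z Fin.elim0]
      exact hdep Fin.elim0 fun p hp => by
        have := hp.1.trans_lt hp.2
        simp at this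
    simp only [hc]
    simp [pathWeight, quenchedProb, toVec_zero]
  | succ L ih =>
    -- The induction hypothesis is applied with the first step and the layer of time `0` frozen.
    -- What remains is the same construction for the environment seen from `(1, z)`.
    have key : ∀ z ℓ, ∫⁻ ϑ, F (walkEnv (consTraj (z, ℓ) ϑ)) (firstSteps (L + 1) (consTraj (z, ℓ) ϑ))
        ∂(walkLaw ρ θ) = ∫⁻ η, ∑ z' : Fin L → Step d,
          ENNReal.ofReal (pathWeight ρ θ η z') * F (glue z ℓ η) (Fin.cons z z') ∂(envLaw ρ) := by
      intro z ℓ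
      rw [← ih (fun η z' => F (glue z ℓ η) (Fin.cons z z')) (fun z' => by
        have := hF (Fin.cons z z'); have h2 := measurable_glue z (d := d); fun_prop) ?_]
      · refine lintegral_congr fun ϑ => ?_
        rw [firstSteps_consTraj]
        exact hdep _ fun p hp => walkEnv_consTraj _ _ _ hp.1
      · intro z' η η' h
        refine hdep _ fun p hp => ?_
        obtain ⟨n, x⟩ := p
        by_cases hn : n = 0
        · subst hn; rw [glue_zero, glue_zero]
        · rw [glue_of_ne _ _ _ hn, glue_of_ne _ _ _ hn]
          simp only [Set.mem_ofPred_eq] at hp ⊢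
          exact h _ (by simp only [Set.mem_ofPred_eq]; push_cast at hp; omega)
    have hFj := hjoint hF
    rw [lintegral_consTraj ρ θ (f := fun ϑ => F (walkEnv ϑ) (firstSteps (L + 1) ϑ))
      (by fun_prop), lintegral_stepLaw]
    · simp only [key]
      simp only [sum_path_succ]
      have hm : ∀ z, Measurable fun ω => ∑ z' : Fin L → Step d,
          ENNReal.ofReal (pathWeight ρ θ ω (Fin.cons z z' : Fin (L + 1) → Step d)) *
            F ω (Fin.cons z z') := fun z => Finset.measurable_sum _ fun z' _ =>
        (measurable_pathWeight ρ θ _).ennreal_ofReal.mul (hF _)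
      rw [lintegral_finsetSum _ fun z _ => hm z]
      refine Finset.sum_congr rfl fun z _ => ?_
      rw [lintegral_glue ρ z (hm z)]
      refine lintegral_congr fun ℓ => ?_
      have hg : ∀ z', Measurable fun η => F (glue z ℓ η) (Fin.cons z z') := fun z' => by
        have := hF (Fin.cons z z')
        have h2 := measurable_glue z (d := d)
        fun_prop
      have hm' : Measurable fun η => ∑ z' : Fin L → Step d,
          ENNReal.ofReal (pathWeight ρ θ η z') * F (glue z ℓ η) (Fin.cons z z') :=
        Finset.measurable_sum _ fun z' _ => (measurable_pathWeight ρ θ _).ennreal_ofReal.mul (hg z')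
      rw [← lintegral_const_mul _ hm']
      refine lintegral_congr fun η => ?_
      rw [Finset.mul_sum]
      refine Finset.sum_congr rfl fun z' _ => ?_
      rw [pathWeight_cons, ← mul_assoc, ENNReal.ofReal_mul (mul_nonneg (transProb_nonneg _ _ _ _)
        (tiltWeight_pos ρ θ z).le), pathWeight_congr ρ θ z'
        (ω := shift 1 z.1 (glue z ℓ η)) (ω' := η) fun p hp _ => shift_glue z ℓ η hp]
      simp only [transProb, glue_zero]
    · exact (Measurable.lintegral_prod_right' (f := fun q : (Step d × Env d) × Traj d =>
        F (walkEnv (consTraj q.1 q.2)) (firstSteps (L + 1) (consTraj q.1 q.2))) (by fun_prop))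

/-! ### A bounded superharmonic function for the difference of two walks -/

/-- The Taylor coefficient of `t ^ 2` is 10/64. The slack up to 11/64 absorbs the higher orders for
small `t` and still leaves room in dimension three. After taking fourth powers the claim is a
polynomial inequality. -/
theorem rpow_neg_quarter_le {t : ℝ} (ht : |t| ≤ 1 / 16) :
    (1 + t) ^ (-(1 / 4) : ℝ) ≤ 1 - t / 4 + 11 / 64 * t ^ 2 := by
  obtain ⟨h1, h2⟩ := abs_le.1 ht
  have ht0 : 0 < 1 + t := by linarith
  have hp : 0 < 1 - t / 4 + 11 / 64 * t ^ 2 := by nlinarith [sq_nonneg t]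
  have hpoly : 1 ≤ (1 + t) * (1 - t / 4 + 11 / 64 * t ^ 2) ^ 4 := by
    -- The terms beyond third order are bounded by nested evaluation: each bracket stays in [-1, 1]
    -- since |t| ≤ 1/16 and the coefficients are at most 15/16.
    have horner : ∀ c g : ℝ, |c| ≤ 15 / 16 → |g| ≤ 1 → |c + t * g| ≤ 1 := fun c g hc hg => by
      have h3 : |t * g| ≤ 1 / 16 * 1 := by
        rw [abs_mul]; exact mul_le_mul ht hg (abs_nonneg _) (by norm_num)
      exact (abs_add_le _ _).trans (by linarith)
    have hg := horner (-549 / 2048) _ (by norm_num [abs_le]) <|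
      horner (863 / 4096) _ (by norm_num [abs_le]) <|
      horner (-4455 / 65536) _ (by norm_num [abs_le]) <|
      horner (6897 / 262144) _ (by norm_num [abs_le]) <|
      horner (-70543 / 16777216) (14641 / 16777216) (by norm_num [abs_le]) (by norm_num [abs_le])
    set g := -549 / 2048 + t * (863 / 4096 + t * (-4455 / 65536 + t * (6897 / 262144
      + t * (-70543 / 16777216 + t * (14641 / 16777216))))) with hgdef
    have hexp : (1 + t) * (1 - t / 4 + 11 / 64 * t ^ 2) ^ 4 =
        1 + t ^ 2 * (1 / 16 + t * (31 / 64) + t ^ 2 * g) := by rw [hgdef]; ring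
    have ht2 : t ^ 2 ≤ (1 / 16) ^ 2 := sq_le_sq' h1 h2
    have h5 : -(1 / 16) ^ 2 ≤ t ^ 2 * g := by nlinarith [sq_nonneg t, (abs_le.1 hg).1]
    have h6 : 0 ≤ 1 / 16 + t * (31 / 64) + t ^ 2 * g := by linarith
    rw [hexp]
    linarith [mul_nonneg (sq_nonneg t) h6]
  have h4 : ((1 + t) ^ (-(1 / 4) : ℝ)) ^ 4 = (1 + t)⁻¹ := by
    rw [← Real.rpow_natCast, ← Real.rpow_mul ht0.le]
    norm_num
    rw [Real.rpow_neg_one]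
  refine le_of_pow_le_pow_left₀ (n := 4) (by norm_num) hp.le ?_
  rw [h4, inv_le_iff_one_le_mul₀ ht0]
  linarith


/-- One step of the superharmonicity estimate for `Q ^ (-1/4)`, for a finite family of increments
`b j + s j` of the quadratic `Q`. -/
theorem sum_rpow_neg_quarter_le {J : Type*} [Fintype J] {p b s : J → ℝ} {Q κ D σ S : ℝ}
    (hQ : 0 < Q) (hp : ∀ j, 0 ≤ p j) (hp1 : ∑ j, p j = 1) (hs0 : ∀ j, 0 ≤ s j)
    (hsσ : ∀ j, s j ≤ σ) (hb : ∑ j, p j * b j = 0) (hbs : ∑ j, p j * (b j * s j) = 0)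
    (hb2 : ∑ j, p j * b j ^ 2 ≤ κ * (4 * S)) (hs1 : D ≤ κ * ∑ j, p j * s j)
    (hs2 : ∑ j, p j * s j ≤ κ * D) (hsmall : ∀ j, |b j + s j| ≤ Q / 16) (hκ : 0 < κ)
    (hκ2 : κ ^ 2 ≤ 12 / 11) (hD : 3 ≤ D) (hSQ : 4 * S + σ * D ≤ 4 * Q) :
    ∑ j, p j * (Q + (b j + s j)) ^ (-(1 / 4) : ℝ) ≤ Q ^ (-(1 / 4) : ℝ) := by
  have hterm : ∀ j, (Q + (b j + s j)) ^ (-(1 / 4) : ℝ) ≤ Q ^ (-(1 / 4) : ℝ) *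
      (1 - (b j + s j) / Q / 4 + 11 / 64 * ((b j + s j) / Q) ^ 2) := fun j => by
    have ht : |(b j + s j) / Q| ≤ 1 / 16 := by
      rw [abs_div, abs_of_pos hQ, div_le_iff₀ hQ]; linarith [hsmall j]
    have h1 := rpow_neg_quarter_le ht
    have h0 : 0 ≤ 1 + (b j + s j) / Q := by linarith [(abs_le.1 ht).1]
    have : Q + (b j + s j) = Q * (1 + (b j + s j) / Q) := by field_simp
    rw [this, Real.mul_rpow hQ.le h0]
    exact mul_le_mul_of_nonneg_left h1 (Real.rpow_nonneg hQ.le _)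
  -- The linear term in `b` and the cross term `b * s` average to zero, so only the mean of `s`
  -- competes with the second moments.
  have hsum : ∑ j, p j * (1 - (b j + s j) / Q / 4 + 11 / 64 * ((b j + s j) / Q) ^ 2) =
      1 - (∑ j, p j * s j) / Q / 4 +
        11 / 64 * ((∑ j, p j * b j ^ 2) + ∑ j, p j * s j ^ 2) / Q ^ 2 := by
    have : ∀ j, p j * (1 - (b j + s j) / Q / 4 + 11 / 64 * ((b j + s j) / Q) ^ 2) =
        p j - (p j * b j) * (1 / Q / 4) - (p j * s j) * (1 / Q / 4) + (p j * b j ^ 2) *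
          (11 / 64 / Q ^ 2) + (p j * (b j * s j)) * (11 / 32 / Q ^ 2) +
          (p j * s j ^ 2) * (11 / 64 / Q ^ 2) := fun j => by field_simp; ring
    simp only [this, Finset.sum_add_distrib, Finset.sum_sub_distrib, ← Finset.sum_mul, hb, hbs, hp1]
    ring
  have hs2' : ∑ j, p j * s j ^ 2 ≤ κ * (σ * D) := by
    calc ∑ j, p j * s j ^ 2 ≤ ∑ j, σ * (p j * s j) := Finset.sum_le_sum fun j _ => by
          nlinarith [mul_nonneg (hp j) (hs0 j), hsσ j, mul_nonneg (mul_nonneg (hp j) (hs0 j))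
            (sub_nonneg.2 (hsσ j))]
      _ = σ * ∑ j, p j * s j := by rw [Finset.mul_sum]
      _ ≤ σ * (κ * D) := by
          obtain ⟨j⟩ : Nonempty J := by
            by_contra h
            rw [not_nonempty_iff] at h
            simp at hp1
          exact mul_le_mul_of_nonneg_left hs2 ((hs0 j).trans (hsσ j))
      _ = κ * (σ * D) := by ring
  have hle : 1 - (∑ j, p j * s j) / Q / 4 +
        11 / 64 * ((∑ j, p j * b j ^ 2) + ∑ j, p j * s j ^ 2) / Q ^ 2 ≤ 1 := by
    set E := ∑ j, p j * s j
    have h1 : (∑ j, p j * b j ^ 2) + ∑ j, p j * s j ^ 2 ≤ κ * (4 * Q) := by nlinarith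
    -- This is where dimension three enters: with D ≥ 3 and κ² ≤ 12/11, the drift -E/4 beats the
    -- 11/64 second-order term, because 11/4 · κ² ≤ 3 ≤ D ≤ κ E.
    have h2 : 11 / 64 * (κ * (4 * Q)) ≤ E / 4 * Q := by
      have : 11 / 4 * κ ≤ E := by
        have : κ * (11 / 4 * κ) ≤ κ * E := by nlinarith
        exact le_of_mul_le_mul_left this hκ
      nlinarith
    have h3 : 11 / 64 * ((∑ j, p j * b j ^ 2) + ∑ j, p j * s j ^ 2) / Q ^ 2 ≤ E / Q / 4 := by
      rw [div_le_iff₀ (by positivity)]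
      have : E / Q / 4 * Q ^ 2 = E / 4 * Q := by field_simp
      rw [this]
      nlinarith
    linarith
  calc ∑ j, p j * (Q + (b j + s j)) ^ (-(1 / 4) : ℝ)
      ≤ ∑ j, Q ^ (-(1 / 4) : ℝ) *
        (p j * (1 - (b j + s j) / Q / 4 + 11 / 64 * ((b j + s j) / Q) ^ 2)) :=
        Finset.sum_le_sum fun j _ => by
          rw [mul_left_comm]; exact mul_le_mul_of_nonneg_left (hterm j) (hp j)
    _ ≤ Q ^ (-(1 / 4) : ℝ) := by
        rw [← Finset.mul_sum, hsum]
        exact mul_le_of_le_one_right (Real.rpow_nonneg hQ.le _) hle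

/-- The displacement `z' - z` of the difference of two walks. -/
def stepDiff (w : Step d × Step d) : Fin d → ℝ := fun i => ((w.2.1 i - w.1.1 i : ℤ) : ℝ)

theorem stepDiff_swap (w : Step d × Step d) : stepDiff w.swap = -stepDiff w := by
  funext i; simp [stepDiff]

/-- The unit vector `e_i`, as a step. -/
def unitStep (i : Fin d) : Step d := ⟨Pi.single i 1, by
  rw [Finset.sum_eq_single i] <;> simp +contextual⟩

/-- The unit vector `-e_i`, as a step. -/
def negUnitStep (i : Fin d) : Step d := ⟨Pi.single i (-1), by
  rw [Finset.sum_eq_single i] <;> simp +contextual⟩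

/-- The covariance matrix of the difference of two independent steps with law `q`. -/
def diffCov (q : Step d → ℝ) : Matrix (Fin d) (Fin d) ℝ :=
  fun i j => ∑ w : Step d × Step d, q w.1 * q w.2 * (stepDiff w i * stepDiff w j)

theorem dotProduct_diffCov (q : Step d → ℝ) (v : Fin d → ℝ) :
    v ⬝ᵥ diffCov q *ᵥ v = ∑ w : Step d × Step d, q w.1 * q w.2 * (v ⬝ᵥ stepDiff w) ^ 2 := by
  simp only [dotProduct, Matrix.mulVec, diffCov, Finset.sum_mul, Finset.mul_sum, sq]
  simp_rw [Finset.sum_comm (γ := Step d × Step d)]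
  refine Finset.sum_congr rfl fun w _ => Finset.sum_congr rfl fun i _ => Finset.sum_congr rfl
    fun j _ => ?_
  ring

/-- The pair of steps -e_i, e_i has positive weight and difference 2 e_i, so no nonzero direction is
degenerate. -/
theorem posDef_diffCov {q : Step d → ℝ} (hq : ∀ z, 0 < q z) : (diffCov q).PosDef := by
  refine Matrix.PosDef.of_dotProduct_mulVec_pos ?_ fun v hv => ?_
  · ext i j
    simp only [Matrix.conjTranspose_apply, star_trivial, diffCov]
    exact Finset.sum_congr rfl fun w _ => by ring
  · rw [star_trivial, dotProduct_diffCov]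
    obtain ⟨i, hi⟩ : ∃ i, v i ≠ 0 := Function.ne_iff.1 hv
    refine Finset.sum_pos' (fun w _ => mul_nonneg (mul_pos (hq _) (hq _)).le (sq_nonneg _))
      ⟨(negUnitStep i, unitStep i), Finset.mem_univ _, mul_pos (mul_pos (hq _) (hq _)) ?_⟩
    have h2 : stepDiff (negUnitStep i, unitStep i) = Pi.single i 2 := by
      funext j
      by_cases h : j = i
      · subst h; norm_num [stepDiff, negUnitStep, unitStep]
      · simp [stepDiff, negUnitStep, unitStep, h]
    rw [h2, dotProduct_single]
    positivity

/-- The function is 1 + (|x|² + R)^(-1/4), in the norm given by the inverse covariance of the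
difference walk. A power |x|^(-2α) is superharmonic at infinity for 0 < 2α < d - 2, and α = 1/4 is
allowed with room to spare when d ≥ 3. A perturbation of the step weights by factors close to one
creates no drift, since both walks receive the same factors and their difference stays symmetric.
The constant 1 starts the second-moment induction and provides a lower bound. -/
theorem exists_superharmonic (hd : 3 ≤ d) {q : Step d → ℝ} (hq : ∀ z, 0 < q z)
    {r : Step d × Step d → ℝ} (hr : ∀ w, 0 < r w) (hr1 : ∑ w, r w = 1) :
    ∃ (h : (Fin d → ℤ) → ℝ) (κ : ℝ), 1 < κ ∧ (∀ x, 1 ≤ h x) ∧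
      ∀ a : Step d → ℝ, (∀ z, κ⁻¹ ≤ a z) → (∀ z, a z ≤ κ) → ∑ z, q z * a z = 1 →
        (∀ x, ∑ w : Step d × Step d,
          q w.1 * a w.1 * (q w.2 * a w.2) * h (x + (w.2.1 - w.1.1)) ≤ h x) ∧
        ∑ w : Step d × Step d, r w * (a w.1 * a w.2) * h (w.2.1 - w.1.1) ≤ h 0 := by
  classical
  have hM := posDef_diffCov hq
  set M := diffCov q with hMdef
  have hMdet : IsUnit M.det := hM.det_pos.ne'.isUnit
  have hS := hM.inv
  set S := M⁻¹ with hSdef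
  have hSsymm : Sᵀ = S := by
    have := hS.isHermitian
    rwa [Matrix.IsHermitian, Matrix.conjTranspose_eq_transpose_of_trivial] at this
  let quad : (Fin d → ℝ) → ℝ := fun x => x ⬝ᵥ S *ᵥ x
  have hquad0 : ∀ x, 0 ≤ quad x := fun x => by
    have := hS.posSemidef.dotProduct_mulVec_nonneg x
    rwa [star_trivial] at this
  have hquadpos : ∀ x, x ≠ 0 → 0 < quad x := fun x hx => by
    have := hS.dotProduct_mulVec_pos hx
    rwa [star_trivial] at this
  have hlin : ∀ x y : Fin d → ℝ, x ⬝ᵥ S *ᵥ y = (S *ᵥ x) ⬝ᵥ y := fun x y => by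
    rw [Matrix.dotProduct_mulVec, ← Matrix.mulVec_transpose, hSsymm]
  have hquad_add : ∀ x y, quad (x + y) = quad x + (2 * ((S *ᵥ x) ⬝ᵥ y) + quad y) := fun x y => by
    simp only [quad, Matrix.mulVec_add, dotProduct_add, add_dotProduct]
    rw [hlin x y, dotProduct_comm y (S *ᵥ x)]
    ring
  -- In this norm the variance of the linear form is the quadratic form itself, and the mean squared
  -- length of a step is exactly `d`.
  have hvar : ∀ x, ∑ w : Step d × Step d, q w.1 * q w.2 * ((S *ᵥ x) ⬝ᵥ stepDiff w) ^ 2 =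
      quad x := fun x => by
    rw [← dotProduct_diffCov, ← hMdef, Matrix.mulVec_mulVec, hSdef, Matrix.mul_nonsing_inv _ hMdet,
      Matrix.one_mulVec, dotProduct_comm]
  have htrace : ∑ w : Step d × Step d, q w.1 * q w.2 * quad (stepDiff w) = d := by
    have h1 : (S * M).trace = d := by
      rw [hSdef, Matrix.nonsing_inv_mul _ hMdet, Matrix.trace_one, Fintype.card_fin]
    rw [← h1, Matrix.trace]
    simp only [Matrix.diag, Matrix.mul_apply, quad, dotProduct, Matrix.mulVec, hMdef, diffCov,
      Finset.mul_sum]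
    simp_rw [Finset.sum_comm (γ := Step d × Step d)]
    refine Finset.sum_congr rfl fun w _ => Finset.sum_congr rfl fun i _ => Finset.sum_congr rfl
      fun j _ => ?_
    ring
  obtain ⟨σ, hσ⟩ : ∃ σ : ℝ, ∀ w : Step d × Step d, quad (stepDiff w) ≤ σ :=
    (Set.finite_range fun w : Step d × Step d => quad (stepDiff w)).bddAbove.imp
      fun σ hσ w => hσ ⟨w, rfl⟩
  obtain ⟨C, hC⟩ : ∃ C : ℝ, ∀ w : Step d × Step d, (q w.1 * q w.2)⁻¹ ≤ C :=
    (Set.finite_range fun w : Step d × Step d => (q w.1 * q w.2)⁻¹).bddAbove.imp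
      fun σ hσ w => hσ ⟨w, rfl⟩
  have hlinC : ∀ x w, ((S *ᵥ x) ⬝ᵥ stepDiff w) ^ 2 ≤ C * quad x := fun x w => by
    have h1 : q w.1 * q w.2 * ((S *ᵥ x) ⬝ᵥ stepDiff w) ^ 2 ≤ quad x := by
      rw [← hvar x]
      exact Finset.single_le_sum (f := fun w : Step d × Step d =>
        q w.1 * q w.2 * ((S *ᵥ x) ⬝ᵥ stepDiff w) ^ 2)
        (fun w _ => mul_nonneg (mul_pos (hq _) (hq _)).le (sq_nonneg _)) (Finset.mem_univ w)
    have h2 : 0 < q w.1 * q w.2 := mul_pos (hq _) (hq _)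
    calc ((S *ᵥ x) ⬝ᵥ stepDiff w) ^ 2
        = (q w.1 * q w.2)⁻¹ * (q w.1 * q w.2 * ((S *ᵥ x) ⬝ᵥ stepDiff w) ^ 2) := by
          rw [inv_mul_cancel_left₀ h2.ne']
      _ ≤ (q w.1 * q w.2)⁻¹ * quad x := mul_le_mul_of_nonneg_left h1 (inv_pos.2 h2).le
      _ ≤ C * quad x := mul_le_mul_of_nonneg_right (hC w) (hquad0 x)
  let i₀ : Fin d := ⟨0, by omega⟩
  have hσ0 : 0 ≤ σ := (hquad0 _).trans (hσ (unitStep i₀, unitStep i₀))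
  have hC0 : 0 ≤ C := (inv_pos.2 (mul_pos (hq _) (hq _))).le.trans (hC (unitStep i₀, unitStep i₀))
  -- The summands of `R` serve the estimates below: 4096 C and 32 σ bound the linear and quadratic
  -- parts of an increment by 1/32 of Q, and σ d bounds the second moment of the quadratic part.
  let R : ℝ := 1 + 4096 * C + 32 * σ + σ * d
  have hR1 : 1 ≤ R := by
    have : 0 ≤ σ * d := by positivity
    simp only [R]; linarith
  have hRC : 4096 * C ≤ R := by
    have : 0 ≤ σ * d := by positivity
    simp only [R]; linarith
  have hRσ : 32 * σ ≤ R := by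
    have : 0 ≤ σ * d := by positivity
    simp only [R]; linarith
  have hRd : σ * d ≤ R := by simp only [R]; linarith
  let cast : (Fin d → ℤ) → Fin d → ℝ := fun x i => (x i : ℝ)
  have hcast : ∀ x (w : Step d × Step d), cast (x + (w.2.1 - w.1.1)) = cast x + stepDiff w :=
    fun x w => by funext i; simp [cast, stepDiff]
  have hcast0 : cast 0 = 0 := by funext i; simp [cast]
  let f : (Fin d → ℤ) → ℝ := fun x => (quad (cast x) + R) ^ (-(1 / 4) : ℝ)
  have hf0 : ∀ x, 0 ≤ f x := fun x => Real.rpow_nonneg (by linarith [hquad0 (cast x)]) _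
  have hquadz : quad 0 = 0 := by simp [quad]
  have hfle : ∀ x, f x ≤ f 0 := fun x => by
    simp only [f, hcast0, hquadz]
    exact Real.rpow_le_rpow_of_nonpos (by linarith) (by linarith [hquad0 (cast x)]) (by norm_num)
  -- At the origin, the maximum of `f`, the inequality is strict. The gap pays for tilted weights `r
  -- a a` whose total mass may exceed one.
  have hflt : ∑ w : Step d × Step d, r w * f (w.2.1 - w.1.1) < f 0 := by
    rw [← one_mul (f 0), ← hr1, Finset.sum_mul]
    refine Finset.sum_lt_sum (fun w _ => mul_le_mul_of_nonneg_left (hfle _) (hr w).le)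
      ⟨(negUnitStep i₀, unitStep i₀), Finset.mem_univ _, mul_lt_mul_of_pos_left ?_ (hr _)⟩
    simp only [f, hcast0, hquadz]
    refine Real.rpow_lt_rpow_of_neg (by linarith) ?_ (by norm_num)
    have := hquadpos (cast ((unitStep i₀).1 - (negUnitStep i₀).1)) fun h => by
      have := congrFun h i₀
      norm_num [cast, unitStep, negUnitStep] at this
    linarith
  obtain ⟨κ, hκ1, hκ4, hκA⟩ : ∃ κ : ℝ, 1 < κ ∧ (κ ^ 2) ^ 2 ≤ 12 / 11 ∧
      κ ^ 2 * (1 + ∑ w : Step d × Step d, r w * f (w.2.1 - w.1.1)) ≤ 1 + f 0 := by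
    have h1 : ∀ᶠ κ in 𝓝[>] (1 : ℝ), (κ ^ 2) ^ 2 < 12 / 11 := by
      refine nhdsWithin_le_nhds (Tendsto.eventually_lt_const (u := 12 / 11) (v := (1 ^ 2) ^ 2)
        (by norm_num) ?_)
      exact Continuous.tendsto (by fun_prop) 1
    have h2 : ∀ᶠ κ in 𝓝[>] (1 : ℝ),
        κ ^ 2 * (1 + ∑ w : Step d × Step d, r w * f (w.2.1 - w.1.1)) < 1 + f 0 := by
      refine nhdsWithin_le_nhds (Tendsto.eventually_lt_const
        (v := 1 ^ 2 * (1 + ∑ w : Step d × Step d, r w * f (w.2.1 - w.1.1))) (by linarith) ?_)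
      exact Continuous.tendsto (f := fun κ : ℝ =>
        κ ^ 2 * (1 + ∑ w : Step d × Step d, r w * f (w.2.1 - w.1.1))) (by fun_prop) 1
    obtain ⟨κ, ⟨ha, hb⟩, hc⟩ := ((h1.and h2).and self_mem_nhdsWithin).exists
    exact ⟨κ, hc, ha.le, hb.le⟩
  have hκ0 : 0 < κ := by linarith
  refine ⟨fun x => 1 + f x, κ, hκ1, fun x => by linarith [hf0 x], fun a ha1 ha2 hsum => ⟨?_, ?_⟩⟩
  · intro x
    have ha0 : ∀ z, 0 < a z := fun z => (inv_pos.2 hκ0).trans_le (ha1 z)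
    let p : Step d × Step d → ℝ := fun w => q w.1 * a w.1 * (q w.2 * a w.2)
    have hp0 : ∀ w, 0 ≤ p w := fun w =>
      (mul_pos (mul_pos (hq _) (ha0 _)) (mul_pos (hq _) (ha0 _))).le
    have hp1 : ∑ w, p w = 1 := by
      simp only [p, Fintype.sum_prod_type]
      simp only [← Finset.mul_sum, hsum, mul_one]
    -- Exchanging the two walks preserves the tilted weights and reverses the displacement, so odd
    -- functions of the displacement have mean zero.
    have hswap : ∀ g : Step d × Step d → ℝ, (∀ w, g w.swap = -g w) → ∑ w, p w * g w = 0 := by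
      intro g hg
      have h1 : ∑ w, p w * g w = ∑ w : Step d × Step d, p w.swap * g w.swap :=
        ((Equiv.prodComm (Step d) (Step d)).sum_comp fun w => p w * g w).symm
      have h2 : ∀ w, p w.swap * g w.swap = -(p w * g w) := fun w => by
        rw [hg]; simp only [p, Prod.fst_swap, Prod.snd_swap]; ring
      simp only [h2, Finset.sum_neg_distrib] at h1
      linarith
    have hpq : ∀ w, p w ≤ κ ^ 2 * (q w.1 * q w.2) := fun w => by
      have h1 : a w.1 * a w.2 ≤ κ ^ 2 := by
        rw [sq]; exact mul_le_mul (ha2 _) (ha2 _) (ha0 _).le hκ0.le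
      have h2 : p w = a w.1 * a w.2 * (q w.1 * q w.2) := by simp only [p]; ring
      rw [h2]
      exact mul_le_mul_of_nonneg_right h1 (mul_pos (hq _) (hq _)).le
    have hqp : ∀ w, q w.1 * q w.2 ≤ κ ^ 2 * p w := fun w => by
      have h1 : 1 ≤ (κ * a w.1) * (κ * a w.2) := by
        have h3 : ∀ z, 1 ≤ κ * a z := fun z => by
          rw [← mul_inv_cancel₀ hκ0.ne']; exact mul_le_mul_of_nonneg_left (ha1 z) hκ0.le
        nlinarith [h3 w.1, h3 w.2]
      have h2 : κ ^ 2 * p w = (κ * a w.1) * (κ * a w.2) * (q w.1 * q w.2) := by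
        simp only [p]; ring
      rw [h2]
      exact le_mul_of_one_le_left (mul_pos (hq _) (hq _)).le h1
    have hlinneg : ∀ w : Step d × Step d, (S *ᵥ cast x) ⬝ᵥ stepDiff w.swap =
        -((S *ᵥ cast x) ⬝ᵥ stepDiff w) := fun w => by rw [stepDiff_swap, dotProduct_neg]
    have hquadneg : ∀ w : Step d × Step d, quad (stepDiff w.swap) = quad (stepDiff w) :=
      fun w => by simp [quad, stepDiff_swap, Matrix.mulVec_neg]
    have hQ1 : 0 < quad (cast x) + R := by linarith [hquad0 (cast x)]
    have key := sum_rpow_neg_quarter_le (p := p)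
      (b := fun w => 2 * ((S *ᵥ cast x) ⬝ᵥ stepDiff w)) (s := fun w => quad (stepDiff w))
      (Q := quad (cast x) + R) (κ := κ ^ 2) (D := d) (σ := σ) (S := quad (cast x)) hQ1 hp0 hp1
      (fun w => hquad0 _) hσ
      (hswap _ fun w => by rw [hlinneg]; ring)
      (hswap _ fun w => by rw [hlinneg, hquadneg]; ring)
      (by
        rw [← hvar (cast x), Finset.mul_sum, Finset.mul_sum]
        refine Finset.sum_le_sum fun w _ => ?_
        have := mul_le_mul_of_nonneg_right (hpq w)
          (sq_nonneg (2 * ((S *ᵥ cast x) ⬝ᵥ stepDiff w)))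
        refine this.trans (le_of_eq (by ring)))
      (by
        rw [← htrace, Finset.mul_sum]
        refine Finset.sum_le_sum fun w _ => ?_
        rw [← mul_assoc]
        exact mul_le_mul_of_nonneg_right (hqp w) (hquad0 _))
      (by
        rw [← htrace, Finset.mul_sum]
        refine Finset.sum_le_sum fun w _ => ?_
        rw [← mul_assoc]
        exact mul_le_mul_of_nonneg_right (hpq w) (hquad0 _))
      (fun w => by
        have h1 : |2 * ((S *ᵥ cast x) ⬝ᵥ stepDiff w)| ≤ (quad (cast x) + R) / 32 := by
          refine abs_le_of_sq_le_sq ?_ (by linarith)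
          have := hlinC (cast x) w
          nlinarith [sq_nonneg (quad (cast x) - R), mul_le_mul_of_nonneg_right hRC (hquad0 (cast x))]
        have h2 : |quad (stepDiff w)| ≤ (quad (cast x) + R) / 32 := by
          rw [abs_of_nonneg (hquad0 _)]
          linarith [hσ w, hquad0 (cast x)]
        refine (abs_add_le _ _).trans (by linarith))
      (by positivity) hκ4 (by exact_mod_cast hd) (by linarith)
    have hexp : ∀ w : Step d × Step d, f (x + (w.2.1 - w.1.1)) = (quad (cast x) + R +
        (2 * ((S *ᵥ cast x) ⬝ᵥ stepDiff w) + quad (stepDiff w))) ^ (-(1 / 4) : ℝ) := fun w => by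
      simp only [f, hcast, hquad_add]
      congr 1
      ring
    have hgoal : ∑ w, p w * f (x + (w.2.1 - w.1.1)) ≤ f x := by
      simp only [hexp]; exact key
    change ∑ w, p w * (1 + f (x + (w.2.1 - w.1.1))) ≤ 1 + f x
    simp only [mul_add, mul_one, Finset.sum_add_distrib, hp1]
    linarith
  · refine le_trans ?_ hκA
    have ha0 : ∀ z, 0 < a z := fun z => (inv_pos.2 hκ0).trans_le (ha1 z)
    have h3 : κ ^ 2 * (1 + ∑ w : Step d × Step d, r w * f (w.2.1 - w.1.1)) =
        ∑ w : Step d × Step d, κ ^ 2 * (r w * (1 + f (w.2.1 - w.1.1))) := by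
      rw [← Finset.mul_sum]
      simp only [mul_add, mul_one, Finset.sum_add_distrib, hr1]
    rw [h3]
    refine Finset.sum_le_sum fun w _ => ?_
    have h1 : a w.1 * a w.2 ≤ κ ^ 2 := by
      rw [sq]; exact mul_le_mul (ha2 _) (ha2 _) (ha0 _).le hκ0.le
    have h4 : 0 ≤ r w * (1 + f (w.2.1 - w.1.1)) :=
      mul_nonneg (hr w).le (by linarith [hf0 (w.2.1 - w.1.1)])
    have := mul_le_mul_of_nonneg_right h1 h4
    linarith

theorem lintegral_envLaw_mul (ρ : Measure (SiteEnv d)) [IsProbabilityMeasure ρ]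
    {S : Set (ℤ × (Fin d → ℤ))} {f g : Env d → ℝ≥0∞} (hf : Measurable f) (hg : Measurable g)
    (hfS : DependsOn f S) (hgS : DependsOn g Sᶜ) :
    ∫⁻ ω, f ω * g ω ∂(envLaw ρ) = (∫⁻ ω, f ω ∂(envLaw ρ)) * ∫⁻ ω, g ω ∂(envLaw ρ) :=
  lintegral_mul_of_dependsOn ρ hf hg hfS hgS

/-! ### The partition function and its second moment -/

section Polymer

variable (ρ : Measure (SiteEnv d)) [IsProbabilityMeasure ρ] (θ : EuclideanSpace ℝ (Fin d))

/-- The normalized partition function `E_{o,o}^ω[exp (⟨θ, X_n⟩ - n Λ_c(θ))]`. -/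
def polymer (n : ℕ) (ω : Env d) : ℝ := ∑ z : Fin n → Step d, pathWeight ρ θ ω z

@[fun_prop]
theorem measurable_polymer (n : ℕ) : Measurable (polymer ρ θ n) := by
  unfold polymer; fun_prop

theorem polymer_nonneg (n : ℕ) (ω : Env d) : 0 ≤ polymer ρ θ n ω :=
  Finset.sum_nonneg fun _ _ => pathWeight_nonneg _ _ _ _

theorem polymer_zero (ω : Env d) : polymer ρ θ 0 ω = 1 := by
  simp [polymer, pathWeight, quenchedProb, toVec_zero]

theorem polymer_succ (n : ℕ) (ω : Env d) :
    polymer ρ θ (n + 1) ω =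
      ∑ z, transProb ω 0 0 z * tiltWeight ρ θ z * polymer ρ θ n (shift 1 z.1 ω) := by
  simp only [polymer, sum_path_succ, pathWeight_cons, Finset.mul_sum]

theorem polymer_congr (n : ℕ) {ω ω' : Env d}
    (h : ∀ p : ℤ × (Fin d → ℤ), 0 ≤ p.1 → p.1 < n → ω p = ω' p) :
    polymer ρ θ n ω = polymer ρ θ n ω' :=
  Finset.sum_congr rfl fun z _ => pathWeight_congr ρ θ z h

theorem exists_polymer_le (n : ℕ) : ∃ C, ∀ ω, polymer ρ θ n ω ≤ C :=
  ⟨_, fun ω => Finset.sum_le_sum fun z _ => mul_le_of_le_one_left (Real.exp_pos _).le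
    (quenchedProb_le_one ω z)⟩

theorem integrable_polymer (n : ℕ) : Integrable (polymer ρ θ n) (envLaw ρ) := by
  obtain ⟨C, hC⟩ := exists_polymer_le ρ θ n
  exact Integrable.of_bound (C := C) (measurable_polymer ρ θ n).aestronglyMeasurable
    (ae_of_all _ fun ω => by rw [Real.norm_of_nonneg (polymer_nonneg ρ θ n ω)]; exact hC ω)

/-- The second mixed moment of the step probabilities at the sites `0` and `x`. -/
theorem lintegral_transProb_mul_of_ne {x : Fin d → ℤ} (hx : x ≠ 0) (z z' : Step d) :
    ∫⁻ ω, ENNReal.ofReal (transProb ω 0 0 z) * ENNReal.ofReal (transProb ω 0 x z') ∂(envLaw ρ) =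
      ENNReal.ofReal (meanProb ρ z) * ENNReal.ofReal (meanProb ρ z') := by
  rw [← lintegral_transProb ρ 0 0 z, ← lintegral_transProb ρ 0 x z']
  refine lintegral_mul_of_dependsOn ρ (S := {((0 : ℤ), (0 : Fin d → ℤ))}) (by fun_prop)
    (by fun_prop) (fun ω ω' h => ?_) (fun ω ω' h => ?_)
  · rw [transProb, transProb, h _ rfl]
  · rw [transProb, transProb, h _ (by simpa using hx)]

/-- Expand both walks at their first step: the layer of time `0` is independent of the later layers,
and by shift invariance only the difference of the new positions matters. -/
theorem lintegral_polymer_mul_shift_succ (n : ℕ) (x : Fin d → ℤ) :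
    ∫⁻ ω, ENNReal.ofReal (polymer ρ θ (n + 1) ω) *
        ENNReal.ofReal (polymer ρ θ (n + 1) (shift 0 x ω)) ∂(envLaw ρ) =
      ∑ w : Step d × Step d, ENNReal.ofReal (tiltWeight ρ θ w.1 * tiltWeight ρ θ w.2) *
        (∫⁻ ω, ENNReal.ofReal (transProb ω 0 0 w.1) * ENNReal.ofReal (transProb ω 0 x w.2)
          ∂(envLaw ρ)) *
        ∫⁻ ω, ENNReal.ofReal (polymer ρ θ n ω) *
          ENNReal.ofReal (polymer ρ θ n (shift 0 (x + (w.2.1 - w.1.1)) ω)) ∂(envLaw ρ) := by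
  have hexp : ∀ ω, ENNReal.ofReal (polymer ρ θ (n + 1) ω) *
      ENNReal.ofReal (polymer ρ θ (n + 1) (shift 0 x ω)) = ∑ w : Step d × Step d,
        ENNReal.ofReal (tiltWeight ρ θ w.1 * tiltWeight ρ θ w.2) *
        ((ENNReal.ofReal (transProb ω 0 0 w.1) * ENNReal.ofReal (transProb ω 0 x w.2)) *
        (ENNReal.ofReal (polymer ρ θ n (shift 1 w.1.1 ω)) *
          ENNReal.ofReal (polymer ρ θ n (shift 1 (x + w.2.1) ω)))) := fun ω => by
    rw [polymer_succ, polymer_succ, ENNReal.ofReal_sum_of_nonneg fun z _ => mul_nonneg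
      (mul_nonneg (transProb_nonneg _ _ _ _) (tiltWeight_pos ρ θ z).le) (polymer_nonneg ρ θ _ _),
      ENNReal.ofReal_sum_of_nonneg fun z _ => mul_nonneg
      (mul_nonneg (transProb_nonneg _ _ _ _) (tiltWeight_pos ρ θ z).le) (polymer_nonneg ρ θ _ _),
      Finset.sum_mul_sum, Fintype.sum_prod_type]
    refine Finset.sum_congr rfl fun z _ => Finset.sum_congr rfl fun z' _ => ?_
    rw [shift_shift, transProb_shift, add_comm z'.1 x]
    simp only [add_zero, zero_add, ENNReal.ofReal_mul (tiltWeight_pos ρ θ z).le,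
      ENNReal.ofReal_mul (transProb_nonneg _ _ _ _), ENNReal.ofReal_mul
        (mul_nonneg (transProb_nonneg _ _ _ _) (tiltWeight_pos ρ θ _).le)]
    ring
  simp only [hexp]
  rw [lintegral_finsetSum _ fun w _ => by fun_prop]
  refine Finset.sum_congr rfl fun w _ => ?_
  rw [lintegral_const_mul _ (by fun_prop), mul_assoc]
  congr 1
  rw [lintegral_envLaw_mul ρ (S := {p : ℤ × (Fin d → ℤ) | p.1 = 0})
    (f := fun ω => ENNReal.ofReal (transProb ω 0 0 w.1) * ENNReal.ofReal (transProb ω 0 x w.2))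
    (g := fun ω => ENNReal.ofReal (polymer ρ θ n (shift 1 w.1.1 ω)) *
          ENNReal.ofReal (polymer ρ θ n (shift 1 (x + w.2.1) ω))) (by fun_prop) (by fun_prop)
    (fun ω ω' h => ?_) (fun ω ω' h => ?_)]
  · congr 1
    rw [← (measurePreserving_shift ρ 1 w.1.1).lintegral_comp (f := fun ω =>
      ENNReal.ofReal (polymer ρ θ n ω) *
          ENNReal.ofReal (polymer ρ θ n (shift 0 (x + (w.2.1 - w.1.1)) ω))) (by fun_prop)]
    refine lintegral_congr fun ω => ?_
    rw [shift_shift, zero_add, add_assoc, sub_add_cancel]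
  · simp only [transProb]
    rw [h (0, 0) rfl, h (0, x) rfl]
  · have : ∀ y, polymer ρ θ n (shift 1 y ω) = polymer ρ θ n (shift 1 y ω') := fun y =>
      polymer_congr ρ θ n fun p hp _ => by
        rw [shift_apply, shift_apply]
        exact h _ (by simp only [Set.mem_compl_iff, Set.mem_ofPred_eq]; omega)
    simp only [this]

end Polymer

/-! ### Small tilts and the uniform second-moment bound. -/

theorem continuous_logMGF (ρ : Measure (SiteEnv d)) [IsProbabilityMeasure ρ] :
    Continuous (logMGF ρ) := by
  unfold logMGF
  refine Continuous.log (by fun_prop) fun θ => (mgf_pos ρ θ).ne'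

theorem logMGF_zero (ρ : Measure (SiteEnv d)) [IsProbabilityMeasure ρ] : logMGF ρ 0 = 0 := by
  simp [logMGF, sum_meanProb]

theorem meanProb_pos (ρ : Measure (SiteEnv d)) [IsProbabilityMeasure ρ] {c₁ : ℝ} (hc₁ : 0 < c₁)
    (hell : ∀ z : Step d, ∀ᵐ ω ∂(envLaw ρ), c₁ ≤ transProb ω 0 0 z) (z : Step d) :
    0 < meanProb ρ z := by
  have : ∫ _ω, c₁ ∂(envLaw ρ) ≤ meanProb ρ z :=
    integral_mono_ae (integrable_const _) (integrable_transProb ρ 0 0 z) (hell z)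
  simp only [integral_const, probReal_univ, one_smul] at this
  linarith

/-- In dimension at least three, the partition functions with a small parameter are bounded
in `L²`. -/
theorem exists_lintegral_polymer_sq_le (hd : 3 ≤ d) (ρ : Measure (SiteEnv d))
    [IsProbabilityMeasure ρ] {c₁ : ℝ} (hc₁ : 0 < c₁)
    (hell : ∀ z : Step d, ∀ᵐ ω ∂(envLaw ρ), c₁ ≤ transProb ω 0 0 z) :
    ∃ δ C : ℝ, 0 < δ ∧ ∀ θ : EuclideanSpace ℝ (Fin d), ‖θ‖ < δ → ∀ n,
      ∫⁻ ω, ENNReal.ofReal (polymer ρ θ n ω) ^ 2 ∂(envLaw ρ) ≤ ENNReal.ofReal C := by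
  have hq : ∀ z, 0 < meanProb ρ z := meanProb_pos ρ hc₁ hell
  let r : Step d × Step d → ℝ := fun w => ∫ ω, transProb ω 0 0 w.1 * transProb ω 0 0 w.2 ∂(envLaw ρ)
  have hrint : ∀ w : Step d × Step d,
      Integrable (fun ω => transProb ω 0 0 w.1 * transProb ω 0 0 w.2) (envLaw ρ) := fun w =>
    Integrable.of_bound (C := 1) (by fun_prop) (ae_of_all _ fun ω => by
      rw [Real.norm_of_nonneg (mul_nonneg (transProb_nonneg _ _ _ _) (transProb_nonneg _ _ _ _))]
      exact mul_le_one₀ (transProb_le_one _ _ _ _) (transProb_nonneg _ _ _ _)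
        (transProb_le_one _ _ _ _))
  have hr : ∀ w, 0 < r w := fun w => by
    have : ∫ _ω, c₁ * c₁ ∂(envLaw ρ) ≤ r w := by
      refine integral_mono_ae (integrable_const _) (hrint w) ?_
      filter_upwards [hell w.1, hell w.2] with ω h1 h2
      exact mul_le_mul h1 h2 hc₁.le (transProb_nonneg _ _ _ _)
    simp only [integral_const, probReal_univ, one_smul] at this
    nlinarith
  have hr1 : ∑ w, r w = 1 := by
    simp only [r]
    rw [← integral_finsetSum _ fun w _ => hrint w]
    simp only [Fintype.sum_prod_type, ← Finset.mul_sum, sum_transProb, mul_one]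
    simp
  obtain ⟨h, κ, hκ, h1, hsuper⟩ := exists_superharmonic hd hq hr hr1
  have hcont : ∀ z, Continuous fun θ => tiltWeight ρ θ z := fun z => by
    have := continuous_logMGF ρ
    unfold tiltWeight; fun_prop
  -- The tilt weights equal one at θ = 0, so by continuity they lie within the factor `κ` allowed by
  -- the superharmonic function.
  have hev : ∀ᶠ θ in 𝓝 (0 : EuclideanSpace ℝ (Fin d)),
      ∀ z, κ⁻¹ < tiltWeight ρ θ z ∧ tiltWeight ρ θ z < κ := by
    rw [eventually_all]
    intro z
    have h0 : tiltWeight ρ 0 z = 1 := by simp [tiltWeight, logMGF_zero]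
    exact ((hcont z).tendsto 0).eventually (by
      rw [h0]; exact (lt_mem_nhds (inv_lt_one_of_one_lt₀ hκ)).and (gt_mem_nhds hκ))
  obtain ⟨δ, hδ, hball⟩ := Metric.eventually_nhds_iff.1 hev
  refine ⟨δ, h 0, hδ, fun θ hθ n => ?_⟩
  have hw := hball (y := θ) (by simpa using hθ)
  obtain ⟨hs1, hs2⟩ := hsuper (tiltWeight ρ θ) (fun z => (hw z).1.le) (fun z => (hw z).2.le)
    (sum_meanProb_mul_tiltWeight ρ θ)
  -- The induction needs all starting differences `x` at once; the bound sought is the case `x = 0`.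
  have hmain : ∀ n x, ∫⁻ ω, ENNReal.ofReal (polymer ρ θ n ω) *
      ENNReal.ofReal (polymer ρ θ n (shift 0 x ω)) ∂(envLaw ρ) ≤ ENNReal.ofReal (h x) := by
    intro n
    induction n with
    | zero =>
      intro x
      simp only [polymer_zero, ENNReal.ofReal_one, mul_one, lintegral_one, measure_univ]
      exact ENNReal.one_le_ofReal.2 (h1 x)
    | succ n ih =>
      intro x
      have hpos : ∀ x, 0 ≤ h x := fun x => zero_le_one.trans (h1 x)
      have ha : ∀ w : Step d × Step d, 0 ≤ tiltWeight ρ θ w.1 * tiltWeight ρ θ w.2 := fun w =>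
        (mul_pos (tiltWeight_pos ρ θ _) (tiltWeight_pos ρ θ _)).le
      rw [lintegral_polymer_mul_shift_succ]
      -- When the walks share a site, the weights are the mixed second moments `r`. Otherwise the
      -- sites are independent and the weights factor into products of means.
      by_cases hx : x = 0
      · subst hx
        refine le_trans ?_ (ENNReal.ofReal_le_ofReal hs2)
        rw [ENNReal.ofReal_sum_of_nonneg fun w _ => mul_nonneg (mul_nonneg (hr w).le (ha w))
          (hpos _)]
        refine Finset.sum_le_sum fun w _ => ?_
        rw [ENNReal.ofReal_mul (mul_nonneg (hr w).le (ha w)), ENNReal.ofReal_mul (hr w).le,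
          mul_comm (ENNReal.ofReal (r w))]
        refine mul_le_mul' (mul_le_mul' le_rfl (le_of_eq ?_)) ((ih _).trans (by rw [zero_add]))
        simp only [← ENNReal.ofReal_mul (transProb_nonneg _ _ _ _), r]
        rw [ofReal_integral_eq_lintegral_ofReal (hrint w) (ae_of_all _ fun ω =>
          mul_nonneg (transProb_nonneg _ _ _ _) (transProb_nonneg _ _ _ _))]
      · refine le_trans ?_ (ENNReal.ofReal_le_ofReal (hs1 x))
        have hqa : ∀ w : Step d × Step d, meanProb ρ w.1 * tiltWeight ρ θ w.1 *
            (meanProb ρ w.2 * tiltWeight ρ θ w.2) = (tiltWeight ρ θ w.1 * tiltWeight ρ θ w.2) *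
              (meanProb ρ w.1 * meanProb ρ w.2) := fun w => by ring
        simp only [hqa]
        have hqq : ∀ w : Step d × Step d, 0 ≤ meanProb ρ w.1 * meanProb ρ w.2 := fun w =>
          (mul_pos (hq _) (hq _)).le
        rw [ENNReal.ofReal_sum_of_nonneg fun w _ => mul_nonneg (mul_nonneg (ha w) (hqq w))
          (hpos _)]
        refine Finset.sum_le_sum fun w _ => ?_
        rw [ENNReal.ofReal_mul (mul_nonneg (ha w) (hqq w)), ENNReal.ofReal_mul (ha w),
          ENNReal.ofReal_mul (hq _).le, lintegral_transProb_mul_of_ne ρ hx]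
        exact mul_le_mul' le_rfl (ih _)
  simpa [sq] using hmain n 0

/-! ### The limit of the partition functions -/

/-- The filtration of the layers `0, …, n - 1`. -/
def layerFiltration (d : ℕ) : Filtration ℕ (MeasurableSpace.pi : MeasurableSpace (Env d)) where
  seq n := cylSigma (SiteEnv d) {p : ℤ × (Fin d → ℤ) | 0 ≤ p.1 ∧ p.1 < n}
  mono' _ _ h := cylSigma_mono fun _ hp => ⟨hp.1, hp.2.trans_le (by exact_mod_cast h)⟩
  le' _ := cylSigma_le _

theorem layerFiltration_apply (n : ℕ) : layerFiltration d n =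
    cylSigma (SiteEnv d) {p : ℤ × (Fin d → ℤ) | 0 ≤ p.1 ∧ p.1 < n} := rfl

theorem iSup_layerFiltration : ⨆ n, layerFiltration d n = futureSigma d 0 := by
  rw [futureSigma_eq]
  refine le_antisymm (iSup_le fun n => cylSigma_mono fun p hp => hp.1) (iSup₂_le fun p hp => ?_)
  refine le_iSup_of_le (p.1.toNat + 1) ?_
  rw [layerFiltration_apply]
  exact le_iSup₂_of_le (f := fun (i : ℤ × (Fin d → ℤ)) _ =>
      MeasurableSpace.comap (fun ω : Env d => ω i) inferInstance) p
    ⟨hp, by push_cast; rw [Int.toNat_of_nonneg hp]; omega⟩ le_rfl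

/-! ### Independence of events carried by disjoint sets of sites. -/

theorem dependsOn_indicator_one {ι α : Type*} {S : Set ι} {s : Set (ι → α)}
    (h : DependsOn (· ∈ s) S) : DependsOn (s.indicator (1 : (ι → α) → ℝ≥0∞)) S := by
  classical
  intro x y hxy
  have hs : (x ∈ s) = (y ∈ s) := h hxy
  rw [Set.indicator_apply, Set.indicator_apply]
  simp only [hs, Pi.one_apply]

theorem dependsOn_mem_of_measurableSet {ι α : Type*} [MeasurableSpace α] {S : Set ι}
    {s : Set (ι → α)} (h : MeasurableSet[cylSigma α S] s) : DependsOn (· ∈ s) S :=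
  dependsOn_of_measurable_cylSigma ((@measurable_mem _ s (cylSigma α S)).2 h)

theorem envLaw_inter_of_dependsOn (ρ : Measure (SiteEnv d)) [IsProbabilityMeasure ρ]
    {S : Set (ℤ × (Fin d → ℤ))} {s t : Set (Env d)} (hs : MeasurableSet s) (ht : MeasurableSet t)
    (hsS : DependsOn (· ∈ s) S) (htS : DependsOn (· ∈ t) Sᶜ) :
    envLaw ρ (s ∩ t) = envLaw ρ s * envLaw ρ t := by
  have h := lintegral_envLaw_mul ρ (measurable_one.indicator hs) (measurable_one.indicator ht)
    (dependsOn_indicator_one hsS) (dependsOn_indicator_one htS)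
  rw [lintegral_indicator_one hs, lintegral_indicator_one ht] at h
  rw [← h, ← lintegral_indicator_one (hs.inter ht), Set.inter_indicator_one]
  rfl

section Limit

variable (ρ : Measure (SiteEnv d)) [IsProbabilityMeasure ρ] (θ : EuclideanSpace ℝ (Fin d))

/-- For an event that ignores the path, summing the path weights leaves the partition function.
Every horizon `L ≥ n` is allowed, since additional tilted steps do not alter the law of the first
`n` layers. -/
theorem walkLaw_preimage_eq_polymer {n : ℕ} {s : Set (Env d)}
    (hs : MeasurableSet[layerFiltration d n] s) {L : ℕ} (hL : n ≤ L) :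
    (walkLaw ρ θ).map walkEnv s = ∫⁻ ω in s, ENNReal.ofReal (polymer ρ θ L ω) ∂(envLaw ρ) := by
  have hs' : MeasurableSet s := (layerFiltration d).le n s hs
  have h := lintegral_walkLaw ρ θ L (fun ω _ => s.indicator 1 ω)
    (fun _ => measurable_one.indicator hs') fun _ =>
      (dependsOn_indicator_one (dependsOn_mem_of_measurableSet hs)).mono
        fun p hp => ⟨hp.1, hp.2.trans_le (by exact_mod_cast hL)⟩
  rw [← lintegral_map (f := s.indicator 1) (measurable_one.indicator hs') measurable_walkEnv,
    lintegral_indicator_one hs'] at h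
  rw [h, ← lintegral_indicator hs']
  refine lintegral_congr fun ω => ?_
  rw [← Finset.sum_mul, ← ENNReal.ofReal_sum_of_nonneg fun z _ => pathWeight_nonneg ρ θ ω z]
  change ENNReal.ofReal (polymer ρ θ L ω) * _ = _
  by_cases hω : ω ∈ s <;> simp [hω]

/-- The integral of W_L over an event of the first `n` layers is the probability of that event under
the tilted environment law, for every `L ≥ n`. Its independence of `L` is the martingale property.
-/
theorem martingale_polymer : Martingale (polymer ρ θ) (layerFiltration d) (envLaw ρ) := by
  have : Nonempty (SiteEnv d) := nonempty_of_isProbabilityMeasure ρ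
  refine martingale_of_setIntegral_eq_succ (fun n => ?_) (integrable_polymer ρ θ) fun n s hs => ?_
  · refine Measurable.stronglyMeasurable ?_
    exact measurable_cylSigma_of_dependsOn (measurable_polymer ρ θ n)
      fun ω ω' h => polymer_congr ρ θ n fun p h0 h1 => h p ⟨h0, h1⟩
  · have h : ∀ L, n ≤ L → ∫ ω in s, polymer ρ θ L ω ∂(envLaw ρ) =
        ((walkLaw ρ θ).map walkEnv s).toReal := fun L hL => by
      rw [walkLaw_preimage_eq_polymer ρ θ hs hL, integral_eq_lintegral_of_nonneg_ae
        (ae_of_all _ fun ω => polymer_nonneg ρ θ L ω)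
        (measurable_polymer ρ θ L).aestronglyMeasurable]
    rw [h n le_rfl, h (n + 1) n.le_succ]

theorem uniformIntegrable_polymer {C : ℝ} (hC : ∀ n,
    ∫⁻ ω, ENNReal.ofReal (polymer ρ θ n ω) ^ 2 ∂(envLaw ρ) ≤ ENNReal.ofReal C) :
    UniformIntegrable (polymer ρ θ) 1 (envLaw ρ) := by
  refine uniformIntegrable_of le_rfl ENNReal.one_ne_top
    (fun n => (measurable_polymer ρ θ n).aestronglyMeasurable) fun ε hε => ?_
  refine ⟨⟨(|C| + 1) / ε, by positivity⟩, fun n => ?_⟩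
  set K : NNReal := ⟨(|C| + 1) / ε, by positivity⟩
  have hKpos : (0 : ℝ) < K := by
    change 0 < (|C| + 1) / ε
    positivity
  have hK : ENNReal.ofReal (K : ℝ) * ENNReal.ofReal ε = ENNReal.ofReal (|C| + 1) := by
    rw [← ENNReal.ofReal_mul hKpos.le]
    congr 1
    change (|C| + 1) / ε * ε = _
    field_simp
  rw [eLpNorm_one_eq_lintegral_enorm]
  -- Where W_n ≥ K one has K W_n ≤ W_n², so the L² bound makes the tails of order 1/K.
  have hpt : ∀ ω, ENNReal.ofReal (K : ℝ) * ‖({x | K ≤ ‖polymer ρ θ n x‖₊}.indicator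
      (polymer ρ θ n)) ω‖ₑ ≤ ENNReal.ofReal (polymer ρ θ n ω) ^ 2 := fun ω => by
    by_cases hω : K ≤ ‖polymer ρ θ n ω‖₊
    · have h1 : (K : ℝ) ≤ polymer ρ θ n ω := by
        have : (K : ℝ) ≤ ‖polymer ρ θ n ω‖ := by exact_mod_cast hω
        rwa [Real.norm_of_nonneg (polymer_nonneg ρ θ n ω)] at this
      rw [Set.indicator_of_mem (by exact hω), Real.enorm_of_nonneg (polymer_nonneg ρ θ n ω), sq]
      exact mul_le_mul' (ENNReal.ofReal_le_ofReal h1) le_rfl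
    · rw [Set.indicator_of_notMem (by exact hω)]
      simp
  have h2 := (lintegral_mono hpt).trans (hC n)
  have hK0 : ENNReal.ofReal (K : ℝ) ≠ 0 := (ENNReal.ofReal_pos.2 hKpos).ne'
  rw [lintegral_const_mul' _ _ ENNReal.ofReal_ne_top] at h2
  have h3 : ENNReal.ofReal C ≤ ENNReal.ofReal (K : ℝ) * ENNReal.ofReal ε := by
    rw [hK]; exact ENNReal.ofReal_le_ofReal (by linarith [le_abs_self C])
  exact (ENNReal.mul_le_mul_iff_right hK0 ENNReal.ofReal_ne_top).1 (h2.trans h3)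

/-- A zero-one law: an event of the future which is invariant under a shift of the time has
probability zero or one. -/
theorem envLaw_eq_zero_or_one {s : Set (Env d)} (hs : MeasurableSet[futureSigma d 0] s) (z : Step d)
    (hinv : shift 1 z.1 ⁻¹' s =ᵐ[envLaw ρ] s) : envLaw ρ s = 0 ∨ envLaw ρ s = 1 := by
  have hs' : MeasurableSet s := by
    rw [futureSigma_eq] at hs; exact cylSigma_le _ _ hs
  have hdep : DependsOn (· ∈ s) {p : ℤ × (Fin d → ℤ) | 0 ≤ p.1} := by
    rw [futureSigma_eq] at hs; exact dependsOn_mem_of_measurableSet hs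
  have hiter : ∀ (n : ℕ) (ω : Env d), (shift 1 z.1)^[n] ω = shift n (n • z.1) ω := fun n ω => by
    induction n with
    | zero => simp
    | succ n ih =>
      rw [Function.iterate_succ_apply', ih, shift_shift, succ_nsmul, add_comm (n • z.1)]
      push_cast
      rw [add_comm (1 : ℤ)]
  -- Up to a null set `s` equals its shift by `n`, which sees only layers at times `≥ n` and is
  -- independent of the first `n` layers. Letting `n` grow, `s` is independent of itself.
  have hindep : ∀ n t, MeasurableSet[layerFiltration d n] t →
      (envLaw ρ).restrict s t = (envLaw ρ s • envLaw ρ) t := fun n t ht => by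
    have ht' : MeasurableSet t := (layerFiltration d).le n t ht
    have hT := measurePreserving_shift ρ n (n • z.1)
    have h1 : shift n (n • z.1) ⁻¹' s =ᵐ[envLaw ρ] s := by
      have := (measurePreserving_shift ρ 1 z.1).quasiMeasurePreserving.preimage_iterate_ae_eq n hinv
      have heq : (shift 1 z.1)^[n] = shift (d := d) n (n • z.1) := funext (hiter n)
      rwa [heq] at this
    rw [Measure.restrict_apply ht', Measure.smul_apply, smul_eq_mul,
      measure_congr (ae_eq_set_inter (ae_eq_refl t) h1.symm), mul_comm,
      envLaw_inter_of_dependsOn ρ ht' (hT.measurable hs') (dependsOn_mem_of_measurableSet ht) ?_,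
      hT.measure_preimage hs'.nullMeasurableSet]
    intro ω ω' h
    refine hdep fun p hp => ?_
    rw [shift_apply, shift_apply]
    refine h _ ?_
    simp only [Set.mem_compl_iff, Set.mem_ofPred_eq] at hp ⊢
    omega
  have h := measure_eq_of_iSup (layerFiltration d).mono' (layerFiltration d).le hindep
    (s := s) (by rw [iSup_layerFiltration]; exact hs)
  rw [Measure.restrict_apply hs', Set.inter_self, Measure.smul_apply, smul_eq_mul] at h
  by_cases h0 : envLaw ρ s = 0
  · exact Or.inl h0
  · right
    have : envLaw ρ s * 1 = envLaw ρ s * envLaw ρ s := by rw [mul_one]; exact h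
    exact ((ENNReal.mul_right_inj h0 (measure_ne_top _ _)).1 this).symm

/-- The partition functions bounded in `L²` converge to a positive function, which is the density
of the environment seen from the tilted walk on the future. -/
theorem exists_density {c₁ C : ℝ} (hc₁ : 0 < c₁) (z₀ : Step d)
    (hell : ∀ z : Step d, ∀ᵐ ω ∂(envLaw ρ), c₁ ≤ transProb ω 0 0 z)
    (hC : ∀ n, ∫⁻ ω, ENNReal.ofReal (polymer ρ θ n ω) ^ 2 ∂(envLaw ρ) ≤ ENNReal.ofReal C) :
    ∃ u : Env d → ℝ, Measurable[futureSigma d 0] u ∧ (∀ ω, 0 < u ω) ∧ Integrable u (envLaw ρ) ∧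
      (∀ᵐ ω ∂(envLaw ρ), Tendsto (fun n => polymer ρ θ n ω) atTop (𝓝 (u ω))) ∧
      ∀ s, MeasurableSet[futureSigma d 0] s →
        (walkLaw ρ θ).map walkEnv s = ∫⁻ ω in s, ENNReal.ofReal (u ω) ∂(envLaw ρ) := by
  have hfut : futureSigma d 0 ≤ MeasurableSpace.pi := by
    rw [futureSigma_eq]; exact cylSigma_le _
  have hUI := uniformIntegrable_polymer ρ θ hC
  have hmart := martingale_polymer ρ θ
  obtain ⟨R, hR⟩ := hUI.2.2
  obtain ⟨v, hvmeas, hvint, hlim, hvcond⟩ : ∃ v : Env d → ℝ, Measurable[futureSigma d 0] v ∧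
      Integrable v (envLaw ρ) ∧
      (∀ᵐ ω ∂(envLaw ρ), Tendsto (fun n => polymer ρ θ n ω) atTop (𝓝 (v ω))) ∧
      ∀ n, polymer ρ θ n =ᵐ[envLaw ρ] (envLaw ρ)[v | layerFiltration d n] := by
    have hm := (Filtration.stronglyMeasurable_limitProcess (f := polymer ρ θ)
      (ℱ := layerFiltration d) (μ := envLaw ρ)).measurable
    rw [iSup_layerFiltration] at hm
    exact ⟨_, hm, (Filtration.memLp_limitProcess_of_eLpNorm_bdd hUI.1 hR).integrable le_rfl,
      hmart.submartingale.ae_tendsto_limitProcess hR, hmart.ae_eq_condExp_limitProcess hUI⟩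
  have hvmeas' : Measurable v := hvmeas.mono hfut le_rfl
  have hv0 : ∀ᵐ ω ∂(envLaw ρ), 0 ≤ v ω := by
    filter_upwards [hlim] with ω hω
    exact ge_of_tendsto' hω fun n => polymer_nonneg ρ θ n ω
  have hdens : ∀ s, MeasurableSet[futureSigma d 0] s →
      (walkLaw ρ θ).map walkEnv s = ∫⁻ ω in s, ENNReal.ofReal (v ω) ∂(envLaw ρ) := by
    have : IsProbabilityMeasure ((walkLaw ρ θ).map walkEnv) :=
      Measure.isProbabilityMeasure_map measurable_walkEnv.aemeasurable
    intro s hs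
    have h := measure_eq_of_iSup (μ := (walkLaw ρ θ).map walkEnv)
      (ν := (envLaw ρ).withDensity fun ω => ENNReal.ofReal (v ω))
      (layerFiltration d).mono' (layerFiltration d).le (fun n t ht => ?_)
      (s := s) (by rw [iSup_layerFiltration]; exact hs)
    · rw [h, withDensity_apply _ (hfut s hs)]
    · have ht' := (layerFiltration d).le n t ht
      rw [withDensity_apply _ ht', walkLaw_preimage_eq_polymer ρ θ ht le_rfl,
        ← ofReal_integral_eq_lintegral_ofReal (integrable_polymer ρ θ n).integrableOn
          (ae_of_all _ fun ω => polymer_nonneg ρ θ n ω),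
        ← ofReal_integral_eq_lintegral_ofReal hvint.integrableOn (ae_restrict_of_ae hv0),
        ← setIntegral_condExp ((layerFiltration d).le n) hvint ht]
      exact congrArg _ (setIntegral_congr_ae ht' ((hvcond n).mono
        fun ω hω _ => hω))
  -- By the recursion and ellipticity, the limit can vanish only if it also vanishes after one step
  -- along `z₀`. The zero set is then contained in a shift of itself with equal measure, hence is
  -- trivial, and full measure would contradict the total mass one.
  have hvpos : ∀ᵐ ω ∂(envLaw ρ), 0 < v ω := by
    set s : Set (Env d) := {ω | v ω ≤ 0} with hsdef
    have hs : MeasurableSet[futureSigma d 0] s := hvmeas measurableSet_Iic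
    have hshift : ∀ᵐ ω ∂(envLaw ρ), ∀ z : Step d,
        Tendsto (fun n => polymer ρ θ n (shift 1 z.1 ω)) atTop (𝓝 (v (shift 1 z.1 ω))) ∧
          0 ≤ v (shift 1 z.1 ω) := by
      rw [ae_all_iff]
      intro z
      exact (measurePreserving_shift ρ 1 z.1).quasiMeasurePreserving.ae (hlim.and hv0)
    have hsub : s ≤ᵐ[envLaw ρ] shift 1 z₀.1 ⁻¹' s := by
      filter_upwards [hlim, hshift, hell z₀] with ω h1 h2 h3 hω
      have h4 : v ω = ∑ z, transProb ω 0 0 z * tiltWeight ρ θ z * v (shift 1 z.1 ω) := by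
        refine tendsto_nhds_unique (h1.comp (tendsto_add_atTop_nat 1)) ?_
        simp only [Function.comp_def, polymer_succ]
        exact tendsto_finsetSum _ fun z _ => (h2 z).1.const_mul _
      have h5 : transProb ω 0 0 z₀ * tiltWeight ρ θ z₀ * v (shift 1 z₀.1 ω) ≤ v ω := by
        rw [h4]
        exact Finset.single_le_sum (f := fun z => transProb ω 0 0 z * tiltWeight ρ θ z *
          v (shift 1 z.1 ω)) (fun z _ => mul_nonneg (mul_nonneg (transProb_nonneg _ _ _ _)
          (tiltWeight_pos ρ θ z).le) (h2 z).2) (Finset.mem_univ z₀)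
      have h6 : 0 < transProb ω 0 0 z₀ * tiltWeight ρ θ z₀ :=
        mul_pos (hc₁.trans_le h3) (tiltWeight_pos ρ θ z₀)
      by_contra hcon
      have h7 : 0 < v (shift 1 z₀.1 ω) := not_le.1 hcon
      have h8 : v ω ≤ 0 := hω
      nlinarith [mul_pos h6 h7]
    have hT := measurePreserving_shift ρ 1 z₀.1
    have hinv : shift 1 z₀.1 ⁻¹' s =ᵐ[envLaw ρ] s :=
      (ae_eq_of_ae_subset_of_measure_ge hsub
        (hT.measure_preimage (hfut s hs).nullMeasurableSet).le (hfut s hs).nullMeasurableSet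
        (measure_ne_top _ _)).symm
    rcases envLaw_eq_zero_or_one ρ hs z₀ hinv with h0 | h1
    · rw [ae_iff]
      simpa only [not_lt] using h0
    · exfalso
      have h2 : ∀ᵐ ω ∂(envLaw ρ), ENNReal.ofReal (v ω) = 0 := by
        have : ∀ᵐ ω ∂(envLaw ρ), ω ∈ s := (prob_compl_eq_zero_iff (hfut s hs)).2 h1
        exact this.mono fun ω hω => ENNReal.ofReal_of_nonpos hω
      have h3 := hdens Set.univ MeasurableSet.univ
      rw [Measure.restrict_univ, lintegral_congr_ae h2, Measure.map_apply measurable_walkEnv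
        MeasurableSet.univ] at h3
      simp at h3
  classical
  -- Changing the limit on a null set makes it positive everywhere, as the quotient in the kernel
  -- requires.
  refine ⟨fun ω => if 0 < v ω then v ω else 1, ?_, fun ω => ?_, ?_, ?_, ?_⟩
  · exact Measurable.ite (hvmeas measurableSet_Ioi) hvmeas measurable_const
  · beta_reduce
    split_ifs with h
    · exact h
    · exact one_pos
  · exact hvint.congr (hvpos.mono fun ω hω => (if_pos hω).symm)
  · filter_upwards [hlim, hvpos] with ω h1 h2
    rwa [if_pos h2]
  · intro s hs
    rw [hdens s hs]
    refine lintegral_congr_ae (ae_restrict_of_ae (hvpos.mono fun ω hω => ?_))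
    simp only [if_pos hω]

end Limit

/-! ### The tilted measure on environments and paths -/

/-- Pass from `x` to `y` through the hybrid equal to `x` on `S` and to `y` elsewhere: the first
change is invisible to `S`, the second to `T`. -/
theorem dependsOn_inter {ι α β : Type*} {S T : Set ι} {f : (ι → α) → β} (hS : DependsOn f S)
    (hT : DependsOn f T) : DependsOn f (S ∩ T) := by
  intro x y h
  rw [hS (y := mixOn S (x, y)) fun i hi => (mixOn_of_mem hi (x, y)).symm]
  refine hT fun i hi => ?_
  by_cases hiS : i ∈ S
  · rw [mixOn_of_mem hiS]; exact h i ⟨hiS, hi⟩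
  · rw [mixOn_of_notMem hiS]

theorem dependsOn_of_measurable_strip {m n : ℤ} {f : Env d → ℝ}
    (hf : Measurable[futureSigma d m ⊓ pastSigma d n] f) :
    DependsOn f {p : ℤ × (Fin d → ℤ) | m ≤ p.1 ∧ p.1 ≤ n} := by
  rw [futureSigma_eq, pastSigma_eq] at hf
  exact dependsOn_inter (dependsOn_of_measurable_cylSigma (hf.mono inf_le_left le_rfl))
    (dependsOn_of_measurable_cylSigma (hf.mono inf_le_right le_rfl))

section Tilted

variable (ρ : Measure (SiteEnv d)) [IsProbabilityMeasure ρ] (θ : EuclideanSpace ℝ (Fin d))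

theorem integrable_sum_pathWeight_mul {L : ℕ} {F : Env d → (Fin L → Step d) → ℝ} {C : ℝ}
    (hF : ∀ z, Measurable fun ω => F ω z) (hC : ∀ ω z, |F ω z| ≤ C) :
    Integrable (fun ω => ∑ z, pathWeight ρ θ ω z * F ω z) (envLaw ρ) := by
  refine integrable_finsetSum _ fun z _ => Integrable.bdd_mul (c := C) ?_
    (hF z).aestronglyMeasurable (ae_of_all _ fun ω => by simpa using hC ω z) |>.congr
      (ae_of_all _ fun ω => mul_comm _ _)
  refine Integrable.of_bound (C := Real.exp (⟪θ, toVec (pathPos z L)⟫ - (L : ℝ) * logMGF ρ θ))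
    (measurable_pathWeight ρ θ z).aestronglyMeasurable (ae_of_all _ fun ω => ?_)
  rw [Real.norm_of_nonneg (pathWeight_nonneg ρ θ ω z)]
  exact mul_le_of_le_one_left (Real.exp_pos _).le (quenchedProb_le_one ω z)

theorem integral_walkLaw {L : ℕ} {F : Env d → (Fin L → Step d) → ℝ} {C : ℝ}
    (hF : ∀ z, Measurable fun ω => F ω z) (hC : ∀ ω z, |F ω z| ≤ C)
    (hdep : ∀ z, DependsOn (fun ω => F ω z) {p : ℤ × (Fin d → ℤ) | 0 ≤ p.1 ∧ p.1 < L}) :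
    ∫ ϑ, F (walkEnv ϑ) (firstSteps L ϑ) ∂(walkLaw ρ θ) =
      ∫ ω, ∑ z, pathWeight ρ θ ω z * F ω z ∂(envLaw ρ) := by
  have hjoint : ∀ {F : Env d → (Fin L → Step d) → ℝ}, (∀ z, Measurable fun ω => F ω z) →
      Measurable fun ϑ => F (walkEnv ϑ) (firstSteps L ϑ) := fun {F} hF =>
    (measurable_from_prod_countable_left (f := fun q : Env d × (Fin L → Step d) => F q.1 q.2) hF).comp
      (measurable_walkEnv.prodMk (measurable_firstSteps L))
  have hnn : ∀ F : Env d → (Fin L → Step d) → ℝ, (∀ z, Measurable fun ω => F ω z) →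
      (∀ ω z, 0 ≤ F ω z) →
      (∀ z, DependsOn (fun ω => F ω z) {p : ℤ × (Fin d → ℤ) | 0 ≤ p.1 ∧ p.1 < L}) →
      ∫ ϑ, F (walkEnv ϑ) (firstSteps L ϑ) ∂(walkLaw ρ θ) =
        ∫ ω, ∑ z, pathWeight ρ θ ω z * F ω z ∂(envLaw ρ) := by
    intro F hF h0 hdep
    rw [integral_eq_lintegral_of_nonneg_ae (ae_of_all _ fun ϑ => h0 _ _)
      (hjoint hF).aestronglyMeasurable, integral_eq_lintegral_of_nonneg_ae
      (ae_of_all _ fun ω => Finset.sum_nonneg fun z _ => mul_nonneg (pathWeight_nonneg ρ θ ω z)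
        (h0 _ _)) (Finset.measurable_sum _ fun z _ =>
          (measurable_pathWeight ρ θ z).mul (hF z)).aestronglyMeasurable,
      lintegral_walkLaw ρ θ L (fun ω z => ENNReal.ofReal (F ω z)) (fun z => (hF z).ennreal_ofReal)
        fun z ω ω' h => congrArg ENNReal.ofReal (hdep z h)]
    congr 1
    refine lintegral_congr fun ω => ?_
    rw [ENNReal.ofReal_sum_of_nonneg fun z _ => mul_nonneg (pathWeight_nonneg ρ θ ω z) (h0 _ _)]
    exact Finset.sum_congr rfl fun z _ => (ENNReal.ofReal_mul (pathWeight_nonneg ρ θ ω z)).symm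
  have hC0 : 0 ≤ |C| := abs_nonneg C
  have hbd : ∀ ω z, |F ω z| ≤ |C| := fun ω z => (hC ω z).trans (le_abs_self C)
  -- Adding the constant |C| makes the integrand nonnegative; its contribution is subtracted at the
  -- end.
  have h1 := hnn (fun ω z => F ω z + |C|) (fun z => (hF z).add_const _)
    (fun ω z => by linarith [(abs_le.1 (hbd ω z)).1])
    fun z ω ω' h => by simp only [hdep z h]
  have h2 := hnn (fun _ _ => |C|) (fun z => measurable_const) (fun _ _ => hC0)
    fun z ω ω' _ => rfl
  have hint1 : Integrable (fun ϑ => F (walkEnv ϑ) (firstSteps L ϑ)) (walkLaw ρ θ) :=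
    Integrable.of_bound (C := |C|) (hjoint hF).aestronglyMeasurable
      (ae_of_all _ fun ϑ => hbd _ _)
  have hint2 := integrable_sum_pathWeight_mul ρ θ hF hC
  have hint3 := integrable_sum_pathWeight_mul ρ θ (L := L) (F := fun _ _ => |C|) (C := |C|)
    (fun z => measurable_const) (fun _ _ => by rw [abs_abs])
  simp only [mul_add, Finset.sum_add_distrib] at h1
  rw [integral_add hint1 (integrable_const _), integral_add hint2 hint3, h2] at h1
  linarith

/-- The environment and the path of the tilted walk. -/
def tiltedMeasure : Measure (Env d × (ℕ → Step d)) :=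
  (walkLaw ρ θ).map fun ϑ => (walkEnv ϑ, fun i : ℕ => (ϑ i).1)

theorem isTiltedMeasure_tiltedMeasure : IsTiltedMeasure ρ θ (tiltedMeasure ρ θ) := by
  have hmeas : Measurable fun ϑ : Traj d => (walkEnv ϑ, fun i : ℕ => (ϑ i).1) := by fun_prop
  refine ⟨Measure.isProbabilityMeasure_map hmeas.aemeasurable, fun N M K f ⟨C, hC⟩ hf => ?_⟩
  have hfm : ∀ z, Measurable fun ω => f ω z := fun z => (hf z).mono
    (inf_le_left.trans (by rw [futureSigma_eq]; exact cylSigma_le _)) le_rfl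
  have hfj : Measurable fun q : Env d × (Fin K → Step d) => f q.1 q.2 :=
    measurable_from_prod_countable_left hfm
  have hfp : Measurable fun p : Env d × (ℕ → Step d) => f p.1 fun i : Fin K => p.2 i.val :=
    hfj.comp (measurable_fst.prodMk (by fun_prop))
  have hG : Measurable fun ϑ : Traj d => f (walkEnv ϑ) fun i : Fin K => (ϑ (i.val : ℕ)).1 :=
    hfp.comp hmeas
  -- Shifting time by `N` moves the layers -N, …, M to 0, …, N + M and the observed steps to N, …, N
  -- + K - 1. All of these lie before the horizon N + M + K + 1.
  rw [tiltedMeasure, integral_map hmeas.aemeasurable hfp.aestronglyMeasurable,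
    ← (measurePreserving_timeShift ρ θ N).map_eq,
    integral_map (measurable_timeShift _).aemeasurable hG.aestronglyMeasurable]
  have hN : N ≤ N + M + K + 1 := by omega
  let F : Env d → (Fin (N + M + K + 1) → Step d) → ℝ := fun ω z =>
    f (shift N (pathPos z N) ω) fun i : Fin K => z ⟨N + i.val, by have := i.isLt; omega⟩
  have h1 : ∀ ϑ : Traj d, f (walkEnv (timeShift N ϑ))
      (fun i : Fin K => (timeShift N ϑ (i.val : ℕ)).1) =
        F (walkEnv ϑ) (firstSteps (N + M + K + 1) ϑ) := fun ϑ => by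
    simp only [F, walkEnv_timeShift, pathPos_firstSteps hN, firstSteps, timeShift]
    push_cast
    simp only [add_comm]
  simp only [h1]
  rw [integral_walkLaw ρ θ (F := F) (C := C) (fun z => (hfm _).comp (measurable_shift _ _))
    (fun ω z => hC _ _) fun z ω ω' h => dependsOn_of_measurable_strip (hf _) fun p hp => ?_]
  · rw [averagedExp]
    refine integral_congr_ae (ae_of_all _ fun ω => Finset.sum_congr rfl fun z _ => ?_)
    simp only [pathWeight, F, mul_assoc]
  · rw [shift_apply, shift_apply]
    refine h _ ?_
    simp only [Set.mem_ofPred_eq] at hp ⊢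
    push_cast
    omega

variable {ρ θ}

/-- Taking all three parameters equal to `n` fixes the measure on a strip of width `2n + 1` together
with the first `n` steps. These σ-algebras increase to the full one. -/
theorem IsTiltedMeasure.unique {ν ν' : Measure (Env d × (ℕ → Step d))}
    (hν : IsTiltedMeasure ρ θ ν) (hν' : IsTiltedMeasure ρ θ ν') : ν = ν' := by
  have := hν.1
  have := hν'.1
  let strip : ℕ → Set (ℤ × (Fin d → ℤ)) := fun n => {p | -(n : ℤ) ≤ p.1 ∧ p.1 ≤ n}
  let g : ∀ n, Env d × (ℕ → Step d) → (strip n → SiteEnv d) × (Fin n → Step d) := fun n p =>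
    ((strip n).domRestrict p.1, fun i : Fin n => p.2 i.val)
  let m : ℕ → MeasurableSpace (Env d × (ℕ → Step d)) := fun n => MeasurableSpace.comap (g n)
    inferInstance
  have hgm : ∀ n, Measurable (g n) := fun n =>
    Measurable.prodMk (f := fun p : Env d × (ℕ → Step d) => (strip n).domRestrict p.1)
      (g := fun p (i : Fin n) => p.2 i.val)
      (measurable_pi_lambda _ fun p => (measurable_pi_apply _).comp measurable_fst)
      (measurable_pi_lambda _ fun i => (measurable_pi_apply _).comp measurable_snd)
  have hcoord1 : ∀ n (p : strip n), Measurable[m n] fun q : Env d × (ℕ → Step d) => q.1 p.1 :=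
    fun n p => (show Measurable fun v : (strip n → SiteEnv d) × (Fin n → Step d) => v.1 p
      by fun_prop).comp (comap_measurable (g n))
  have hcoord2 : ∀ n (i : Fin n), Measurable[m n] fun q : Env d × (ℕ → Step d) => q.2 i.val :=
    fun n i => (show Measurable fun v : (strip n → SiteEnv d) × (Fin n → Step d) => v.2 i
      by fun_prop).comp (comap_measurable (g n))
  have hmono : Monotone m := by
    intro n k hnk
    refine Measurable.comap_le (m₁ := m k) ?_
    refine Measurable.prodMk (m := m k) ?_ ?_
    · refine (@measurable_pi_iff _ _ _ (m k) _ _).2 fun p => ?_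
      have hp := p.2
      exact hcoord1 k ⟨p.1, by
        simp only [strip, Set.mem_ofPred_eq] at hp ⊢; omega⟩
    · exact (@measurable_pi_iff _ _ _ (m k) _ _).2 fun i => hcoord2 k ⟨i.1, by omega⟩
  have hagree : ∀ n s, MeasurableSet[m n] s → ν s = ν' s := by
    rintro n s ⟨t, ht, rfl⟩
    let f : Env d → (Fin n → Step d) → ℝ := fun ω z =>
      t.indicator 1 ((strip n).domRestrict ω, z)
    have hbd : ∃ C : ℝ, ∀ ω z, |f ω z| ≤ C := ⟨1, fun ω z => by
      by_cases h : ((strip n).domRestrict ω, z) ∈ t <;> simp [f, h]⟩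
    have hfm : ∀ z, Measurable[futureSigma d (-(n : ℤ)) ⊓ pastSigma d (n : ℤ)]
        fun ω => f ω z := fun z => by
      have h1 : Measurable fun v : strip n → SiteEnv d =>
          t.indicator (1 : (strip n → SiteEnv d) × (Fin n → Step d) → ℝ) (v, z) :=
        (measurable_one.indicator ht).comp (by fun_prop)
      refine h1.comp ?_
      refine (@measurable_pi_iff _ _ _ (futureSigma d (-(n : ℤ)) ⊓ pastSigma d (n : ℤ)) _ _).2
        fun p => Measurable.of_comap_le (le_inf ?_ ?_)
      · rw [futureSigma_eq]
        exact le_iSup₂_of_le (f := fun (i : ℤ × (Fin d → ℤ)) _ =>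
          MeasurableSpace.comap (fun ω : Env d => ω i) inferInstance) p.1 p.2.1 le_rfl
      · rw [pastSigma_eq]
        exact le_iSup₂_of_le (f := fun (i : ℤ × (Fin d → ℤ)) _ =>
          MeasurableSpace.comap (fun ω : Env d => ω i) inferInstance) p.1 p.2.2 le_rfl
    have h := (hν.2 n n n f hbd hfm).trans (hν'.2 n n n f hbd hfm).symm
    have h2 : ∀ p : Env d × (ℕ → Step d), f p.1 (fun i : Fin n => p.2 i.val) =
        (g n ⁻¹' t).indicator 1 p := fun p => rfl
    simp only [h2] at h
    rw [integral_indicator_one (hgm n ht), integral_indicator_one (hgm n ht)] at h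
    exact (measureReal_eq_measureReal_iff).1 h
  ext s hs
  refine measure_eq_of_iSup hmono (fun n => (hgm n).comap_le) hagree ?_
  have hid : @Measurable _ _ (⨆ n, m n) Prod.instMeasurableSpace fun q : Env d × (ℕ → Step d) => (q.1, q.2) := by
    refine Measurable.prodMk (m := ⨆ n, m n) ?_ ?_
    · refine (@measurable_pi_iff _ _ _ (⨆ n, m n) _ _).2 fun p => ?_
      exact (hcoord1 p.1.natAbs ⟨p, by simp only [strip, Set.mem_ofPred_eq]; omega⟩).mono
        (le_iSup m _) le_rfl
    · refine (@measurable_pi_iff _ _ _ (⨆ n, m n) _ _).2 fun i => ?_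
      exact (hcoord2 (i + 1) ⟨i, by omega⟩).mono (le_iSup m _) le_rfl
  exact hid hs

variable (ρ θ)

@[fun_prop]
theorem measurable_shift_uncurry (k : ℤ) :
    Measurable fun q : (Fin d → ℤ) × Env d => shift k q.1 q.2 :=
  measurable_from_prod_countable_right fun x => measurable_shift k x

theorem measurable_envTrajectory :
    Measurable (envTrajectory : Env d × (ℕ → Step d) → ℕ → Env d) := by
  refine measurable_pi_lambda _ fun k => ?_
  refine (measurable_shift_uncurry (k : ℤ)).comp (Measurable.prodMk ?_ measurable_fst)
  have h : ∀ i, Measurable fun p : Env d × (ℕ → Step d) => (p.2 i).1 := fun i =>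
    measurable_subtype_coe.comp ((measurable_pi_apply i).comp measurable_snd)
  exact Finset.measurable_sum (Finset.range k) fun i _ => h i

/-- The environments seen from the tilted walk at the times `k ≥ 0`. -/
def seenFrom (ϑ : Traj d) : ℕ → Env d := fun k => walkEnv (timeShift k ϑ)

@[fun_prop]
theorem measurable_seenFrom : Measurable (seenFrom : Traj d → ℕ → Env d) := by
  unfold seenFrom; fun_prop

theorem map_envTrajectory_tiltedMeasure :
    (tiltedMeasure ρ θ).map envTrajectory = (walkLaw ρ θ).map seenFrom := by
  rw [tiltedMeasure, Measure.map_map measurable_envTrajectory (by fun_prop)]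
  congr 1
  funext ϑ k
  rw [seenFrom, walkEnv_timeShift, Function.comp_apply, envTrajectory]
  congr 1
  induction k with
  | zero => simp
  | succ k ih =>
    push_cast
    rw [Finset.sum_range_succ, ih, walkPos_add_one]

end Tilted

/-! ### The Markov property of the environment seen from the tilted walk -/

section Doob

variable (ρ : Measure (SiteEnv d)) [IsProbabilityMeasure ρ] (θ : EuclideanSpace ℝ (Fin d))
  (u : Env d → ℝ)

/-- The weight given by `doobKernel` to the step `z`. -/
def doobWeight (ω : Env d) (z : Step d) : ℝ≥0∞ :=
  ENNReal.ofReal (transProb ω 0 0 z * (u (shift 1 z.1 ω) / u ω) *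
    Real.exp (⟪θ, toVec z.1⟫ - logMGF ρ θ))

/-- The integral of `f` against `doobKernel`. -/
def doobOp (f : Env d → ℝ≥0∞) (ω : Env d) : ℝ≥0∞ :=
  ∑ z, doobWeight ρ θ u ω z * f (shift 1 z.1 ω)

variable {ρ θ u}

@[fun_prop]
theorem measurable_doobWeight (hu : Measurable u) (z : Step d) :
    Measurable fun ω => doobWeight ρ θ u ω z := by
  unfold doobWeight; fun_prop

@[fun_prop]
theorem measurable_doobOp (hu : Measurable u) {f : Env d → ℝ≥0∞} (hf : Measurable f) :
    Measurable (doobOp ρ θ u f) := by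
  unfold doobOp
  exact Finset.measurable_sum _ fun z _ =>
    (measurable_doobWeight hu z).mul (hf.comp (measurable_shift _ _))

theorem doobKernel_apply (ω : Env d) {A : Set (Env d)} (hA : MeasurableSet A) :
    doobKernel ρ θ u ω A = doobOp ρ θ u (A.indicator 1) ω := by
  simp only [doobKernel, doobOp, doobWeight, Measure.coe_finsetSum, Finset.sum_apply,
    Measure.smul_apply, smul_eq_mul, Measure.dirac_apply' _ hA]

/-- Integrating against the density `u` cancels the denominator of the kernel and leaves the plain
tilted weight times `u` after the step. -/
theorem doobWeight_mul (hu : ∀ ω, 0 < u ω) (ω : Env d) (z : Step d) :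
    doobWeight ρ θ u ω z * ENNReal.ofReal (u ω) =
      ENNReal.ofReal (transProb ω 0 0 z * tiltWeight ρ θ z) *
        ENNReal.ofReal (u (shift 1 z.1 ω)) := by
  have h1 : 0 ≤ transProb ω 0 0 z * (u (shift 1 z.1 ω) / u ω) *
      Real.exp (⟪θ, toVec z.1⟫ - logMGF ρ θ) :=
    mul_nonneg (mul_nonneg (transProb_nonneg _ _ _ _) (div_pos (hu _) (hu _)).le)
      (Real.exp_pos _).le
  rw [doobWeight, ← ENNReal.ofReal_mul h1, ← ENNReal.ofReal_mul
    (mul_nonneg (transProb_nonneg _ _ _ _) (tiltWeight_pos ρ θ z).le)]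
  congr 1
  have := (hu ω).ne'
  simp only [tiltWeight]
  field_simp

theorem dependsOn_doobWeight {u : Env d → ℝ}
    (hdep : DependsOn u {p : ℤ × (Fin d → ℤ) | 0 ≤ p.1}) (z : Step d) :
    DependsOn (fun ω => doobWeight ρ θ u ω z) {p : ℤ × (Fin d → ℤ) | 0 ≤ p.1} := by
  intro ω ω' h
  have h1 : u (shift 1 z.1 ω) = u (shift 1 z.1 ω') := hdep fun p hp => by
    rw [shift_apply, shift_apply]
    refine h _ ?_
    simp only [Set.mem_ofPred_eq] at hp ⊢
    omega
  have h2 : transProb ω 0 0 z = transProb ω' 0 0 z := by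
    rw [transProb, transProb, h (0, 0) (le_refl (0 : ℤ))]
  simp only [doobWeight, h1, h2, hdep h]

/-- One application of the kernel moves the dependence on layers forward by one time unit, but not
beyond time `0`, because the weights themselves read the layers from time `0` on. -/
theorem dependsOn_doobOp {u : Env d → ℝ}
    (hdep : DependsOn u {p : ℤ × (Fin d → ℤ) | 0 ≤ p.1}) {f : Env d → ℝ≥0∞} {n : ℤ} {k : ℤ}
    (hk : k ≤ 0) (hkn : k ≤ n + 1) (hf : DependsOn f {p : ℤ × (Fin d → ℤ) | n ≤ p.1}) :
    DependsOn (doobOp ρ θ u f) {p : ℤ × (Fin d → ℤ) | k ≤ p.1} := by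
  intro ω ω' h
  refine Finset.sum_congr rfl fun z _ => ?_
  have h1 : doobWeight ρ θ u ω z = doobWeight ρ θ u ω' z :=
    dependsOn_doobWeight (ρ := ρ) (θ := θ) hdep z fun p hp => h p (hk.trans hp)
  rw [h1]
  congr 1
  refine hf fun p hp => ?_
  rw [shift_apply, shift_apply]
  refine h _ ?_
  simp only [Set.mem_ofPred_eq] at hp ⊢
  omega

end Doob

/-- The properties of the function `u^θ` used for the Markov property. -/
structure IsFutureDensity (ρ : Measure (SiteEnv d)) [IsProbabilityMeasure ρ]
    (θ : EuclideanSpace ℝ (Fin d)) (u : Env d → ℝ) : Prop where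
  measurable : Measurable[futureSigma d 0] u
  pos : ∀ ω, 0 < u ω
  density : ∀ s, MeasurableSet[futureSigma d 0] s →
    (walkLaw ρ θ).map walkEnv s = ∫⁻ ω in s, ENNReal.ofReal (u ω) ∂(envLaw ρ)

theorem futureSigma_le (n : ℤ) : futureSigma d n ≤ MeasurableSpace.pi := by
  rw [futureSigma_eq]; exact cylSigma_le _

theorem measurable_future_of_dependsOn {β : Type*} [MeasurableSpace β] [Nonempty (SiteEnv d)]
    {n : ℤ} {f : Env d → β} (hf : Measurable f)
    (hdep : DependsOn f {p : ℤ × (Fin d → ℤ) | n ≤ p.1}) : Measurable[futureSigma d n] f := by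
  rw [futureSigma_eq]; exact measurable_cylSigma_of_dependsOn hf hdep

section Markov

variable {ρ : Measure (SiteEnv d)} [IsProbabilityMeasure ρ] {θ : EuclideanSpace ℝ (Fin d)}
  {u : Env d → ℝ}

theorem IsFutureDensity.measurable' (hu : IsFutureDensity ρ θ u) : Measurable u :=
  hu.measurable.mono (futureSigma_le 0) le_rfl

theorem IsFutureDensity.dependsOn (hu : IsFutureDensity ρ θ u) :
    DependsOn u {p : ℤ × (Fin d → ℤ) | 0 ≤ p.1} := by
  have := hu.measurable
  rw [futureSigma_eq] at this
  exact dependsOn_of_measurable_cylSigma this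

theorem IsFutureDensity.lintegral_walkEnv (hu : IsFutureDensity ρ θ u) {φ : Env d → ℝ≥0∞}
    (hφ : Measurable φ) (hdep : DependsOn φ {p : ℤ × (Fin d → ℤ) | 0 ≤ p.1}) :
    ∫⁻ ϑ, φ (walkEnv ϑ) ∂(walkLaw ρ θ) =
      ∫⁻ ω, φ ω * ENNReal.ofReal (u ω) ∂(envLaw ρ) := by
  have : Nonempty (SiteEnv d) := nonempty_of_isProbabilityMeasure ρ
  rw [← lintegral_map hφ measurable_walkEnv, lintegral_eq_of_agree (futureSigma_le 0)
    (ν := (envLaw ρ).withDensity fun ω => ENNReal.ofReal (u ω)) (fun s hs => ?_)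
    (measurable_future_of_dependsOn hφ hdep),
    lintegral_withDensity_eq_lintegral_mul _ hu.measurable'.ennreal_ofReal hφ]
  · exact lintegral_congr fun ω => mul_comm _ _
  · rw [hu.density s hs, withDensity_apply _ (futureSigma_le 0 s hs)]

/-- The conditional law of the first step given the future of the environment. -/
theorem IsFutureDensity.lintegral_firstStep (hu : IsFutureDensity ρ θ u) {φ : Env d → ℝ≥0∞}
    (hφ : Measurable φ) (hdep : DependsOn φ {p : ℤ × (Fin d → ℤ) | 0 ≤ p.1}) (z : Step d) :
    ∫⁻ ϑ, φ (walkEnv ϑ) * ({z} : Set (Step d)).indicator 1 (ϑ 0).1 ∂(walkLaw ρ θ) =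
      ∫⁻ ϑ, φ (walkEnv ϑ) * doobWeight ρ θ u (walkEnv ϑ) z ∂(walkLaw ρ θ) := by
  have hum := hu.measurable'
  have hind : Measurable (({z} : Set (Step d)).indicator (1 : Step d → ℝ≥0∞)) :=
    measurable_one.indicator (measurableSet_singleton z)
  rw [hu.lintegral_walkEnv (φ := fun ω => φ ω * doobWeight ρ θ u ω z) (by fun_prop)
    fun ω ω' h => by
      simp only [hdep h, dependsOn_doobWeight (ρ := ρ) (θ := θ) hu.dependsOn z h]]
  simp only [mul_assoc, doobWeight_mul hu.pos]
  rw [lintegral_consTraj ρ θ (by fun_prop), lintegral_stepLaw ρ θ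
    (Measurable.lintegral_prod_right' (f := fun q : (Step d × Env d) × Traj d =>
      φ (walkEnv (consTraj q.1 q.2)) * ({z} : Set (Step d)).indicator 1 (consTraj q.1 q.2 0).1)
      (by fun_prop)), Finset.sum_eq_single z]
  -- With the layer `ℓ` frozen, the remaining sequence has the same law, and its environment again
  -- has density `u` on the future. This is the factor `u` seen after the step.
  · conv_rhs => rw [lintegral_glue ρ z (by fun_prop)]
    refine lintegral_congr fun ℓ => ?_
    have hg := (measurable_glue z).comp (measurable_prodMk_left (x := ℓ) (β := Env d))
    have h1 : ∀ ϑ : Traj d, φ (walkEnv (consTraj (z, ℓ) ϑ)) *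
        ({z} : Set (Step d)).indicator 1 (consTraj (z, ℓ) ϑ 0).1 = φ (glue z ℓ (walkEnv ϑ)) :=
      fun ϑ => by
        rw [consTraj_zero, Set.indicator_of_mem (by simp), Pi.one_apply, mul_one]
        exact hdep fun p hp => walkEnv_consTraj z ℓ ϑ hp
    have hm : Measurable fun η => φ (glue z ℓ η) * ENNReal.ofReal (u η) :=
      (hφ.comp hg).mul hum.ennreal_ofReal
    simp only [h1]
    rw [hu.lintegral_walkEnv (φ := fun η => φ (glue z ℓ η)) (hφ.comp hg) fun η η' h =>
      hdep fun p hp => ?_, ← lintegral_const_mul _ hm]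
    · refine lintegral_congr fun η => ?_
      rw [hu.dependsOn fun p (hp : 0 ≤ p.1) => shift_glue z ℓ η hp]
      simp only [transProb, glue_zero]
      ring
    · obtain ⟨n, x⟩ := p
      by_cases hn : n = 0
      · subst hn; rw [glue_zero, glue_zero]
      · rw [glue_of_ne _ _ _ hn, glue_of_ne _ _ _ hn]
        refine h _ ?_
        simp only [Set.mem_ofPred_eq] at hp ⊢
        omega
  · intro z' _ hz'
    simp [hz']
  · simp

/-- The conditional law of the first step given the environment and the past of the walk. -/
theorem IsFutureDensity.lintegral_firstStep_past (hu : IsFutureDensity ρ θ u)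
    {H : Env d → Traj d → ℝ≥0∞} (hH : Measurable fun q : Env d × Traj d => H q.1 q.2)
    (hdep : ∀ ω, DependsOn (H ω) {n : ℤ | n < 0}) (z : Step d) :
    ∫⁻ ϑ, H (walkEnv ϑ) ϑ * ({z} : Set (Step d)).indicator 1 (ϑ 0).1 ∂(walkLaw ρ θ) =
      ∫⁻ ϑ, H (walkEnv ϑ) ϑ * doobWeight ρ θ u (walkEnv ϑ) z ∂(walkLaw ρ θ) := by
  have hum := hu.measurable'
  have hind : Measurable (({z} : Set (Step d)).indicator (1 : Step d → ℝ≥0∞)) :=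
    measurable_one.indicator (measurableSet_singleton z)
  have hH' : Measurable fun ϑ => H (walkEnv ϑ) ϑ := hH.comp (measurable_walkEnv.prodMk measurable_id)
  have hmix := measurePreserving_mixOn (stepLaw ρ θ) {n : ℤ | n < 0}
  have hQ : walkLaw ρ θ = Measure.infinitePi fun _ : ℤ => stepLaw ρ θ := rfl
  rw [← hQ] at hmix
  -- Splitting the i.i.d. sequence at time `0` splits the environment at layer `0`. With the
  -- negative half frozen, the claim reduces to conditioning on the future alone.
  have henv : ∀ q : Traj d × Traj d, walkEnv (mixOn {n : ℤ | n < 0} q) =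
      mixOn {p | p.1 < 0} (walkEnv q.1, walkEnv q.2) := fun q => by
    funext p
    by_cases hp : p.1 < 0
    · rw [mixOn_of_mem (by exact hp)]
      exact walkEnv_congr_past hp fun i hi => mixOn_of_mem (by exact hi) q
    · rw [mixOn_of_notMem (by exact hp)]
      exact walkEnv_congr_future (not_lt.1 hp) fun i hi _ =>
        mixOn_of_notMem (by simpa using hi) q
  have hstep : ∀ q : Traj d × Traj d, mixOn {n : ℤ | n < 0} q 0 = q.2 0 := fun q =>
    mixOn_of_notMem (by simp) q
  have hHmix : ∀ (ω : Env d) (q : Traj d × Traj d), H ω (mixOn {n : ℤ | n < 0} q) = H ω q.1 :=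
    fun ω q => hdep ω fun i hi => mixOn_of_mem hi q
  have hdw : ∀ ϑ ϑ' : Traj d, doobWeight ρ θ u (mixOn {p | p.1 < 0} (walkEnv ϑ, walkEnv ϑ')) z =
      doobWeight ρ θ u (walkEnv ϑ') z := fun ϑ ϑ' =>
    dependsOn_doobWeight (ρ := ρ) (θ := θ) hu.dependsOn z fun p hp =>
      mixOn_of_notMem (by simpa using hp) _
  rw [← hmix.lintegral_comp (by fun_prop), ← hmix.lintegral_comp (by fun_prop),
    lintegral_prod _ (by fun_prop), lintegral_prod _ (by fun_prop)]
  refine lintegral_congr fun ϑ => ?_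
  simp only [henv, hstep, hHmix]
  rw [lintegral_congr fun ϑ' => congrArg _ (hdw ϑ ϑ')]
  refine hu.lintegral_firstStep (φ := fun ω => H (mixOn {p | p.1 < 0} (walkEnv ϑ, ω)) ϑ) ?_
    (fun ω ω' h => ?_) z
  · have h1 : Measurable fun ω : Env d =>
        ((mixOn {p : ℤ × (Fin d → ℤ) | p.1 < 0} (walkEnv ϑ, ω) : Env d), ϑ) := by fun_prop
    exact hH.comp h1
  · have : mixOn {p : ℤ × (Fin d → ℤ) | p.1 < 0} (walkEnv ϑ, ω) =
        mixOn {p : ℤ × (Fin d → ℤ) | p.1 < 0} (walkEnv ϑ, ω') := by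
      funext p
      by_cases hp : p.1 < 0
      · rw [mixOn_of_mem (by exact hp), mixOn_of_mem (by exact hp)]
      · rw [mixOn_of_notMem (by exact hp), mixOn_of_notMem (by exact hp)]
        exact h p (not_lt.1 hp)
    simp only [this]

/-- After moving time `n` to the origin, the earlier environments are shifts of the present one
along the walk at negative times. They are therefore functions of the present environment and the
past of the walk, whose influence on the next step is already known. -/
theorem IsFutureDensity.lintegral_seenFrom_succ (hu : IsFutureDensity ρ θ u) (n : ℕ)
    {Φ : (Fin (n + 1) → Env d) → ℝ≥0∞} (hΦ : Measurable Φ) {f : Env d → ℝ≥0∞}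
    (hf : Measurable f) :
    ∫⁻ ϑ, Φ (fun i => seenFrom ϑ i.val) * f (seenFrom ϑ (n + 1)) ∂(walkLaw ρ θ) =
      ∫⁻ ϑ, Φ (fun i => seenFrom ϑ i.val) * doobOp ρ θ u f (seenFrom ϑ n) ∂(walkLaw ρ θ) := by
  have hum := hu.measurable'
  let past : Env d → Traj d → Fin (n + 1) → Env d := fun ω ϑ i =>
    shift ((i.val : ℤ) - n) (walkPos ϑ ((i.val : ℤ) - n)) ω
  have hpast : Measurable fun q : Env d × Traj d => past q.1 q.2 :=
    measurable_pi_lambda _ fun i => (measurable_shift_uncurry _).comp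
      (Measurable.prodMk ((measurable_walkPos _).comp measurable_snd) measurable_fst)
  have hpast_eq : ∀ ϑ : Traj d,
      (fun i : Fin (n + 1) => seenFrom ϑ i.val) = past (walkEnv (timeShift n ϑ)) (timeShift n ϑ) :=
    fun ϑ => by
      funext i
      simp only [past, seenFrom]
      rw [← walkEnv_timeShift, timeShift_timeShift, sub_add_cancel]
  have hnext : ∀ ϑ : Traj d, seenFrom ϑ (n + 1) =
      shift 1 (timeShift n ϑ 0).1.1 (walkEnv (timeShift n ϑ)) := fun ϑ => by
    have h1 : walkPos (timeShift n ϑ) 1 = (timeShift n ϑ 0).1.1 := by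
      have := walkPos_add_one (timeShift n ϑ) 0
      simpa using this
    rw [← h1, ← walkEnv_timeShift, timeShift_timeShift, seenFrom]
    push_cast
    rw [add_comm (n : ℤ)]
  simp only [hnext, hpast_eq]
  have hsucc : Measurable fun ϑ : Traj d => shift 1 (ϑ 0).1.1 (walkEnv ϑ) :=
    (measurable_shift_uncurry 1).comp (Measurable.prodMk
      ((measurable_subtype_coe (p := fun z : Fin d → ℤ => ∑ i, |z i| = 1)).comp
        (measurable_fst.comp (measurable_pi_apply 0))) measurable_walkEnv)
  have hpast' : Measurable fun ϑ : Traj d => past (walkEnv ϑ) ϑ :=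
    hpast.comp (measurable_walkEnv.prodMk measurable_id)
  have hop := measurable_doobOp (ρ := ρ) (θ := θ) hum hf
  have e1 := (measurePreserving_timeShift ρ θ n).lintegral_comp
    (f := fun ϑ => Φ (past (walkEnv ϑ) ϑ) * f (shift 1 (ϑ 0).1.1 (walkEnv ϑ))) (by fun_prop)
  have e2 := (measurePreserving_timeShift ρ θ n).lintegral_comp
    (f := fun ϑ => Φ (past (walkEnv ϑ) ϑ) * doobOp ρ θ u f (walkEnv ϑ)) (by fun_prop)
  rw [e1]
  refine Eq.trans ?_ e2.symm
  have h1 : ∀ ϑ : Traj d, Φ (past (walkEnv ϑ) ϑ) * f (shift 1 (ϑ 0).1.1 (walkEnv ϑ)) =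
      ∑ z, Φ (past (walkEnv ϑ) ϑ) * f (shift 1 z.1 (walkEnv ϑ)) *
        ({z} : Set (Step d)).indicator 1 (ϑ 0).1 := fun ϑ => by
    rw [Finset.sum_eq_single (ϑ 0).1 (fun z _ hz => by simp [hz.symm]) (by simp)]
    simp
  have h2 : ∀ ϑ : Traj d, Φ (past (walkEnv ϑ) ϑ) * doobOp ρ θ u f (walkEnv ϑ) =
      ∑ z, Φ (past (walkEnv ϑ) ϑ) * f (shift 1 z.1 (walkEnv ϑ)) *
        doobWeight ρ θ u (walkEnv ϑ) z := fun ϑ => by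
    rw [doobOp, Finset.mul_sum]
    exact Finset.sum_congr rfl fun z _ => by ring
  have hind : ∀ z, Measurable (({z} : Set (Step d)).indicator (1 : Step d → ℝ≥0∞)) := fun z =>
    measurable_one.indicator (measurableSet_singleton z)
  have hdw := fun z => measurable_doobWeight (ρ := ρ) (θ := θ) hum z
  simp only [h1, h2]
  rw [lintegral_finsetSum _ fun z _ => by fun_prop, lintegral_finsetSum _ fun z _ => by fun_prop]
  refine Finset.sum_congr rfl fun z _ => ?_
  refine hu.lintegral_firstStep_past
    (H := fun ω ϑ => Φ (past ω ϑ) * f (shift 1 z.1 ω)) (by fun_prop) (fun ω ϑ ϑ' h => ?_) z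
  have h3 : past ω ϑ = past ω ϑ' := by
    funext i
    have hi := i.isLt
    simp only [past]
    rw [walkPos_congr (ϑ' := ϑ') (fun j _ _ => by omega) fun j _ hj => h j hj]
  simp only [h3]

theorem seenFrom_zero (ϑ : Traj d) : seenFrom ϑ 0 = walkEnv ϑ := by simp [seenFrom]

theorem IsFutureDensity.isStationaryMarkov (hu : IsFutureDensity ρ θ u) :
    IsStationaryMarkov (doobKernel ρ θ u) ((walkLaw ρ θ).map seenFrom) := by
  refine ⟨Measure.isProbabilityMeasure_map measurable_seenFrom.aemeasurable, ?_, ?_⟩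
  · rw [Measure.map_map (by fun_prop) measurable_seenFrom]
    conv_rhs => rw [← (measurePreserving_timeShift ρ θ 1).map_eq,
      Measure.map_map measurable_seenFrom (measurable_timeShift 1)]
    congr 1
    funext ϑ k
    simp only [Function.comp_apply, seenFrom, timeShift_timeShift]
    push_cast
    rfl
  · intro n B A hB hA
    have hr : Measurable fun (w : ℕ → Env d) (i : Fin (n + 1)) => w i.val := by fun_prop
    have hBs : MeasurableSet {w : ℕ → Env d | (fun i : Fin (n + 1) => w i.val) ∈ B} := hr hB
    have hAs : MeasurableSet {w : ℕ → Env d | w (n + 1) ∈ A} := measurable_pi_apply (n + 1) hA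
    have hAi : Measurable (A.indicator (1 : Env d → ℝ≥0∞)) := measurable_one.indicator hA
    have hop := measurable_doobOp (ρ := ρ) (θ := θ) hu.measurable' hAi
    have h := hu.lintegral_seenFrom_succ n (measurable_one.indicator hB) hAi
    simp only [doobKernel_apply _ hA]
    have hBA : MeasurableSet
        {w : ℕ → Env d | (fun i : Fin (n + 1) => w i.val) ∈ B ∧ w (n + 1) ∈ A} := hBs.inter hAs
    rw [← lintegral_indicator hBs, lintegral_map (Measurable.indicator (by fun_prop) hBs)
      measurable_seenFrom, ← lintegral_indicator_one hBA,
      lintegral_map (measurable_one.indicator hBA) measurable_seenFrom]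
    refine Eq.trans (lintegral_congr fun ϑ => ?_) (h.trans (lintegral_congr fun ϑ => ?_))
    · by_cases h1 : (fun i : Fin (n + 1) => seenFrom ϑ i.val) ∈ B <;>
        by_cases h2 : seenFrom ϑ (n + 1) ∈ A <;> simp [h1, h2]
    · by_cases h1 : (fun i : Fin (n + 1) => seenFrom ϑ i.val) ∈ B <;>
        simp [h1]

theorem IsFutureDensity.lintegral_iterate (hu : IsFutureDensity ρ θ u) {φ : Env d → ℝ≥0∞}
    (hφ : Measurable φ) (k : ℕ) {f : Env d → ℝ≥0∞} (hf : Measurable f) :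
    ∫⁻ ϑ, φ (walkEnv ϑ) * f (seenFrom ϑ k) ∂(walkLaw ρ θ) =
      ∫⁻ ϑ, φ (walkEnv ϑ) * ((doobOp ρ θ u)^[k] f) (walkEnv ϑ) ∂(walkLaw ρ θ) := by
  induction k generalizing f with
  | zero => simp [seenFrom]
  | succ k ih =>
    have h := hu.lintegral_seenFrom_succ k (Φ := fun v => φ (v 0)) (by fun_prop) hf
    simp only [Fin.val_zero, seenFrom_zero] at h
    rw [h, ih (measurable_doobOp hu.measurable' hf), Function.iterate_succ_apply]

/-- The density `u` only controls layers at times `≥ 0`. By stationarity the environment may be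
viewed after `N` steps, when the event has become a future event shifted by one of countably many
positions, each shift being ℙ-null. -/
theorem IsFutureDensity.marginalAC (hu : IsFutureDensity ρ θ u) :
    MarginalAC ρ ((walkLaw ρ θ).map seenFrom) := by
  intro n A hA h0
  have hA' : MeasurableSet A := futureSigma_le n A hA
  have hAdep : DependsOn (· ∈ A) {p : ℤ × (Fin d → ℤ) | n ≤ p.1} := by
    rw [futureSigma_eq] at hA; exact dependsOn_mem_of_measurableSet hA
  have : Nonempty (SiteEnv d) := nonempty_of_isProbabilityMeasure ρ
  obtain ⟨N, hN⟩ : ∃ N : ℕ, -(N : ℤ) ≤ n := ⟨n.natAbs, by omega⟩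
  rw [Measure.map_map (by fun_prop) measurable_seenFrom]
  have h1 : ((fun w : ℕ → Env d => w 0) ∘ seenFrom : Traj d → Env d) = walkEnv :=
    funext seenFrom_zero
  rw [h1, Measure.map_apply measurable_walkEnv hA',
    ← (measurePreserving_timeShift ρ θ N).measure_preimage
      (measurable_walkEnv hA').nullMeasurableSet]
  have hsub : timeShift (N : ℤ) ⁻¹' (walkEnv ⁻¹' A) ⊆
      ⋃ x : Fin d → ℤ, walkEnv ⁻¹' (shift N x ⁻¹' A) := fun ϑ hϑ => by
    rw [Set.mem_iUnion]
    refine ⟨walkPos ϑ N, ?_⟩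
    rw [Set.mem_preimage, Set.mem_preimage, walkEnv_timeShift] at hϑ
    exact hϑ
  refine measure_mono_null hsub (measure_iUnion_null fun x => ?_)
  have hx : MeasurableSet (shift (N : ℤ) x ⁻¹' A) := measurable_shift _ _ hA'
  have hxf : MeasurableSet[futureSigma d 0] (shift (N : ℤ) x ⁻¹' A) := by
    refine (@measurable_mem _ _ (futureSigma d 0)).1
      (measurable_future_of_dependsOn (measurable_mem.2 hx) fun ω ω' h => ?_)
    refine hAdep fun p hp => ?_
    rw [shift_apply, shift_apply]
    refine h _ ?_
    simp only [Set.mem_ofPred_eq] at hp ⊢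
    omega
  rw [← Measure.map_apply measurable_walkEnv hx, hu.density _ hxf]
  exact setLIntegral_measure_zero _ _
    (by rw [(measurePreserving_shift ρ N x).measure_preimage hA'.nullMeasurableSet, h0])

end Markov

/-! ### Uniqueness of the stationary process -/

section Unique

variable {ρ : Measure (SiteEnv d)} [IsProbabilityMeasure ρ] {θ : EuclideanSpace ℝ (Fin d)}
  {u : Env d → ℝ}

theorem walkEnv_congr_ge {ϑ ϑ' : Traj d} {p : ℤ × (Fin d → ℤ)} {n : ℤ} (hn : n ≤ 0)
    (hp : n ≤ p.1) (h : ∀ i, n ≤ i → ϑ i = ϑ' i) : walkEnv ϑ p = walkEnv ϑ' p := by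
  rw [walkEnv, walkEnv, h _ hp, walkPos_congr (ϑ' := ϑ') (fun i h₀ _ => h i (hn.trans h₀))
    fun i h₀ _ => h i (hp.trans h₀)]

theorem measurable_iterate_doobOp (hu : Measurable u) (k : ℕ) {f : Env d → ℝ≥0∞}
    (hf : Measurable f) : Measurable ((doobOp ρ θ u)^[k] f) := by
  induction k generalizing f with
  | zero => exact hf
  | succ k ih => rw [Function.iterate_succ_apply]; exact ih (measurable_doobOp hu hf)

theorem dependsOn_iterate_doobOp (hdep : DependsOn u {p : ℤ × (Fin d → ℤ) | 0 ≤ p.1}) (N k : ℕ)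
    (hk : N ≤ k) {f : Env d → ℝ≥0∞}
    (hf : DependsOn f {p : ℤ × (Fin d → ℤ) | -(N : ℤ) ≤ p.1}) :
    DependsOn ((doobOp ρ θ u)^[k] f) {p : ℤ × (Fin d → ℤ) | 0 ≤ p.1} := by
  induction k generalizing f N with
  | zero =>
    obtain rfl : N = 0 := by omega
    simpa using hf
  | succ k ih =>
    rw [Function.iterate_succ_apply]
    refine ih (N - 1) (by omega) (dependsOn_doobOp hdep (by omega) (by omega) hf)

/-- A law which is invariant under the kernel. -/
theorem IsStationaryMarkov.lintegral_doobOp {P : Measure (ℕ → Env d)} (hu : Measurable u)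
    (hP : IsStationaryMarkov (doobKernel ρ θ u) P) {f : Env d → ℝ≥0∞} (hf : Measurable f) :
    ∫⁻ ω, doobOp ρ θ u f ω ∂(P.map fun w => w 0) = ∫⁻ ω, f ω ∂(P.map fun w => w 0) := by
  let ν : Measure (Env d) := P.map fun w => w 0
  -- Invariance on indicators is stated as an identity of measures, so that it extends to all
  -- nonnegative functions.
  have hν : ∑ z : Step d, (ν.withDensity fun ω => doobWeight ρ θ u ω z).map (shift 1 z.1) = ν := by
    ext A hA
    have hAi : Measurable (A.indicator (1 : Env d → ℝ≥0∞)) := measurable_one.indicator hA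
    have h1 : ∫⁻ ω, doobOp ρ θ u (A.indicator 1) ω ∂ν = ν A := by
      have h2 := hP.2.2 0 Set.univ A MeasurableSet.univ hA
      simp only [Set.mem_univ, true_and, zero_add, Set.ofPred_true, Measure.restrict_univ,
        doobKernel_apply _ hA] at h2
      rw [lintegral_map (measurable_doobOp hu hAi) (measurable_pi_apply 0), ← h2]
      change P ((fun w : ℕ → Env d => w 1) ⁻¹' A) = P.map (fun w => w 0) A
      conv_rhs => rw [← hP.2.1, Measure.map_map (measurable_pi_apply 0) (by fun_prop)]
      rw [Measure.map_apply (by fun_prop) hA]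
      rfl
    rw [← h1, Measure.coe_finsetSum, Finset.sum_apply]
    simp only [doobOp]
    have hm : ∀ z : Step d, Measurable fun ω =>
        doobWeight ρ θ u ω z * A.indicator (1 : Env d → ℝ≥0∞) (shift 1 z.1 ω) := fun z =>
      (measurable_doobWeight hu z).mul (hAi.comp (measurable_shift _ _))
    rw [lintegral_finsetSum _ fun z _ => hm z]
    refine Finset.sum_congr rfl fun z _ => ?_
    rw [← lintegral_indicator_one hA, lintegral_map hAi (measurable_shift _ _),
      lintegral_withDensity_eq_lintegral_mul _ (measurable_doobWeight hu z)
        (g := fun ω => A.indicator (1 : Env d → ℝ≥0∞) (shift 1 z.1 ω))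
        (hAi.comp (measurable_shift _ _))]
    rfl
  change ∫⁻ ω, doobOp ρ θ u f ω ∂ν = ∫⁻ ω, f ω ∂ν
  conv_rhs => rw [← hν]
  rw [lintegral_finsetSum_measure]
  simp only [doobOp]
  have hm : ∀ z : Step d, Measurable fun ω => doobWeight ρ θ u ω z * f (shift 1 z.1 ω) :=
    fun z => (measurable_doobWeight hu z).mul (hf.comp (measurable_shift _ _))
  rw [lintegral_finsetSum _ fun z _ => hm z]
  refine Finset.sum_congr rfl fun z _ => ?_
  rw [lintegral_map hf (measurable_shift _ _), lintegral_withDensity_eq_lintegral_mul _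
    (measurable_doobWeight hu z) (g := fun ω => f (shift 1 z.1 ω))
    (hf.comp (measurable_shift _ _))]
  rfl

theorem IsStationaryMarkov.lintegral_iterate {P : Measure (ℕ → Env d)} (hu : Measurable u)
    (hP : IsStationaryMarkov (doobKernel ρ θ u) P) (k : ℕ) {f : Env d → ℝ≥0∞} (hf : Measurable f) :
    ∫⁻ ω, ((doobOp ρ θ u)^[k] f) ω ∂(P.map fun w => w 0) = ∫⁻ ω, f ω ∂(P.map fun w => w 0) := by
  induction k generalizing f with
  | zero => rfl
  | succ k ih =>
    rw [Function.iterate_succ_apply, ih (measurable_doobOp hu hf), hP.lintegral_doobOp hu hf]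

/-- The environments seen from the tilted walk decorrelate completely in finite time. -/
theorem IsFutureDensity.lintegral_mul_iterate (hu : IsFutureDensity ρ θ u) {M N : ℕ}
    {φ f : Env d → ℝ≥0∞} (hφ : Measurable φ)
    (hφdep : DependsOn φ {p : ℤ × (Fin d → ℤ) | 0 ≤ p.1 ∧ p.1 < M}) (hf : Measurable f)
    (hfdep : DependsOn f {p : ℤ × (Fin d → ℤ) | -(N : ℤ) ≤ p.1}) :
    ∫⁻ ϑ, φ (walkEnv ϑ) * ((doobOp ρ θ u)^[M + N] f) (walkEnv ϑ) ∂(walkLaw ρ θ) =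
      (∫⁻ ϑ, φ (walkEnv ϑ) ∂(walkLaw ρ θ)) * ∫⁻ ϑ, f (walkEnv ϑ) ∂(walkLaw ρ θ) := by
  rw [← hu.lintegral_iterate hφ (M + N) hf,
    ← (measurePreserving_timeShift ρ θ (M + N : ℕ)).lintegral_comp
      (f := fun ϑ => f (walkEnv ϑ)) (by fun_prop)]
  -- The function `φ` reads entries before time `M`, while `f` at time M + N reads entries from time
  -- (M + N) - N = M on. The blocks are disjoint.
  refine lintegral_mul_of_dependsOn (stepLaw ρ θ) (S := {n : ℤ | n < M})
    (f := fun ϑ => φ (walkEnv ϑ)) (g := fun ϑ => f (seenFrom ϑ (M + N))) (by fun_prop)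
    (by fun_prop) (fun ϑ ϑ' h => ?_) fun ϑ ϑ' h => ?_
  · exact hφdep fun p hp => walkEnv_congr_future hp.1 fun i _ hi => h i (hi.trans_lt hp.2)
  · refine hfdep fun p hp => walkEnv_congr_ge (n := -(N : ℤ)) (by omega) hp fun i hi => h _ ?_
    simp only [Set.mem_compl_iff, Set.mem_ofPred_eq]
    push_cast
    omega

/-- An invariant law of the kernel which is absolutely continuous with respect to `ℙ` on the
future is the law of the environment of the tilted walk. -/
theorem IsFutureDensity.marginal_unique (hu : IsFutureDensity ρ θ u) {P : Measure (ℕ → Env d)}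
    (hP : IsStationaryMarkov (doobKernel ρ θ u) P) (hac : MarginalAC ρ P) :
    P.map (fun w => w 0) = (walkLaw ρ θ).map walkEnv := by
  have hne : Nonempty (SiteEnv d) := nonempty_of_isProbabilityMeasure ρ
  have hum := hu.measurable'
  have := hP.1
  set ν : Measure (Env d) := P.map fun w => w 0 with hνdef
  set μ : Measure (Env d) := (walkLaw ρ θ).map walkEnv with hμdef
  have hνp : IsProbabilityMeasure ν :=
    Measure.isProbabilityMeasure_map (measurable_pi_apply 0).aemeasurable
  have hμp : IsProbabilityMeasure μ :=
    Measure.isProbabilityMeasure_map measurable_walkEnv.aemeasurable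
  have hle := futureSigma_le (d := d) 0
  have : IsFiniteMeasure (ν.trim hle) := isFiniteMeasure_trim hle
  have : IsFiniteMeasure (μ.trim hle) := isFiniteMeasure_trim hle
  -- Since `u` is positive, null sets of the tilted law on the future are ℙ-null, hence null for
  -- `ν`. Absolute continuity is only known on this σ-algebra, so the density is taken between the
  -- trimmed measures.
  have hacμ : ν.trim hle ≪ μ.trim hle := by
    refine Measure.AbsolutelyContinuous.mk fun s hs h0 => ?_
    rw [trim_measurableSet_eq hle hs] at h0 ⊢
    refine hac 0 s hs ?_
    rw [hu.density s hs, lintegral_eq_zero_iff hum.ennreal_ofReal] at h0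
    have h1 : ∀ᵐ _ω ∂(envLaw ρ).restrict s, False := h0.mono fun ω hω => by
      have : ENNReal.ofReal (u ω) = 0 := hω
      rw [ENNReal.ofReal_eq_zero] at this
      exact (hu.pos ω).not_ge this
    rw [ae_iff] at h1
    simpa using h1
  let g₀ : Env d → ℝ≥0∞ := (ν.trim hle).rnDeriv (μ.trim hle)
  have hg₀ : Measurable[futureSigma d 0] g₀ := Measure.measurable_rnDeriv _ _
  have hg₀' : Measurable g₀ := hg₀.mono hle le_rfl
  have hνμ : ∀ f : Env d → ℝ≥0∞, Measurable[futureSigma d 0] f →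
      ∫⁻ ω, f ω ∂ν = ∫⁻ ω, f ω * g₀ ω ∂μ := fun f hf => by
    have h1 : (μ.trim hle).withDensity g₀ = ν.trim hle := by
      have : Measure.HaveLebesgueDecomposition (ν.trim hle) (μ.trim hle) :=
        @Measure.haveLebesgueDecomposition_of_sigmaFinite _ (futureSigma d 0)
          (ν.trim hle) (μ.trim hle) inferInstance inferInstance
      exact Measure.withDensity_rnDeriv_eq _ _ hacμ
    rw [← lintegral_trim hle hf, ← lintegral_trim hle (f := fun ω => f ω * g₀ ω) (hf.mul hg₀), ← h1,
      lintegral_withDensity_eq_lintegral_mul _ hg₀ hf]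
    exact lintegral_congr fun ω => mul_comm _ _
  have hg1 : ∫⁻ ω, g₀ ω ∂μ = 1 := by
    have := hνμ (fun _ => 1) (@measurable_const _ _ _ (futureSigma d 0) 1)
    simpa using this.symm
  have hgtop : ∀ᵐ ω ∂μ, g₀ ω < ∞ := ae_lt_top hg₀' (by simp [hg1])
  let g : Env d → ℝ := fun ω => (g₀ ω).toReal
  have hgm : Measurable[futureSigma d 0] g := hg₀.ennreal_toReal
  have hgint : Integrable g μ := integrable_toReal_of_lintegral_ne_top hg₀'.aemeasurable
    (by simp [hg1])
  have hgofReal : ∀ᵐ ω ∂μ, ENNReal.ofReal (g ω) = g₀ ω :=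
    hgtop.mono fun ω hω => ENNReal.ofReal_toReal hω.ne
  -- Truncations of the density to the first `M` layers: they keep total mass one, converge in L¹,
  -- and decorrelate exactly from the environment seen later.
  let gM : ℕ → Env d → ℝ := fun M => μ[g | layerFiltration d M]
  have hgM : ∀ M, Measurable[layerFiltration d M] (gM M) := fun M =>
    stronglyMeasurable_condExp.measurable
  have hgM' : ∀ M, Measurable (gM M) := fun M => (hgM M).mono ((layerFiltration d).le M) le_rfl
  have hgMint : ∀ M, ∫⁻ ω, ENNReal.ofReal (gM M ω) ∂μ = 1 := fun M => by
    have h0 : 0 ≤ᵐ[μ] gM M := condExp_nonneg (ae_of_all _ fun ω => ENNReal.toReal_nonneg)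
    rw [← ofReal_integral_eq_lintegral_ofReal integrable_condExp h0,
      integral_condExp ((layerFiltration d).le M), ofReal_integral_eq_lintegral_ofReal hgint
      (ae_of_all _ fun ω => ENNReal.toReal_nonneg), lintegral_congr_ae hgofReal, hg1]
  have hlim : Tendsto (fun M => eLpNorm (gM M - g) 1 μ) atTop (𝓝 0) :=
    hgint.tendsto_eLpNorm_condExp (by
      rw [iSup_layerFiltration]; exact hgm.stronglyMeasurable)
  -- One inequality suffices: both are probability measures, and the complements give the other one.
  have hmain : ∀ N : ℕ, ∀ A, MeasurableSet[futureSigma d (-(N : ℤ))] A → ν A ≤ μ A := by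
    intro N A hA
    have hA' : MeasurableSet A := futureSigma_le _ A hA
    have hAi : Measurable (A.indicator (1 : Env d → ℝ≥0∞)) := measurable_one.indicator hA'
    have hAdep : DependsOn (A.indicator (1 : Env d → ℝ≥0∞))
        {p : ℤ × (Fin d → ℤ) | -(N : ℤ) ≤ p.1} := by
      rw [futureSigma_eq] at hA
      exact dependsOn_indicator_one (dependsOn_mem_of_measurableSet hA)
    have hbound : ∀ M : ℕ, ν A ≤ eLpNorm (gM M - g) 1 μ + μ A := by
      intro M
      let ψ := (doobOp ρ θ u)^[M + N] (A.indicator 1)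
      have hψ : Measurable ψ := measurable_iterate_doobOp hum _ hAi
      have hψdep := dependsOn_iterate_doobOp (ρ := ρ) (θ := θ) hu.dependsOn N (M + N) (by omega)
        hAdep
      have h1 : ν A = ∫⁻ ω, ψ ω * g₀ ω ∂μ := by
        rw [← hνμ ψ (measurable_future_of_dependsOn hψ hψdep), hP.lintegral_iterate hum _ hAi,
          lintegral_indicator_one hA']
      -- The iterated kernel is a contraction under `μ`, so the L¹ error of the truncation does not
      -- grow with the number of iterations.
      have hψle : ∀ φ : Env d → ℝ≥0∞, Measurable φ → ∫⁻ ω, φ ω * ψ ω ∂μ ≤ ∫⁻ ω, φ ω ∂μ :=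
        fun φ hφ => by
          have hm : Measurable fun ω => φ ω * ψ ω := hφ.mul hψ
          rw [hμdef, lintegral_map hm measurable_walkEnv,
            lintegral_map hφ measurable_walkEnv]
          refine (hu.lintegral_iterate hφ (M + N) hAi).symm.le.trans (lintegral_mono fun ϑ => ?_)
          refine mul_le_of_le_one_right' ?_
          exact Set.indicator_le_self' (fun _ _ => zero_le_one) _
      have hψeq : ∫⁻ ω, ENNReal.ofReal (gM M ω) * ψ ω ∂μ = μ A := by
        have hdep : DependsOn (fun ω => ENNReal.ofReal (gM M ω))
            {p : ℤ × (Fin d → ℤ) | 0 ≤ p.1 ∧ p.1 < M} := fun ω ω' h =>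
          congrArg ENNReal.ofReal (dependsOn_of_measurable_cylSigma (hgM M) h)
        have h2 := hu.lintegral_mul_iterate (φ := fun ω => ENNReal.ofReal (gM M ω))
          (hgM' M).ennreal_ofReal hdep hAi hAdep
        have hm : Measurable fun ω => ENNReal.ofReal (gM M ω) * ψ ω :=
          (hgM' M).ennreal_ofReal.mul hψ
        rw [hμdef, lintegral_map hm measurable_walkEnv]
        refine h2.trans ?_
        rw [← lintegral_map (f := fun ω => ENNReal.ofReal (gM M ω)) (hgM' M).ennreal_ofReal
          measurable_walkEnv, ← hμdef, hgMint, one_mul,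
          ← lintegral_map hAi measurable_walkEnv, ← hμdef, lintegral_indicator_one hA']
      rw [h1, ← hψeq, eLpNorm_one_eq_lintegral_enorm]
      have hmd : Measurable fun ω => ‖(gM M - g) ω‖ₑ :=
        ((hgM' M).sub (hgm.mono hle le_rfl)).enorm
      calc ∫⁻ ω, ψ ω * g₀ ω ∂μ
          ≤ ∫⁻ ω, (‖(gM M - g) ω‖ₑ * ψ ω + ENNReal.ofReal (gM M ω) * ψ ω) ∂μ := by
            refine lintegral_mono_ae (hgofReal.mono fun ω hω => ?_)
            rw [← hω, mul_comm, ← add_mul]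
            refine mul_le_mul' ?_ le_rfl
            have : g ω ≤ ‖(gM M - g) ω‖ + gM M ω := by
              have := neg_le_abs ((gM M - g) ω)
              rw [Real.norm_eq_abs]
              simp only [Pi.sub_apply] at this ⊢
              linarith
            refine (ENNReal.ofReal_le_ofReal this).trans (ENNReal.ofReal_add_le.trans ?_)
            rw [ofReal_norm]
        _ = ∫⁻ ω, ‖(gM M - g) ω‖ₑ * ψ ω ∂μ + ∫⁻ ω, ENNReal.ofReal (gM M ω) * ψ ω ∂μ :=
            lintegral_add_left (hmd.mul hψ) _
        _ ≤ _ := add_le_add (hψle _ hmd) le_rfl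
    refine ge_of_tendsto' (f := fun M => eLpNorm (gM M - g) 1 μ + μ A) (x := atTop) ?_ hbound
    simpa using hlim.add_const (μ A)
  have hagree : ∀ N : ℕ, ∀ A, MeasurableSet[futureSigma d (-(N : ℤ))] A → ν A = μ A := by
    intro N A hA
    have hA' : MeasurableSet A := futureSigma_le _ A hA
    refine le_antisymm (hmain N A hA) ?_
    have h1 := hmain N Aᶜ hA.compl
    rw [prob_compl_eq_one_sub hA', prob_compl_eq_one_sub hA'] at h1
    exact (ENNReal.sub_le_sub_iff_left prob_le_one ENNReal.one_ne_top).1 h1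
  ext A hA
  refine measure_eq_of_iSup (m := fun N : ℕ => futureSigma d (-(N : ℤ))) (fun i j hij => ?_)
    (fun N => futureSigma_le _) hagree ?_
  · simp only [futureSigma_eq]
    refine cylSigma_mono fun p hp => ?_
    simp only [Set.mem_ofPred_eq] at hp ⊢
    omega
  · have hpi : (MeasurableSpace.pi : MeasurableSpace (Env d)) ≤
        ⨆ N : ℕ, futureSigma d (-(N : ℤ)) := by
      refine iSup_le fun p => le_iSup_of_le p.1.natAbs ?_
      rw [futureSigma_eq]
      exact le_iSup₂_of_le (f := fun (i : ℤ × (Fin d → ℤ)) _ =>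
        MeasurableSpace.comap (fun ω : Env d => ω i) inferInstance) p
        (by simp only [Set.mem_ofPred_eq]; omega) le_rfl
    exact hpi A hA

end Unique

/-- A stationary Markov process is determined by its kernel and its one-dimensional marginal. -/
theorem IsStationaryMarkov.eq_of_marginal {S : Type*} [MeasurableSpace S] {κ : S → Measure S}
    (hκ : ∀ A, MeasurableSet A → Measurable fun x => κ x A) {P P' : Measure (ℕ → S)}
    (hP : IsStationaryMarkov κ P) (hP' : IsStationaryMarkov κ P')
    (h0 : P.map (fun w => w 0) = P'.map fun w => w 0) : P = P' := by
  have := hP.1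
  have := hP'.1
  let r : ∀ n : ℕ, (ℕ → S) → Fin (n + 1) → S := fun n w i => w i.val
  have hr : ∀ n, Measurable (r n) := fun n => by fun_prop
  have hfd : ∀ n, P.map (r n) = P'.map (r n) := by
    intro n
    induction n with
    | zero =>
      have h1 : r 0 = (fun x (_ : Fin 1) => x) ∘ fun w => w 0 := by
        funext w i
        simp only [r, Function.comp_apply]
        congr 1
        omega
      rw [h1, ← Measure.map_map (by fun_prop) (by fun_prop), h0,
        Measure.map_map (by fun_prop) (by fun_prop)]
    | succ n ih =>
      have hpair : P.map (fun w => (r n w, w (n + 1))) = P'.map fun w => (r n w, w (n + 1)) := by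
        have : IsProbabilityMeasure (P.map fun w => (r n w, w (n + 1))) :=
          Measure.isProbabilityMeasure_map ((hr n).prodMk (by fun_prop)).aemeasurable
        refine Measure.ext_prod fun {B A} hB hA => ?_
        have hκA := hκ A hA
        have hrect : ∀ {R : Measure (ℕ → S)}, IsStationaryMarkov κ R →
            R.map (fun w => (r n w, w (n + 1))) (B ×ˢ A) =
              ∫⁻ v in B, κ (v (Fin.last n)) A ∂(R.map (r n)) := fun {R} hR => by
          have hκl : Measurable fun v : Fin (n + 1) → S => κ (v (Fin.last n)) A :=
            hκA.comp (measurable_pi_apply _)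
          rw [Measure.map_apply ((hr n).prodMk (by fun_prop)) (hB.prod hA),
            setLIntegral_map hB hκl (hr n)]
          exact hR.2.2 n B A hB hA
        rw [hrect hP, hrect hP', ih]
      have hsnoc : Measurable fun q : (Fin (n + 1) → S) × S =>
          (Fin.snoc q.1 q.2 : Fin (n + 1 + 1) → S) := by
        refine measurable_pi_lambda _ fun i => ?_
        refine Fin.lastCases ?_ (fun i => ?_) i
        · simp only [Fin.snoc_last]; fun_prop
        · simp only [Fin.snoc_castSucc]; fun_prop
      have h1 : r (n + 1) = (fun q : (Fin (n + 1) → S) × S =>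
          (Fin.snoc q.1 q.2 : Fin (n + 1 + 1) → S)) ∘ fun w => (r n w, w (n + 1)) := by
        funext w i
        refine Fin.lastCases ?_ (fun i => ?_) i
        · simp [r]
        · simp [r]
      rw [h1, ← Measure.map_map hsnoc ((hr n).prodMk (by fun_prop)), hpair,
        Measure.map_map hsnoc ((hr n).prodMk (by fun_prop))]
  have hmcoord : ∀ n (i : Fin (n + 1)), Measurable[MeasurableSpace.comap (r n) MeasurableSpace.pi]
      fun w : ℕ → S => w i.val := fun n i => (measurable_pi_apply i).comp (comap_measurable (r n))
  ext s hs
  refine measure_eq_of_iSup (m := fun n => MeasurableSpace.comap (r n) MeasurableSpace.pi)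
    (fun n k hnk => ?_) (fun n => (hr n).comap_le) ?_ ?_
  · refine Measurable.comap_le (m₁ := MeasurableSpace.comap (r k) MeasurableSpace.pi) ?_
    exact (@measurable_pi_iff _ _ _ (MeasurableSpace.comap (r k) MeasurableSpace.pi) _ _).2
      fun i => hmcoord k ⟨i.1, by omega⟩
  · rintro n _ ⟨t, ht, rfl⟩
    rw [← Measure.map_apply (hr n) ht, ← Measure.map_apply (hr n) ht, hfd n]
  · have hpi : (MeasurableSpace.pi : MeasurableSpace (ℕ → S)) ≤
        ⨆ n, MeasurableSpace.comap (r n) MeasurableSpace.pi :=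
      iSup_le fun i => le_iSup_of_le i (hmcoord i ⟨i, by omega⟩).comap_le
    exact hpi s hs

theorem IsFutureDensity.stationary_iff {ρ : Measure (SiteEnv d)} [IsProbabilityMeasure ρ]
    {θ : EuclideanSpace ℝ (Fin d)} {u : Env d → ℝ} (hu : IsFutureDensity ρ θ u)
    (P : Measure (ℕ → Env d)) :
    (IsStationaryMarkov (doobKernel ρ θ u) P ∧ MarginalAC ρ P) ↔
      P = (tiltedMeasure ρ θ).map envTrajectory := by
  rw [map_envTrajectory_tiltedMeasure]
  constructor
  · rintro ⟨hP, hac⟩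
    refine hP.eq_of_marginal (fun A hA => ?_) hu.isStationaryMarkov ?_
    · simp only [doobKernel_apply _ hA]
      exact measurable_doobOp hu.measurable' (measurable_one.indicator hA)
    · rw [hu.marginal_unique hP hac, Measure.map_map (by fun_prop) measurable_seenFrom]
      congr 1
      funext ϑ
      exact (seenFrom_zero ϑ).symm
  · rintro rfl
    exact ⟨hu.isStationaryMarkov, hu.marginalAC⟩

/-! ### Large deviations from exponential moments near one tilt -/

theorem two_mul_exp_le {x y : ℝ} (h : Real.log 2 + x ≤ y) : 2 * Real.exp x ≤ Real.exp y := by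
  calc 2 * Real.exp x = Real.exp (Real.log 2 + x) := by
        rw [Real.exp_add, Real.exp_log two_pos]
    _ ≤ Real.exp y := Real.exp_le_exp.2 h

section ExpRate

variable {E : Type*} [NormedAddCommGroup E] [InnerProductSpace ℝ E] [MeasurableSpace E]
  [BorelSpace E]

/-- The exponential moments of `Q n` at `n θ` grow like `exp (n b)`. -/
def HasExpRate (Q : ℕ → Measure E) (θ : E) (b : ℝ) : Prop :=
  ∀ ε : ℝ, 0 < ε → ∀ᶠ n : ℕ in atTop,
    ENNReal.ofReal (Real.exp (n * (b - ε))) ≤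
        ∫⁻ x, ENNReal.ofReal (Real.exp (n * ⟪θ, x⟫)) ∂(Q n) ∧
      ∫⁻ x, ENNReal.ofReal (Real.exp (n * ⟪θ, x⟫)) ∂(Q n) ≤
        ENNReal.ofReal (Real.exp (n * (b + ε)))

@[fun_prop]
theorem measurable_ofReal_exp_inner (θ : E) (r s : ℝ) :
    Measurable fun x : E => ENNReal.ofReal (Real.exp (r * (⟪θ, x⟫ - s))) := by
  have : Continuous fun x : E => Real.exp (r * (⟪θ, x⟫ - s)) := by fun_prop
  exact this.measurable.ennreal_ofReal

theorem ofReal_exp_mul (a b : ℝ) : ENNReal.ofReal (Real.exp a) * ENNReal.ofReal (Real.exp b) =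
    ENNReal.ofReal (Real.exp (a + b)) := by
  rw [Real.exp_add, ENNReal.ofReal_mul (Real.exp_pos _).le]

theorem lintegral_exp_sub (μ : Measure E) (θ : E) (r s : ℝ) :
    ∫⁻ x, ENNReal.ofReal (Real.exp (r * (⟪θ, x⟫ - s))) ∂μ =
      ENNReal.ofReal (Real.exp (-(r * s))) *
        ∫⁻ x, ENNReal.ofReal (Real.exp (r * ⟪θ, x⟫)) ∂μ := by
  have hm : Measurable fun x : E => ENNReal.ofReal (Real.exp (r * ⟪θ, x⟫)) := by
    simpa using measurable_ofReal_exp_inner θ r 0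
  rw [← lintegral_const_mul _ hm]
  refine lintegral_congr fun x => ?_
  rw [ofReal_exp_mul]
  ring_nf

/-- Chebyshev's inequality gives the decay on a half-space around each point of `K`, and compactness
leaves finitely many half-spaces. The strict inequality at each point yields the gain `ε`. -/
theorem HasExpRate.exists_decay {Q : ℕ → Measure E} {K : Set E} (hK : IsCompact K) {a : ℝ}
    (h : ∀ y ∈ K, ∃ θ b, HasExpRate Q θ b ∧ a < ⟪θ, y⟫ - b) :
    ∃ ε : ℝ, 0 < ε ∧ ∀ᶠ n : ℕ in atTop, Q n K ≤ ENNReal.ofReal (Real.exp (-(n * (a + ε)))) := by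
  refine hK.induction_on (p := fun s => ∃ ε : ℝ, 0 < ε ∧ ∀ᶠ n : ℕ in atTop,
    Q n s ≤ ENNReal.ofReal (Real.exp (-(n * (a + ε))))) ?_ ?_ ?_ ?_
  · exact ⟨1, one_pos, Eventually.of_forall fun n => by simp⟩
  · rintro s t hst ⟨ε, hε, h⟩
    exact ⟨ε, hε, h.mono fun n hn => (measure_mono hst).trans hn⟩
  · rintro s t ⟨ε₁, hε₁, h₁⟩ ⟨ε₂, hε₂, h₂⟩
    set m := min ε₁ ε₂ with hm
    have hm0 : 0 < m := lt_min hε₁ hε₂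
    -- The factor two of the union bound is absorbed by giving up half of the exponent gain.
    have hlarge : ∀ᶠ n : ℕ in atTop, Real.log 2 ≤ n * (m / 2) :=
      (tendsto_natCast_atTop_atTop.atTop_mul_const (half_pos hm0)).eventually_ge_atTop _
    refine ⟨m / 2, half_pos hm0, ?_⟩
    filter_upwards [h₁, h₂, hlarge] with n hn₁ hn₂ hn
    have hle : ∀ ε, m ≤ ε → ENNReal.ofReal (Real.exp (-(n * (a + ε)))) ≤
        ENNReal.ofReal (Real.exp (-(n * (a + m)))) := fun ε hε => by
      gcongr
    calc Q n (s ∪ t) ≤ Q n s + Q n t := measure_union_le s t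
      _ ≤ ENNReal.ofReal (Real.exp (-(n * (a + m)))) +
          ENNReal.ofReal (Real.exp (-(n * (a + m)))) :=
        add_le_add (hn₁.trans (hle _ (min_le_left _ _))) (hn₂.trans (hle _ (min_le_right _ _)))
      _ = ENNReal.ofReal (2 * Real.exp (-(n * (a + m)))) := by
        rw [← ENNReal.ofReal_add (Real.exp_pos _).le (Real.exp_pos _).le, two_mul (Real.exp _)]
      _ ≤ _ := by
        refine ENNReal.ofReal_le_ofReal ?_
        refine two_mul_exp_le ?_
        linarith
  · intro y hy
    obtain ⟨θ, b, hb, hyb⟩ := h y hy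
    set s : ℝ := ⟪θ, y⟫ - b - a with hs
    have hs0 : 0 < s := by linarith
    have hopen : IsOpen {x : E | a + b + s / 2 < ⟪θ, x⟫} :=
      isOpen_lt continuous_const (by fun_prop)
    refine ⟨{x : E | a + b + s / 2 < ⟪θ, x⟫}, mem_nhdsWithin_of_mem_nhds (hopen.mem_nhds ?_),
      s / 4, by linarith, ?_⟩
    · change a + b + s / 2 < ⟪θ, y⟫
      linarith
    · filter_upwards [hb (s / 4) (by linarith)] with n hn
      calc Q n {x : E | a + b + s / 2 < ⟪θ, x⟫}
          = ∫⁻ _x in {x : E | a + b + s / 2 < ⟪θ, x⟫}, 1 ∂(Q n) := by simp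
        _ ≤ ∫⁻ x in {x : E | a + b + s / 2 < ⟪θ, x⟫},
            ENNReal.ofReal (Real.exp (n * (⟪θ, x⟫ - (a + b + s / 2)))) ∂(Q n) := by
          refine setLIntegral_mono' hopen.measurableSet fun x hx => ?_
          rw [← ENNReal.ofReal_one]
          refine ENNReal.ofReal_le_ofReal (Real.one_le_exp ?_)
          exact mul_nonneg n.cast_nonneg (sub_nonneg.2 (le_of_lt hx))
        _ ≤ ∫⁻ x, ENNReal.ofReal (Real.exp (n * (⟪θ, x⟫ - (a + b + s / 2)))) ∂(Q n) :=
          setLIntegral_le_lintegral _ _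
        _ ≤ ENNReal.ofReal (Real.exp (-(n * (a + b + s / 2)))) *
            ENNReal.ofReal (Real.exp (n * (b + s / 4))) := by
          rw [lintegral_exp_sub]
          exact mul_le_mul' le_rfl hn.2
        _ = _ := by
          rw [ofReal_exp_mul]
          ring_nf

/-- The measures `Q n` tilted by `θ`. -/
def expTilt (Q : ℕ → Measure E) (θ : E) (b : ℝ) (n : ℕ) : Measure E :=
  (Q n).withDensity fun x => ENNReal.ofReal (Real.exp (n * (⟪θ, x⟫ - b)))

theorem HasExpRate.expTilt {Q : ℕ → Measure E} {θ φ : E} {c : ℝ} (h : HasExpRate Q (θ + φ) c)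
    (b : ℝ) : HasExpRate (expTilt Q θ b) φ (c - b) := by
  intro ε hε
  filter_upwards [h ε hε] with n hn
  have hm : Measurable fun x : E => ENNReal.ofReal (Real.exp (n * ⟪φ, x⟫)) := by
    simpa using measurable_ofReal_exp_inner φ n 0
  have h1 : ∫⁻ x, ENNReal.ofReal (Real.exp (n * ⟪φ, x⟫)) ∂(SpaceTimeRWRE.expTilt Q θ b n) =
      ENNReal.ofReal (Real.exp (-(n * b))) *
        ∫⁻ x, ENNReal.ofReal (Real.exp (n * ⟪θ + φ, x⟫)) ∂(Q n) := by
    rw [SpaceTimeRWRE.expTilt, lintegral_withDensity_eq_lintegral_mul _ (by fun_prop) hm,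
      ← lintegral_exp_sub]
    refine lintegral_congr fun x => ?_
    rw [Pi.mul_apply, ofReal_exp_mul, inner_add_left]
    ring_nf
  rw [h1]
  constructor
  · refine le_trans ?_ (mul_le_mul' le_rfl hn.1)
    rw [ofReal_exp_mul]
    exact le_of_eq (by ring_nf)
  · refine (mul_le_mul' le_rfl hn.2).trans ?_
    rw [ofReal_exp_mul]
    exact le_of_eq (by ring_nf)

/-- Exponential rates at a dense set of tilts extend to all tilts. -/
theorem HasExpRate.of_dense {Q : ℕ → Measure E} (hsupp : ∀ n, ∀ᵐ x ∂(Q n), ‖x‖ ≤ 1)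
    {D : Set E} (hD : Dense D) {Λ : E → ℝ} {θ : E} (hΛ : ContinuousAt Λ θ)
    (h : ∀ᶠ θ' in 𝓝 θ, θ' ∈ D → HasExpRate Q θ' (Λ θ')) : HasExpRate Q θ (Λ θ) := by
  intro ε hε
  have h1 : ∀ᶠ θ' in 𝓝 θ, (θ' ∈ D → HasExpRate Q θ' (Λ θ')) ∧ dist (Λ θ') (Λ θ) < ε / 3 ∧
      dist θ' θ < ε / 3 :=
    h.and (((Metric.tendsto_nhds.1 hΛ) _ (by linarith)).and
      (Metric.ball_mem_nhds θ (by linarith)))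
  obtain ⟨θ', hθ'D, hθ', hd, hdist⟩ :=
    (mem_closure_iff_frequently.1 (hD θ)).and_eventually h1 |>.exists
  rw [Real.dist_eq] at hd
  rw [dist_eq_norm] at hdist
  -- The measures live on the unit ball, so moving the tilt by less than ε/3 changes the exponent by
  -- at most n ε/3.
  have hcomp : ∀ (n : ℕ) (x : E), ‖x‖ ≤ 1 → |(n : ℝ) * ⟪θ', x⟫ - n * ⟪θ, x⟫| ≤ n * (ε / 3) := by
    intro n x hx
    rw [← mul_sub, ← inner_sub_left, abs_mul, Nat.abs_cast]
    refine mul_le_mul_of_nonneg_left ?_ n.cast_nonneg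
    refine (abs_real_inner_le_norm _ _).trans ?_
    exact (mul_le_of_le_one_right (norm_nonneg _) hx).trans hdist.le
  have hmono : ∀ {θ₁ θ₂ : E} {n : ℕ}, (∀ x : E, ‖x‖ ≤ 1 →
      (n : ℝ) * ⟪θ₁, x⟫ ≤ n * ⟪θ₂, x⟫ + n * (ε / 3)) →
      ENNReal.ofReal (Real.exp (-(n * (ε / 3)))) *
        ∫⁻ x, ENNReal.ofReal (Real.exp (n * ⟪θ₁, x⟫)) ∂(Q n) ≤
      ∫⁻ x, ENNReal.ofReal (Real.exp (n * ⟪θ₂, x⟫)) ∂(Q n) := by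
    intro θ₁ θ₂ n hle
    rw [← lintegral_exp_sub]
    refine lintegral_mono_ae ((hsupp n).mono fun x hx => ?_)
    refine ENNReal.ofReal_le_ofReal (Real.exp_le_exp.2 ?_)
    have := hle x hx
    linarith
  filter_upwards [hθ' hθ'D (ε / 3) (by linarith)] with n hn
  have hn0 : (0 : ℝ) ≤ n := n.cast_nonneg
  have hd' := abs_lt.1 hd
  constructor
  · refine le_trans ?_ (hmono (θ₁ := θ') (θ₂ := θ) fun x hx => ?_)
    · refine le_trans ?_ (mul_le_mul' le_rfl hn.1)
      rw [ofReal_exp_mul]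
      refine ENNReal.ofReal_le_ofReal (Real.exp_le_exp.2 ?_)
      have := mul_le_mul_of_nonneg_left (show Λ θ - ε ≤ -(ε / 3) + (Λ θ' - ε / 3) by linarith) hn0
      linarith
    · have := abs_le.1 (hcomp n x hx)
      linarith
  · have h2 := hmono (θ₁ := θ) (θ₂ := θ') (n := n) fun x hx => by
      have := abs_le.1 (hcomp n x hx)
      linarith
    have h3 : ENNReal.ofReal (Real.exp (n * (ε / 3))) *
        (ENNReal.ofReal (Real.exp (-(n * (ε / 3)))) *
          ∫⁻ x, ENNReal.ofReal (Real.exp (n * ⟪θ, x⟫)) ∂(Q n)) =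
        ∫⁻ x, ENNReal.ofReal (Real.exp (n * ⟪θ, x⟫)) ∂(Q n) := by
      rw [← mul_assoc, ofReal_exp_mul]
      simp
    rw [← h3]
    refine (mul_le_mul' le_rfl (h2.trans hn.2)).trans ?_
    rw [ofReal_exp_mul]
    refine ENNReal.ofReal_le_ofReal (Real.exp_le_exp.2 ?_)
    have := mul_le_mul_of_nonneg_left (show ε / 3 + (Λ θ' + ε / 3) ≤ Λ θ + ε by linarith) hn0
    linarith

variable [FiniteDimensional ℝ E]

/-- The lower bound of the large deviation principle at a point exposed by `θ`. -/
theorem HasExpRate.le_measure_ball [CompleteSpace E] {Q : ℕ → Measure E}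
    (hsupp : ∀ n, ∀ᵐ x ∂(Q n), ‖x‖ ≤ 1)
    {Λ : E → ℝ} {θ ξ : E} (hgrad : HasGradientAt Λ ξ θ)
    (hrate : ∀ᶠ θ' in 𝓝 θ, HasExpRate Q θ' (Λ θ')) {r ε : ℝ} (hr : 0 < r) (hε : 0 < ε) :
    ∀ᶠ n : ℕ in atTop,
      ENNReal.ofReal (Real.exp (-(n * (⟪θ, ξ⟫ - Λ θ + ε)))) ≤ Q n (Metric.ball ξ r) := by
  have hθ1 : 0 < ‖θ‖ + 1 := by positivity
  set s : ℝ := min r (ε / (2 * (‖θ‖ + 1))) with hs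
  have hs0 : 0 < s := lt_min hr (by positivity)
  have hsθ : ‖θ‖ * s ≤ ε / 2 := by
    have h1 : s ≤ ε / (2 * (‖θ‖ + 1)) := min_le_right _ _
    rw [le_div_iff₀ (by positivity)] at h1
    nlinarith
  -- Under the tilt by `θ` the mass concentrates at `ξ`: the total mass is subexponential, while the
  -- mass away from `ξ` decays exponentially.
  let R := SpaceTimeRWRE.expTilt Q θ (Λ θ)
  have hK : IsCompact (Metric.closedBall (0 : E) 1 \ Metric.ball ξ s) :=
    have : ProperSpace E := FiniteDimensional.proper_real E
    (isCompact_closedBall 0 1).diff Metric.isOpen_ball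
  obtain ⟨ε₀, hε₀, hdecay⟩ : ∃ ε₀ : ℝ, 0 < ε₀ ∧ ∀ᶠ n : ℕ in atTop,
      R n (Metric.closedBall 0 1 \ Metric.ball ξ s) ≤
        ENNReal.ofReal (Real.exp (-(n * (0 + ε₀)))) := by
    refine HasExpRate.exists_decay hK fun y hy => ?_
    -- A slight further tilt towards `y` suffices: for small t, Λ(θ + t v) - Λ(θ) is t⟨ξ, v⟩ up to
    -- o(t), whereas ⟨t v, y⟩ exceeds t⟨ξ, v⟩ by t‖v‖².
    set v : E := y - ξ with hv
    have hv0 : 0 < ‖v‖ := by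
      have h1 : ¬ dist y ξ < s := hy.2
      rw [dist_eq_norm] at h1
      linarith
    have hlo := (hasGradientAt_iff_hasFDerivAt.1 hgrad).isLittleO.def (half_pos hv0)
    have htend : Tendsto (fun t : ℝ => θ + t • v) (𝓝[>] 0) (𝓝 θ) := by
      have : Continuous fun t : ℝ => θ + t • v := by fun_prop
      have h2 := this.tendsto 0
      simp only [zero_smul, add_zero] at h2
      exact h2.mono_left nhdsWithin_le_nhds
    obtain ⟨t, ⟨ht1, ht2⟩, ht0⟩ :=
      ((htend.eventually (hlo.and hrate)).and self_mem_nhdsWithin).exists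
    have ht0' : 0 < t := ht0
    refine ⟨t • v, Λ (θ + t • v) - Λ θ, ht2.expTilt _, ?_⟩
    rw [add_sub_cancel_left, InnerProductSpace.toDual_apply_apply, norm_smul, Real.norm_eq_abs,
      Real.norm_eq_abs, abs_of_pos ht0', inner_smul_right] at ht1
    have h3 := (abs_le.1 ht1).2
    have h4 : ⟪v, y⟫ = ⟪ξ, v⟫ + ‖v‖ ^ 2 := by
      rw [← real_inner_self_eq_norm_sq, real_inner_comm v ξ, ← inner_add_right, hv]
      congr 1
      abel
    rw [real_inner_smul_left, h4]
    have : 0 < t * ‖v‖ ^ 2 := by positivity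
    nlinarith
  set e : ℝ := min (ε₀ / 2) (ε / 4) with he
  have he0 : 0 < e := lt_min (by linarith) (by linarith)
  have hmass : HasExpRate R 0 (Λ θ - Λ θ) := HasExpRate.expTilt (by
    rw [add_zero]; exact hrate.self_of_nhds) _
  have hlarge : ∀ᶠ n : ℕ in atTop, Real.log 2 ≤ n * e :=
    (tendsto_natCast_atTop_atTop.atTop_mul_const he0).eventually_ge_atTop _
  filter_upwards [hdecay, hmass e he0, hlarge] with n hn1 hn2 hn3
  have hn0 : (0 : ℝ) ≤ n := n.cast_nonneg
  have hR0 : R n (Metric.closedBall 0 1)ᶜ = 0 := by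
    refine withDensity_absolutelyContinuous _ _ ?_
    refine measure_mono_null (fun x hx => ?_) (ae_iff.1 (hsupp n))
    simpa using hx
  have hRle : ENNReal.ofReal (Real.exp (-(n * (2 * e)))) ≤ R n (Metric.ball ξ s) := by
    have h1 : ENNReal.ofReal (Real.exp (-(n * (2 * e)))) +
        ENNReal.ofReal (Real.exp (-(n * (2 * e)))) ≤ R n (Metric.ball ξ s) +
          ENNReal.ofReal (Real.exp (-(n * (2 * e)))) := by
      calc ENNReal.ofReal (Real.exp (-(n * (2 * e)))) + ENNReal.ofReal (Real.exp (-(n * (2 * e))))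
          = ENNReal.ofReal (2 * Real.exp (-(n * (2 * e)))) := by
            rw [← ENNReal.ofReal_add (Real.exp_pos _).le (Real.exp_pos _).le, two_mul (Real.exp _)]
        _ ≤ ENNReal.ofReal (Real.exp (n * (Λ θ - Λ θ - e))) := by
            refine ENNReal.ofReal_le_ofReal ?_
            refine two_mul_exp_le ?_
            linarith
        _ ≤ R n Set.univ := by
            refine hn2.1.trans (le_of_eq ?_)
            simp
        _ ≤ R n (Metric.ball ξ s) + (R n (Metric.closedBall 0 1 \ Metric.ball ξ s) +
              R n (Metric.closedBall 0 1)ᶜ) := by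
            refine (measure_mono fun x _ => ?_).trans
              ((measure_union_le _ _).trans (add_le_add le_rfl (measure_union_le _ _)))
            by_cases h1 : x ∈ Metric.ball ξ s
            · exact Or.inl h1
            · by_cases h2 : x ∈ Metric.closedBall (0 : E) 1
              · exact Or.inr (Or.inl ⟨h2, h1⟩)
              · exact Or.inr (Or.inr h2)
        _ ≤ _ := by
            rw [hR0, add_zero]
            refine add_le_add le_rfl (hn1.trans ?_)
            refine ENNReal.ofReal_le_ofReal (Real.exp_le_exp.2 ?_)
            have h2 : 2 * e ≤ ε₀ := by
              have := min_le_left (ε₀ / 2) (ε / 4)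
              linarith
            have := mul_le_mul_of_nonneg_left h2 hn0
            linarith
    exact (ENNReal.add_le_add_iff_right ENNReal.ofReal_ne_top).1 h1
  -- On the small ball the tilting density is nearly constant, by the choice of `s`, so the mass
  -- found there can be untilted at a cost of ε/2.
  have hRQ : R n (Metric.ball ξ s) ≤ ENNReal.ofReal (Real.exp (n * (⟪θ, ξ⟫ - Λ θ + ε / 2))) *
      Q n (Metric.ball ξ r) := by
    calc R n (Metric.ball ξ s)
        = ∫⁻ x in Metric.ball ξ s, ENNReal.ofReal (Real.exp (n * (⟪θ, x⟫ - Λ θ))) ∂(Q n) :=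
          withDensity_apply _ Metric.isOpen_ball.measurableSet
      _ ≤ ∫⁻ _x in Metric.ball ξ s,
          ENNReal.ofReal (Real.exp (n * (⟪θ, ξ⟫ - Λ θ + ε / 2))) ∂(Q n) := by
          refine setLIntegral_mono' Metric.isOpen_ball.measurableSet fun x hx => ?_
          refine ENNReal.ofReal_le_ofReal (Real.exp_le_exp.2 ?_)
          refine mul_le_mul_of_nonneg_left ?_ hn0
          have h1 : ⟪θ, x - ξ⟫ ≤ ‖θ‖ * s := by
            refine (real_inner_le_norm _ _).trans (mul_le_mul_of_nonneg_left ?_ (norm_nonneg _))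
            rw [← dist_eq_norm]
            exact le_of_lt hx
          rw [inner_sub_right] at h1
          linarith
      _ = ENNReal.ofReal (Real.exp (n * (⟪θ, ξ⟫ - Λ θ + ε / 2))) * Q n (Metric.ball ξ s) := by
          rw [setLIntegral_const]
      _ ≤ _ := mul_le_mul' le_rfl (measure_mono (Metric.ball_subset_ball (min_le_left _ _)))
  calc ENNReal.ofReal (Real.exp (-(n * (⟪θ, ξ⟫ - Λ θ + ε))))
      ≤ ENNReal.ofReal (Real.exp (-(n * (⟪θ, ξ⟫ - Λ θ + ε / 2)))) *
          ENNReal.ofReal (Real.exp (-(n * (2 * e)))) := by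
        rw [ofReal_exp_mul]
        refine ENNReal.ofReal_le_ofReal (Real.exp_le_exp.2 ?_)
        have h2 : 2 * e ≤ ε / 2 := by
          have := min_le_right (ε₀ / 2) (ε / 4)
          linarith
        have := mul_le_mul_of_nonneg_left h2 hn0
        linarith
    _ ≤ ENNReal.ofReal (Real.exp (-(n * (⟪θ, ξ⟫ - Λ θ + ε / 2)))) *
          (ENNReal.ofReal (Real.exp (n * (⟪θ, ξ⟫ - Λ θ + ε / 2))) * Q n (Metric.ball ξ r)) :=
        mul_le_mul' le_rfl (hRle.trans hRQ)
    _ = Q n (Metric.ball ξ r) := by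
        rw [← mul_assoc, ofReal_exp_mul]
        simp

end ExpRate

/-! ### Logarithmic rates in the extended reals -/

theorem inv_mul_log_le {x : ℝ≥0∞} {n : ℕ} (hn : 0 < n) {a : ℝ}
    (h : x ≤ ENNReal.ofReal (Real.exp (-(n * a)))) :
    (((n : ℝ)⁻¹ : ℝ) : EReal) * ENNReal.log x ≤ ((-a : ℝ) : EReal) := by
  have h1 := ENNReal.log_le_log h
  rw [ENNReal.log_ofReal_of_pos (Real.exp_pos _), Real.log_exp] at h1
  have h0 : (0 : EReal) ≤ (((n : ℝ)⁻¹ : ℝ) : EReal) := EReal.coe_nonneg.2 (by positivity)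
  refine (mul_le_mul_of_nonneg_left h1 h0).trans (le_of_eq ?_)
  rw [← EReal.coe_mul]
  congr 1
  field_simp

theorem le_inv_mul_log {x : ℝ≥0∞} {n : ℕ} (hn : 0 < n) {a : ℝ}
    (h : ENNReal.ofReal (Real.exp (-(n * a))) ≤ x) :
    ((-a : ℝ) : EReal) ≤ (((n : ℝ)⁻¹ : ℝ) : EReal) * ENNReal.log x := by
  have h1 := ENNReal.log_le_log h
  rw [ENNReal.log_ofReal_of_pos (Real.exp_pos _), Real.log_exp] at h1
  have h0 : (0 : EReal) ≤ (((n : ℝ)⁻¹ : ℝ) : EReal) := EReal.coe_nonneg.2 (by positivity)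
  refine le_trans (le_of_eq ?_) (mul_le_mul_of_nonneg_left h1 h0)
  rw [← EReal.coe_mul]
  congr 1
  field_simp

/-! ### Strict convexity of the logarithmic moment generating function -/

section Convexity

variable {ρ : Measure (SiteEnv d)} [IsProbabilityMeasure ρ]

/-- The mean step under the tilt by `θ`. -/
def tiltedVelocity (ρ : Measure (SiteEnv d)) [IsProbabilityMeasure ρ]
    (θ : EuclideanSpace ℝ (Fin d)) : EuclideanSpace ℝ (Fin d) :=
  ∑ z : Step d, (meanProb ρ z * tiltWeight ρ θ z) • toVec z.1

theorem exp_logMGF (ρ : Measure (SiteEnv d)) [IsProbabilityMeasure ρ]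
    (θ : EuclideanSpace ℝ (Fin d)) :
    Real.exp (logMGF ρ θ) = ∑ z : Step d, meanProb ρ z * Real.exp ⟪θ, toVec z.1⟫ :=
  Real.exp_log (mgf_pos ρ θ)

theorem hasGradientAt_logMGF (θ : EuclideanSpace ℝ (Fin d)) :
    HasGradientAt (logMGF ρ) (tiltedVelocity ρ θ) θ := by
  rw [hasGradientAt_iff_hasFDerivAt]
  have h1 : ∀ z ∈ (Finset.univ : Finset (Step d)), HasFDerivAt
      (fun θ : EuclideanSpace ℝ (Fin d) => meanProb ρ z * Real.exp ⟪θ, toVec z.1⟫)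
      (meanProb ρ z • Real.exp ⟪θ, toVec z.1⟫ •
        InnerProductSpace.toDual ℝ (EuclideanSpace ℝ (Fin d)) (toVec z.1)) θ := fun z _ => by
    have h2 : HasFDerivAt (fun θ : EuclideanSpace ℝ (Fin d) => ⟪θ, toVec z.1⟫)
        (InnerProductSpace.toDual ℝ (EuclideanSpace ℝ (Fin d)) (toVec z.1)) θ := by
      have := (InnerProductSpace.toDual ℝ (EuclideanSpace ℝ (Fin d)) (toVec z.1)).hasFDerivAt
        (x := θ)
      refine this.congr_of_eventuallyEq (Eventually.of_forall fun θ' => ?_)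
      change ⟪θ', toVec z.1⟫ = _
      rw [InnerProductSpace.toDual_apply_apply, real_inner_comm]
    exact h2.exp.const_mul _
  refine ((HasFDerivAt.fun_sum h1).log (mgf_pos ρ θ).ne').congr_fderiv ?_
  ext v
  simp only [tiltedVelocity, tiltWeight, map_sum, map_smul, Real.exp_sub, exp_logMGF,
    FunLike.coe_smul, FunLike.coe_sum, Finset.sum_apply, Pi.smul_apply, smul_eq_mul,
    Finset.mul_sum]
  refine Finset.sum_congr rfl fun z _ => ?_
  ring

theorem eq_tiltedVelocity_of_hasGradientAt {θ ξ : EuclideanSpace ℝ (Fin d)}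
    (h : HasGradientAt (logMGF ρ) ξ θ) : ξ = tiltedVelocity ρ θ :=
  h.unique (hasGradientAt_logMGF θ)

/-- Strict convexity of `Λ_c`. -/
theorem inner_lt_logMGF_sub (hq : ∀ z, 0 < meanProb ρ z) {θ θ' : EuclideanSpace ℝ (Fin d)}
    (hne : θ' ≠ θ) :
    ⟪θ' - θ, tiltedVelocity ρ θ⟫ < logMGF ρ θ' - logMGF ρ θ := by
  set φ := θ' - θ with hφ
  set ξ := tiltedVelocity ρ θ with hξ
  let p : Step d → ℝ := fun z => meanProb ρ z * tiltWeight ρ θ z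
  have hp : ∀ z, 0 < p z := fun z => mul_pos (hq z) (tiltWeight_pos ρ θ z)
  have hp1 : ∑ z, p z = 1 := sum_meanProb_mul_tiltWeight ρ θ
  have hmean : ∑ z : Step d, p z * ⟪φ, toVec z.1⟫ = ⟪φ, ξ⟫ := by
    rw [hξ, tiltedVelocity, inner_sum]
    simp only [inner_smul_right, p]
  -- If φ had the same product with every step, then comparing e_i with -e_i would force φ = 0. So
  -- the tilted step is not constant in the direction φ, and exp x ≥ 1 + x is strict for some step.
  obtain ⟨z₀, hz₀⟩ : ∃ z : Step d, ⟪φ, toVec z.1⟫ - ⟪φ, ξ⟫ ≠ 0 := by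
    by_contra! hall
    refine hne (sub_eq_zero.1 ?_)
    rw [← hφ]
    ext i
    have h1 := hall (unitStep i)
    have h2 := hall (negUnitStep i)
    have h3 : toVec (unitStep i).1 = EuclideanSpace.single i 1 := by
      ext j
      simp [toVec, unitStep, Pi.single_apply]
    have h4 : toVec (negUnitStep i).1 = -EuclideanSpace.single i 1 := by
      ext j
      by_cases h : j = i
      · subst h; simp [toVec, negUnitStep]
      · simp [toVec, negUnitStep, h]
    rw [h3] at h1
    rw [h4, inner_neg_right] at h2
    have h5 : ⟪φ, EuclideanSpace.single i (1 : ℝ)⟫ = 0 := by linarith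
    simpa [EuclideanSpace.inner_single_right] using h5
  have hexp : Real.exp (logMGF ρ θ' - logMGF ρ θ - ⟪φ, ξ⟫) =
      ∑ z : Step d, p z * Real.exp (⟪φ, toVec z.1⟫ - ⟪φ, ξ⟫) := by
    rw [Real.exp_sub, Real.exp_sub, exp_logMGF ρ θ', Finset.sum_div, Finset.sum_div]
    refine Finset.sum_congr rfl fun z _ => ?_
    simp only [p, tiltWeight, hφ, inner_sub_left, Real.exp_sub]
    field_simp
  have hlt : ∑ z : Step d, p z * (1 + (⟪φ, toVec z.1⟫ - ⟪φ, ξ⟫)) <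
      ∑ z : Step d, p z * Real.exp (⟪φ, toVec z.1⟫ - ⟪φ, ξ⟫) := by
    refine Finset.sum_lt_sum (fun z _ => ?_) ⟨z₀, Finset.mem_univ _, ?_⟩
    · refine mul_le_mul_of_nonneg_left ?_ (hp z).le
      rw [add_comm]
      exact Real.add_one_le_exp _
    · refine mul_lt_mul_of_pos_left ?_ (hp z₀)
      rw [add_comm]
      exact Real.add_one_lt_exp hz₀
  have hone : ∑ z : Step d, p z * (1 + (⟪φ, toVec z.1⟫ - ⟪φ, ξ⟫)) = 1 := by
    simp only [mul_add, mul_sub, mul_one, Finset.sum_add_distrib, Finset.sum_sub_distrib,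
      ← Finset.sum_mul, hp1, hmean]
    ring
  rw [hone, ← hexp, Real.one_lt_exp_iff] at hlt
  linarith

theorem inner_le_logMGF_sub (hq : ∀ z, 0 < meanProb ρ z) (θ θ' : EuclideanSpace ℝ (Fin d)) :
    ⟪θ' - θ, tiltedVelocity ρ θ⟫ ≤ logMGF ρ θ' - logMGF ρ θ := by
  rcases eq_or_ne θ' θ with rfl | hne
  · simp
  · exact (inner_lt_logMGF_sub hq hne).le

theorem tiltedVelocity_injective (hq : ∀ z, 0 < meanProb ρ z) :
    Function.Injective (tiltedVelocity ρ) := by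
  intro θ θ' h
  by_contra hne
  have h1 := inner_lt_logMGF_sub (ρ := ρ) hq (θ := θ) (θ' := θ') (Ne.symm hne)
  have h2 := inner_lt_logMGF_sub (ρ := ρ) hq (θ := θ') (θ' := θ) hne
  rw [← h, ← neg_sub, inner_neg_left] at h2
  linarith

theorem tiltedVelocity_zero : tiltedVelocity ρ 0 = meanVelocity ρ := by
  simp [tiltedVelocity, meanVelocity, tiltWeight, logMGF_zero]

/-- Velocities close to `ξ_o` are reached by small tilts. -/
theorem exists_tilt (hq : ∀ z, 0 < meanProb ρ z) {δ : ℝ} (hδ : 0 < δ) :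
    ∃ η : ℝ, 0 < η ∧ ∀ ξ, ‖ξ - meanVelocity ρ‖ ≤ η →
      ∃ θ, ‖θ‖ < δ ∧ tiltedVelocity ρ θ = ξ := by
  have hcont := continuous_logMGF ρ
  -- On the sphere, strict convexity keeps Λ_c(θ) - ⟨θ, ξ_o⟩ at least `c > 0`. Moving ξ_o by at most
  -- c/δ lowers this by at most c/2, so the minimizer over the closed ball is interior and its
  -- gradient condition is the required equation.
  obtain ⟨c, hc0, hc⟩ := (isCompact_sphere (0 : EuclideanSpace ℝ (Fin d)) (δ / 2)).exists_forall_le'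
    (f := fun θ => logMGF ρ θ - ⟪θ, meanVelocity ρ⟫) (by fun_prop) (a := 0) fun θ hθ => by
      have hne : θ ≠ 0 := by
        rintro rfl
        simp only [mem_sphere_iff_norm, sub_self, norm_zero] at hθ
        linarith
      have := inner_lt_logMGF_sub hq hne
      rw [tiltedVelocity_zero, sub_zero, logMGF_zero, sub_zero] at this
      linarith
  refine ⟨c / δ, div_pos hc0 hδ, fun ξ hξ => ?_⟩
  obtain ⟨θ, hθmem, hθ⟩ := (isCompact_closedBall (0 : EuclideanSpace ℝ (Fin d))
    (δ / 2)).exists_isMinOn ⟨0, Metric.mem_closedBall_self (half_pos hδ).le⟩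
    (f := fun θ => logMGF ρ θ - ⟪θ, ξ⟫) (by fun_prop)
  rw [mem_closedBall_zero_iff] at hθmem
  have hlt : ‖θ‖ < δ / 2 := by
    refine lt_of_le_of_ne hθmem fun heq => ?_
    have h1 : logMGF ρ θ - ⟪θ, ξ⟫ ≤ logMGF ρ 0 - ⟪0, ξ⟫ :=
      hθ (Metric.mem_closedBall_self (half_pos hδ).le)
    have h2 := hc θ (by simpa using heq)
    have h3 : ⟪θ, ξ - meanVelocity ρ⟫ ≤ δ / 2 * (c / δ) := by
      refine (real_inner_le_norm _ _).trans ?_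
      rw [heq]
      exact mul_le_mul_of_nonneg_left hξ (half_pos hδ).le
    have h4 : δ / 2 * (c / δ) = c / 2 := by field_simp
    rw [inner_sub_right] at h3
    rw [logMGF_zero, inner_zero_left] at h1
    linarith
  refine ⟨θ, by linarith, ?_⟩
  have hloc : IsLocalMin (fun θ => logMGF ρ θ - ⟪θ, ξ⟫) θ := by
    refine hθ.isLocalMin (Filter.mem_of_superset (Metric.isOpen_ball.mem_nhds ?_)
      Metric.ball_subset_closedBall)
    simpa using hlt
  have hder := (hasGradientAt_iff_hasFDerivAt.1 (hasGradientAt_logMGF (ρ := ρ) θ)).sub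
    ((InnerProductSpace.toDual ℝ (EuclideanSpace ℝ (Fin d)) ξ).hasFDerivAt (x := θ))
  have hfun : (fun θ => logMGF ρ θ - ⟪θ, ξ⟫) =
      logMGF ρ - ⇑(InnerProductSpace.toDual ℝ (EuclideanSpace ℝ (Fin d)) ξ) := by
    funext θ'
    rw [Pi.sub_apply, InnerProductSpace.toDual_apply_apply, real_inner_comm]
  rw [hfun] at hloc
  have := hloc.hasFDerivAt_eq_zero hder
  exact (InnerProductSpace.toDual ℝ (EuclideanSpace ℝ (Fin d))).injective (sub_eq_zero.1 this)

/-- The tangent inequality for the convex function Λ_c at `θ` says that the supremum is attained at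
`θ`. -/
theorem averagedRate_tiltedVelocity (hq : ∀ z, 0 < meanProb ρ z)
    (θ : EuclideanSpace ℝ (Fin d)) :
    averagedRate ρ (tiltedVelocity ρ θ) =
      ((⟪θ, tiltedVelocity ρ θ⟫ - logMGF ρ θ : ℝ) : EReal) := by
  refine le_antisymm (iSup_le fun θ' => EReal.coe_le_coe_iff.2 ?_)
    (le_iSup (fun θ' => ((⟪θ', tiltedVelocity ρ θ⟫ - logMGF ρ θ' : ℝ) : EReal)) θ)
  have := inner_le_logMGF_sub hq θ θ'
  rw [inner_sub_left] at this
  linarith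

theorem averagedRate_nonneg (ρ : Measure (SiteEnv d)) [IsProbabilityMeasure ρ]
    (ξ : EuclideanSpace ℝ (Fin d)) : 0 ≤ averagedRate ρ ξ := by
  refine le_trans (le_of_eq ?_)
    (le_iSup (fun θ' => ((⟪θ', ξ⟫ - logMGF ρ θ' : ℝ) : EReal)) 0)
  simp [logMGF_zero]

theorem lowerSemicontinuous_averagedRate (ρ : Measure (SiteEnv d)) [IsProbabilityMeasure ρ] :
    LowerSemicontinuous (averagedRate ρ) :=
  lowerSemicontinuous_iSup fun θ =>
    (continuous_coe_real_ereal.comp (by fun_prop :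
      Continuous fun ξ : EuclideanSpace ℝ (Fin d) => ⟪θ, ξ⟫ - logMGF ρ θ)).lowerSemicontinuous

end Convexity

/-! ### The quenched large deviation principle -/

section LargeDeviations

theorem norm_toVec_step (z : Step d) : ‖toVec z.1‖ ≤ 1 := by
  have h1 : ∀ i, |z.1 i| ≤ 1 := fun i =>
    (Finset.single_le_sum (f := fun i => |z.1 i|) (fun j _ => abs_nonneg _)
      (Finset.mem_univ i)).trans z.2.le
  rw [EuclideanSpace.norm_eq, Real.sqrt_le_one]
  have h2 : ∑ i, |z.1 i| ^ 2 ≤ ∑ i, |z.1 i| := Finset.sum_le_sum fun i _ => by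
    have := abs_nonneg (z.1 i)
    nlinarith [h1 i]
  rw [z.2] at h2
  have h3 : ((∑ i, |z.1 i| ^ 2 : ℤ) : ℝ) ≤ 1 := by exact_mod_cast h2
  simpa [toVec] using h3

theorem norm_toVec_pathPos {n : ℕ} (z : Fin n → Step d) : ‖toVec (pathPos z n)‖ ≤ n := by
  have h1 : toVec (pathPos z n) = ∑ i, toVec (z i).1 := by
    ext j
    simp [pathPos, toVec]
  rw [h1]
  refine (norm_sum_le _ _).trans ((Finset.sum_le_sum fun i _ => norm_toVec_step (z i)).trans ?_)
  simp

theorem quenchedVelocityLaw_ae_norm_le (ω : Env d) (n : ℕ) :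
    ∀ᵐ x ∂(quenchedVelocityLaw ω n), ‖x‖ ≤ 1 := by
  have hs : MeasurableSet {x : EuclideanSpace ℝ (Fin d) | ¬ ‖x‖ ≤ 1} :=
    (measurableSet_le measurable_norm measurable_const).compl
  rw [ae_iff, quenchedVelocityLaw, Measure.coe_finsetSum, Finset.sum_apply]
  refine Finset.sum_eq_zero fun z _ => ?_
  rw [Measure.smul_apply, Measure.dirac_apply' _ hs, Set.indicator_of_notMem, smul_zero]
  rw [Set.mem_ofPred_eq, not_not, norm_smul, norm_inv, Real.norm_natCast]
  rcases Nat.eq_zero_or_pos n with rfl | hn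
  · simp
  · rw [inv_mul_le_one₀ (by exact_mod_cast hn)]
    exact norm_toVec_pathPos z

theorem lintegral_exp_quenchedVelocityLaw (ρ : Measure (SiteEnv d)) [IsProbabilityMeasure ρ]
    (θ : EuclideanSpace ℝ (Fin d)) (ω : Env d) (n : ℕ) :
    ∫⁻ x, ENNReal.ofReal (Real.exp (n * ⟪θ, x⟫)) ∂(quenchedVelocityLaw ω n) =
      ENNReal.ofReal (Real.exp (n * logMGF ρ θ) * polymer ρ θ n ω) := by
  have hm : Measurable fun x : EuclideanSpace ℝ (Fin d) =>
      ENNReal.ofReal (Real.exp (n * ⟪θ, x⟫)) := by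
    simpa using measurable_ofReal_exp_inner θ n 0
  rw [quenchedVelocityLaw, lintegral_finsetSum_measure, polymer, Finset.mul_sum,
    ENNReal.ofReal_sum_of_nonneg fun z _ =>
      mul_nonneg (Real.exp_pos _).le (pathWeight_nonneg ρ θ ω z)]
  refine Finset.sum_congr rfl fun z _ => ?_
  rw [lintegral_smul_measure, lintegral_dirac' _ hm, smul_eq_mul,
    ← ENNReal.ofReal_mul (quenchedProb_nonneg ω z), pathWeight, mul_left_comm, ← Real.exp_add]
  congr 3
  rcases Nat.eq_zero_or_pos n with rfl | hn
  · simp [pathPos, toVec_zero]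
  · rw [inner_smul_right]
    field_simp
    ring

/-- The quenched and averaged exponential moments differ by the factor W_n, which is subexponential
both ways once it converges to a positive limit. -/
theorem hasExpRate_quenchedVelocityLaw (ρ : Measure (SiteEnv d)) [IsProbabilityMeasure ρ]
    (θ : EuclideanSpace ℝ (Fin d)) (ω : Env d) {u : ℝ} (hu : 0 < u)
    (h : Tendsto (fun n => polymer ρ θ n ω) atTop (𝓝 u)) :
    HasExpRate (quenchedVelocityLaw ω) θ (logMGF ρ θ) := by
  intro ε hε
  have hlim : Tendsto (fun n : ℕ => (n : ℝ) * ε) atTop atTop :=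
    tendsto_natCast_atTop_atTop.atTop_mul_const hε
  filter_upwards [h.eventually (lt_mem_nhds (half_lt_self hu)),
    h.eventually (gt_mem_nhds (show u < 2 * u by linarith)),
    (Real.tendsto_exp_atTop.comp hlim).eventually_ge_atTop (2 * u),
    (Real.tendsto_exp_neg_atTop_nhds_zero.comp hlim).eventually (gt_mem_nhds (half_pos hu))]
    with n h1 h2 h3 h4
  simp only [Function.comp_apply] at h3 h4
  rw [lintegral_exp_quenchedVelocityLaw ρ]
  constructor
  · refine ENNReal.ofReal_le_ofReal ?_
    rw [mul_sub, sub_eq_add_neg, Real.exp_add]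
    exact mul_le_mul_of_nonneg_left (h4.trans h1).le (Real.exp_pos _).le
  · refine ENNReal.ofReal_le_ofReal ?_
    rw [mul_add, Real.exp_add]
    exact mul_le_mul_of_nonneg_left (h2.le.trans h3) (Real.exp_pos _).le

/-- Exponential rates at all small tilts give the large deviation principle near `ξ_o`. -/
theorem ldpOn_of_hasExpRate {ρ : Measure (SiteEnv d)} [IsProbabilityMeasure ρ]
    (hq : ∀ z, 0 < meanProb ρ z) {δ η : ℝ}
    (hη : ∀ ξ, ‖ξ - meanVelocity ρ‖ ≤ η → ∃ θ, ‖θ‖ < δ ∧ tiltedVelocity ρ θ = ξ)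
    {Q : ℕ → Measure (EuclideanSpace ℝ (Fin d))} (hsupp : ∀ n, ∀ᵐ x ∂(Q n), ‖x‖ ≤ 1)
    (hrate : ∀ θ, ‖θ‖ < δ → HasExpRate Q θ (logMGF ρ θ)) :
    LDPOn (Metric.ball (meanVelocity ρ) η) Q (averagedRate ρ) := by
  refine ⟨fun x _ => averagedRate_nonneg ρ x,
    (lowerSemicontinuous_averagedRate ρ).lowerSemicontinuousOn _, fun G hG _ => ⟨?_, ?_⟩⟩
  · rw [EReal.neg_le]
    refine le_iInf₂ fun ξ hξ => ?_
    rw [EReal.neg_le]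
    obtain ⟨θ, hθ, rfl⟩ := hη ξ (by
      rw [← dist_eq_norm]
      exact le_of_lt (hG (interior_subset hξ)))
    obtain ⟨r, hr, hball⟩ := Metric.isOpen_iff.1 isOpen_interior _ hξ
    rw [averagedRate_tiltedVelocity hq]
    set b : ℝ := ⟪θ, tiltedVelocity ρ θ⟫ - logMGF ρ θ with hb
    refine le_of_forall_lt_imp_le_of_dense fun a ha => ?_
    induction a using EReal.rec with
    | bot => exact bot_le
    | top => exact absurd ha not_top_lt
    | coe a =>
      rw [← EReal.coe_neg, EReal.coe_lt_coe_iff] at ha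
      refine le_liminf_of_le (by isBoundedDefault) ?_
      have hnear : ∀ᶠ θ' in 𝓝 θ, HasExpRate Q θ' (logMGF ρ θ') := by
        have h1 : ∀ᶠ θ' in 𝓝 θ, ‖θ'‖ < δ :=
          (continuous_norm.tendsto θ).eventually (gt_mem_nhds hθ)
        exact h1.mono hrate
      filter_upwards [HasExpRate.le_measure_ball hsupp (hasGradientAt_logMGF θ) hnear hr
        (sub_pos.2 ha), eventually_gt_atTop 0] with n hn hn0
      refine le_trans (le_of_eq ?_) (le_inv_mul_log hn0
        (hn.trans (measure_mono (hball.trans interior_subset))))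
      congr 1
      linarith
  -- The closure of `G` may reach the bounding sphere, which is why tilts are needed on the closed
  -- ball.
  · have hcl : closure G ⊆ Metric.closedBall (meanVelocity ρ) η :=
      closure_minimal (hG.trans Metric.ball_subset_closedBall) Metric.isClosed_closedBall
    rw [EReal.le_neg]
    refine le_of_forall_lt_imp_le_of_dense fun a ha => ?_
    rw [EReal.le_neg]
    induction a using EReal.rec with
    | bot => simp
    | top => exact absurd ha not_top_lt
    | coe a =>
      obtain ⟨ε, hε, hdecay⟩ := HasExpRate.exists_decay (Q := Q) (a := a)
        ((isCompact_closedBall _ _).of_isClosed_subset isClosed_closure hcl) fun ξ hξ => by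
          obtain ⟨θ, hθ, rfl⟩ := hη ξ (by
            rw [← dist_eq_norm]
            exact hcl hξ)
          refine ⟨θ, logMGF ρ θ, hrate θ hθ, ?_⟩
          have h1 := ha.trans_le (iInf₂_le _ hξ)
          rwa [averagedRate_tiltedVelocity hq, EReal.coe_lt_coe_iff] at h1
      refine limsup_le_of_le (by isBoundedDefault) ?_
      filter_upwards [hdecay, eventually_gt_atTop 0] with n hn hn0
      rw [← EReal.coe_neg]
      refine inv_mul_log_le hn0 ((measure_mono subset_closure).trans (hn.trans ?_))
      refine ENNReal.ofReal_le_ofReal (Real.exp_le_exp.2 (neg_le_neg ?_))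
      exact mul_le_mul_of_nonneg_left (by linarith) n.cast_nonneg

/-- The quenched large deviation principle, given convergence of the polymer partition functions
at small tilts to positive limits. -/
theorem ae_ldpOn {ρ : Measure (SiteEnv d)} [IsProbabilityMeasure ρ]
    (hq : ∀ z, 0 < meanProb ρ z) {δ η : ℝ}
    (hη : ∀ ξ, ‖ξ - meanVelocity ρ‖ ≤ η → ∃ θ, ‖θ‖ < δ ∧ tiltedVelocity ρ θ = ξ)
    (hlim : ∀ θ : EuclideanSpace ℝ (Fin d), ‖θ‖ < δ → ∃ u : Env d → ℝ, (∀ ω, 0 < u ω) ∧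
      ∀ᵐ ω ∂(envLaw ρ), Tendsto (fun n => polymer ρ θ n ω) atTop (𝓝 (u ω))) :
    ∀ᵐ ω ∂(envLaw ρ),
      LDPOn (Metric.ball (meanVelocity ρ) η) (quenchedVelocityLaw ω) (averagedRate ρ) := by
  -- The exceptional null set depends on θ. A countable dense set of tilts provides a common one,
  -- and continuity of Λ_c recovers the remaining tilts.
  obtain ⟨D, hDc, hD⟩ := TopologicalSpace.exists_countable_dense (EuclideanSpace ℝ (Fin d))
  have hall : ∀ᵐ ω ∂(envLaw ρ), ∀ θ ∈ D, ‖θ‖ < δ →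
      HasExpRate (quenchedVelocityLaw ω) θ (logMGF ρ θ) := by
    rw [ae_ball_iff hDc]
    intro θ _
    by_cases hθ : ‖θ‖ < δ
    · obtain ⟨u, hu, h⟩ := hlim θ hθ
      exact h.mono fun ω hω _ => hasExpRate_quenchedVelocityLaw ρ θ ω (hu ω) hω
    · exact ae_of_all _ fun ω h => absurd h hθ
  refine hall.mono fun ω hω => ldpOn_of_hasExpRate hq hη (quenchedVelocityLaw_ae_norm_le ω)
    fun θ hθ => HasExpRate.of_dense (quenchedVelocityLaw_ae_norm_le ω) hD
      (continuous_logMGF ρ).continuousAt ?_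
  have h1 : ∀ᶠ θ' in 𝓝 θ, ‖θ'‖ < δ := (continuous_norm.tendsto θ).eventually (gt_mem_nhds hθ)
  exact h1.mono fun θ' hθ' hD' => hω θ' hD' hθ'

end LargeDeviations

/-! ### The fixed point equation for the density -/

section FixedPoint

variable {ρ : Measure (SiteEnv d)} [IsProbabilityMeasure ρ] {θ : EuclideanSpace ℝ (Fin d)}
  {u : Env d → ℝ}

theorem ae_fixedPoint_of_tendsto_polymer
    (hlim : ∀ᵐ ω ∂(envLaw ρ), Tendsto (fun n => polymer ρ θ n ω) atTop (𝓝 (u ω))) :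
    ∀ᵐ ω ∂(envLaw ρ), u ω = ∑ z : Step d, transProb ω 0 0 z *
      Real.exp (inner ℝ θ (toVec z.1) - logMGF ρ θ) * u (shift 1 z.1 ω) := by
  have hshift : ∀ᵐ ω ∂(envLaw ρ), ∀ z : Step d,
      Tendsto (fun n => polymer ρ θ n (shift 1 z.1 ω)) atTop (𝓝 (u (shift 1 z.1 ω))) :=
    ae_all_iff.2 fun z => (measurePreserving_shift ρ 1 z.1).quasiMeasurePreserving.ae hlim
  filter_upwards [hlim, hshift] with ω h1 h2
  refine tendsto_nhds_unique ((tendsto_add_atTop_iff_nat 1).2 h1) ?_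
  simp only [polymer_succ]
  exact tendsto_finsetSum _ fun z _ => (h2 z).const_mul _

theorem IsFutureDensity.integral_eq_one (hu : IsFutureDensity ρ θ u) :
    ∫ ω, u ω ∂(envLaw ρ) = 1 := by
  have := nonempty_of_isProbabilityMeasure ρ
  have hp : IsProbabilityMeasure ((walkLaw ρ θ).map walkEnv) :=
    Measure.isProbabilityMeasure_map measurable_walkEnv.aemeasurable
  have h1 := hu.density Set.univ MeasurableSet.univ
  rw [measure_univ, Measure.restrict_univ] at h1
  rw [integral_eq_lintegral_of_nonneg_ae (ae_of_all _ fun ω => (hu.pos ω).le)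
    hu.measurable'.aestronglyMeasurable, ← h1, ENNReal.toReal_one]

theorem isProbabilityMeasure_doobKernel (hpos : ∀ ω, 0 < u ω) {ω : Env d}
    (h : u ω = ∑ z : Step d, transProb ω 0 0 z *
      Real.exp (inner ℝ θ (toVec z.1) - logMGF ρ θ) * u (shift 1 z.1 ω)) :
    IsProbabilityMeasure (doobKernel ρ θ u ω) := by
  constructor
  rw [doobKernel, Measure.coe_finsetSum, Finset.sum_apply]
  simp only [Measure.smul_apply, measure_univ, smul_eq_mul, mul_one]
  rw [← ENNReal.ofReal_sum_of_nonneg fun z _ => mul_nonneg (mul_nonneg (transProb_nonneg _ _ _ _)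
    (div_pos (hpos _) (hpos _)).le) (Real.exp_pos _).le, ← ENNReal.ofReal_one]
  congr 1
  rw [← div_self (hpos ω).ne']
  conv_rhs => rw [div_eq_mul_inv]; enter [1]; rw [h]
  rw [Finset.sum_mul]
  refine Finset.sum_congr rfl fun z _ => ?_
  rw [div_eq_mul_inv]
  ring

end FixedPoint

end SpaceTimeRWRE

end

/-! ### Assembly of the theorem. -/

theorem theorem1p20 (d : ℕ) (hd : 3 ≤ d)
    (ρ : MeasureTheory.Measure (SpaceTimeRWRE.SiteEnv d))
    [MeasureTheory.IsProbabilityMeasure ρ]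
    (c₁ : ℝ) (hc₁ : 0 < c₁)
    (hell : ∀ z : SpaceTimeRWRE.Step d,
      ∀ᵐ ω ∂(SpaceTimeRWRE.envLaw ρ), c₁ ≤ SpaceTimeRWRE.transProb ω 0 0 z) :
    ∃ η : ℝ, 0 < η ∧
      -- the quenched LDP holds with rate `I_c` in the `η`-neighborhood of `ξ_o`
      (∀ᵐ ω ∂(SpaceTimeRWRE.envLaw ρ),
        SpaceTimeRWRE.LDPOn (Metric.ball (SpaceTimeRWRE.meanVelocity ρ) η)
          (SpaceTimeRWRE.quenchedVelocityLaw ω) (SpaceTimeRWRE.averagedRate ρ)) ∧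
      ∀ ξ : EuclideanSpace ℝ (Fin d), ‖ξ - SpaceTimeRWRE.meanVelocity ρ‖ < η →
        -- `θ` is the unique solution of `ξ = ∇Λ_c(θ)`
        ∃ θ : EuclideanSpace ℝ (Fin d),
          HasGradientAt (SpaceTimeRWRE.logMGF ρ) ξ θ ∧
          (∀ θ', HasGradientAt (SpaceTimeRWRE.logMGF ρ) ξ θ' → θ' = θ) ∧
          -- `μbar` is the measure on `Ω × U^ℕ` attached to `ξ`
          ∃ μbar : MeasureTheory.Measure
              (SpaceTimeRWRE.Env d × (ℕ → SpaceTimeRWRE.Step d)),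
            SpaceTimeRWRE.IsTiltedMeasure ρ θ μbar ∧
            (∀ ν, SpaceTimeRWRE.IsTiltedMeasure ρ θ ν → ν = μbar) ∧
            ∃ u : SpaceTimeRWRE.Env d → ℝ,
              Measurable[SpaceTimeRWRE.futureSigma d 0] u ∧
              (∀ ω, 0 < u ω) ∧
              MeasureTheory.Integrable u (SpaceTimeRWRE.envLaw ρ) ∧
              ∫ ω, u ω ∂(SpaceTimeRWRE.envLaw ρ) = 1 ∧
              (∀ᵐ ω ∂(SpaceTimeRWRE.envLaw ρ),
                u ω = ∑ z : SpaceTimeRWRE.Step d,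
                  SpaceTimeRWRE.transProb ω 0 0 z *
                    Real.exp (inner ℝ θ (SpaceTimeRWRE.toVec z.1)
                      - SpaceTimeRWRE.logMGF ρ θ) *
                    u (SpaceTimeRWRE.shift 1 z.1 ω)) ∧
              (∀ᵐ ω ∂(SpaceTimeRWRE.envLaw ρ),
                MeasureTheory.IsProbabilityMeasure
                  (SpaceTimeRWRE.doobKernel ρ θ u ω)) ∧
              -- the induced process is the unique one with the stated properties
              ∀ P : MeasureTheory.Measure (ℕ → SpaceTimeRWRE.Env d),
                (SpaceTimeRWRE.IsStationaryMarkov (SpaceTimeRWRE.doobKernel ρ θ u) P ∧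
                    SpaceTimeRWRE.MarginalAC ρ P) ↔
                  P = μbar.map SpaceTimeRWRE.envTrajectory := by
  obtain ⟨δ, C, hδ, hC⟩ := SpaceTimeRWRE.exists_lintegral_polymer_sq_le hd ρ hc₁ hell
  have hq := SpaceTimeRWRE.meanProb_pos ρ hc₁ hell
  have hdens := fun θ (hθ : ‖θ‖ < δ) => SpaceTimeRWRE.exists_density ρ θ hc₁
    (SpaceTimeRWRE.unitStep ⟨0, by omega⟩) hell (hC θ hθ)
  -- The radius `η` is chosen so that every velocity considered comes from a tilt in the L² region.
  obtain ⟨η, hη, htilt⟩ := SpaceTimeRWRE.exists_tilt hq hδ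
  refine ⟨η, hη, SpaceTimeRWRE.ae_ldpOn hq htilt fun θ hθ => ?_, fun ξ hξ => ?_⟩
  · obtain ⟨u, -, hpos, -, hlim, -⟩ := hdens θ hθ
    exact ⟨u, hpos, hlim⟩
  · obtain ⟨θ, hθ, rfl⟩ := htilt ξ hξ.le
    obtain ⟨u, humeas, hpos, hint, hlim, hu⟩ := hdens θ hθ
    have hfd : SpaceTimeRWRE.IsFutureDensity ρ θ u := ⟨humeas, hpos, hu⟩
    have hfix := SpaceTimeRWRE.ae_fixedPoint_of_tendsto_polymer hlim
    exact ⟨θ, SpaceTimeRWRE.hasGradientAt_logMGF θ,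
      fun θ' h => SpaceTimeRWRE.tiltedVelocity_injective hq (SpaceTimeRWRE.eq_tiltedVelocity_of_hasGradientAt h).symm,
      SpaceTimeRWRE.tiltedMeasure ρ θ, SpaceTimeRWRE.isTiltedMeasure_tiltedMeasure ρ θ,
      fun ν hν => hν.unique (SpaceTimeRWRE.isTiltedMeasure_tiltedMeasure ρ θ),
      u, humeas, hpos, hint, hfd.integral_eq_one, hfix,
      hfix.mono fun ω hω => SpaceTimeRWRE.isProbabilityMeasure_doobKernel hpos hω,
      hfd.stationary_iff⟩
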